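/- **Setting.** Let $n$ be a power of two, $\omega=e^{2\pi i/n}$, and index signals by $[n]=\mathbb Z_n$, with circular absolute value $|\cdot|_\circ$ and orthonormal Fourier transform $\hat x_f=n^{-1/2}\sum_i\omega^{-if}x_i$, inverse $\mathcal F^{-1}$. A *flat filter* with $B$ buckets and sharpness $F$ is a symmetric $G:\mathbb Z_n\to[0,1]$ with $G_j\ge 1-(1/4)^{F-1}$ for $|j|_\circ\le n/(2B)$ and $G_j\le (1/4)^{F-1}\big(n/(B|j|_\circ)\big)^{F-1}$ for $|j|_\circ\ge n/B$. For $\sigma$ invertible mod $n$ and $q,a\in[n]$ put $\pi(i)=\sigma(i-q)$, $h(i)=\mathrm{round}(\tfrac Bn\pi(i))$, $o_i(j)=\pi(j)-\tfrac nB h(i)$, and $(P_{\sigma,a,q}y)_i=y_{\sigma(i-a)}\omega^{i\sigma q}$. Given $\hat x$ and a vector $\hat\chi'$ approximating $\hat\chi$, *HashToBins* returns $u_j=\sqrt n\,\mathcal F^{-1}\big(\hat G\cdot P_{\sigma,a,q}(\hat x-\hat\chi')\big)_{(n/B)j}$, where at each call $\|\hat\chi-\hat\chi'\|_\infty\le \|\chi\|_2\,n^{-c}$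 ($c$ is the precision exponent). *EstimateValues* on a list $L$ returns, for $i\in L$, the median (separately for real and imaginary parts) over its measurements of $G_{o_i(i)}^{-1}u_{h(i)}\omega^{-a\sigma i}$, and $0$ for $i\notin L$. **Parameters.** $\delta\in(0,1/2)$; $R_t=C_12^t$; $B_t$ is the least power of two that is $\ge C_2k/R_t^2$; $T=\lceil\frac1{1-\delta}\log_2\log_2(k+1)\rceil+C_T$. For $1\le t\le T$, $1\le s\le R_t$ the seeds $(\sigma_{t,s},q_{t,s},a_{t,s})$ are independent and uniform; $\pi_{t,s}$ denotes the corresponding permutation. Round $t$ uses a flat filter $G_t$ with $B_t$ buckets and sharpness $8$. **Isolating partitions.** In round $t$, an element $a$ *collides* with $b\ne a$ under seed $s$ if $|\pi_{t,s}(a)-\pi_{t,s}(b)|_\circ\le\frac n{B_t}(R_t-1)$. An element of $S$ is *bad* for $Q$ in round $t$ if it collides with some element of $Q$ under more than an $R_t^{-\delta}$ fraction of the seeds $s\le R_t$. An element $a$ is *crowded* by $Q$ under seed $s$ if for some integer $p\ge0$ at least $R_t^{-3}2^{2p}$ elements $b\in Q\setminus\{a\}$ satisfy $|\pi_{t,s}(a)-\pi_{t,s}(b)|_\circ\le\frac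 n{B_t}2^p$. A partition $S=S_1\cup\dots\cup S_T$ into disjoint (possibly empty) sets is *$\delta$-isolating* if for every $t$: $|S_t|\le k\frac{R_0}{R_{t-1}}2^{-2^{(1-\delta)(t-1)}+1}$; no element of $S_t$ is crowded by $S_t$ under any round-$t$ seed; and no element of $S_t$ collides, under any round-$t$ seed, with an element of $S$ that is bad for $S_t$. *ConstructPartition* starts with $Q_1=S$ and for $t=1,2,\dots$ until $Q_t=\emptyset$ lets $Q_{t+1}$ be the union of the set $\mathrm{Bad}_t$ of elements of $S$ bad for $Q_t$, the set of elements of $Q_t$ that collide with an element of $\mathrm{Bad}_t$ under some round-$t$ seed, and the set of elements of $Q_t$ crowded by $Q_t$ under some round-$t$ seed; its output is $S_t=Q_t\setminus\bigcup_{t'>t}Q_{t'}$. **The $\ell_1$ reduction loop of Estimate.** Given $S_1,\dots,S_T$, start from $\chi=0$; for $r=0,1,\dots,\max(0,\lceil C\log_4R^*\rceil)$ and for $t=1,\dots,T$, replace $\chi$ by $\chi+\text{EstimateValues}(\chi,S_t)$ computed with the round-$t$ measurements (the same measurements for all $r$). The final vector is $\tilde\chi$. **Claim.** For every $\delta\in(0,1/2)$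 there are $K>0$, thresholds for $C_T$ and $C_1$, a threshold $c_0(A)$ for each real $A$, and, for each integer $C_1$ above its threshold, a threshold for $C_2$ depending only on $\delta$ and $C_1$, such that the following holds for all integers $C_T, C_1$ and reals $C_2$ at least these thresholds. Let $n$ be any power of two, $k\ge1$, $S\subseteq[n]$ with $|S|=k$, $x\in\mathbb C^n$, $0<R^*\le n^{A}$, $c\ge c_0(A)$, $C\ge1$, and let $G_1,\dots,G_T$ be any filters as above. If $\|x\|_\infty\le R^*\,\|x_{[n]\setminus S}\|_2/\sqrt k$, then there is an event $\mathcal E_{maj}$ over the random seeds with $\Pr[\mathcal E_{maj}]\ge 1-\frac2{25}$ such that for every outcome in $\mathcal E_{maj}$: 1. ConstructPartition terminates within $T$ passes of its loop and its output is a $\delta$-isolating partition of $S$; 2. for every $\delta$-isolating partition $S_1,\dots,S_T$ of $S$ (in particular that output), and for all approximations $\hat\chi'$ made within the stated precision, the vector $\tilde\chi$ satisfies $$\|(x-\tilde\chi)_S\|_1\le K\,\|x_{[n]\setminus S}\|_2\,\sqrt k .$$ -/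

import Mathlib

namespace SparseFourier

noncomputable section

/-! ### Signals and the orthonormal Fourier transform

Signals of length `n` are functions `ZMod n → ℂ`. For `z : ZMod n`, `ZMod.stdAddChar z` is
`ω ^ z` with `ω = exp (2 π i / n)`. -/

/-- The forward transform `x̂_f = n^{-1/2} ∑_i ω^{-i f} x_i`. -/
def dft {n : ℕ} [NeZero n] (x : ZMod n → ℂ) (f : ZMod n) : ℂ :=
  ((Real.sqrt n : ℝ) : ℂ)⁻¹ * ∑ i, ZMod.stdAddChar (-(i * f)) * x i

/-- The inverse transform `x_j = n^{-1/2} ∑_f ω^{j f} x̂_f`. -/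
def invDft {n : ℕ} [NeZero n] (y : ZMod n → ℂ) (j : ZMod n) : ℂ :=
  ((Real.sqrt n : ℝ) : ℂ)⁻¹ * ∑ f, ZMod.stdAddChar (j * f) * y f

/-- `‖x_Q‖₁`. -/
def l1On {n : ℕ} (Q : Finset (ZMod n)) (x : ZMod n → ℂ) : ℝ := ∑ i ∈ Q, ‖x i‖

/-- `‖x_Q‖₂`. -/
def l2On {n : ℕ} (Q : Finset (ZMod n)) (x : ZMod n → ℂ) : ℝ := Real.sqrt (∑ i ∈ Q, ‖x i‖ ^ 2)

/-- The circular absolute value `|z|_∘` (distance from `z` to `0` on the cycle of length `n`). -/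
def circAbs {n : ℕ} (z : ZMod n) : ℕ := z.valMinAbs.natAbs

/-! ### Filters and hashing -/

/-- Flat filter with `B` buckets and sharpness `F`. Symmetry makes its transform real. -/
structure IsFlatFilter (n B F : ℕ) (G : ZMod n → ℝ) : Prop where
  symm : ∀ j, G (-j) = G j
  nonneg : ∀ j, 0 ≤ G j
  le_one : ∀ j, G j ≤ 1
  pass : ∀ j, (circAbs j : ℝ) ≤ n / (2 * B) → 1 - (1 / 4 : ℝ) ^ (F - 1) ≤ G j
  decay : ∀ j, (n : ℝ) / B ≤ circAbs j →
    G j ≤ (1 / 4 : ℝ) ^ (F - 1) * ((n : ℝ) / (B * circAbs j)) ^ (F - 1)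

/-- The randomness `(σ, q, a)` of one measurement: `σ` is invertible mod `n` (for `n ≥ 2` a power
of two these are the odd residues), `q` is the shift and `a` the evaluation point. -/
abbrev Seed (n : ℕ) : Type := (ZMod n)ˣ × ZMod n × ZMod n

/-- The permutation `π_{σ,q}(i) = σ (i - q)`. -/
def hashPerm {n : ℕ} (h : Seed n) (i : ZMod n) : ZMod n := (h.1 : ZMod n) * (i - h.2.1)

/-- `h(i) = round ((B / n) π(i))`; only its class modulo `B` matters. -/
def bucket {n : ℕ} (B : ℕ) (h : Seed n) (i : ZMod n) : ℤ :=
  round ((B : ℚ) / n * ((hashPerm h i).val : ℚ))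

/-- The centre `(n / B) j` of bucket `j`. For `n`, `B` powers of two this number is an integer at
every bucket `j = h(i)` (also when `B > n`), so that the rounding does nothing there. -/
def bucketCenter (n B : ℕ) (j : ℤ) : ZMod n := ((round ((n : ℚ) / B * (j : ℚ)) : ℤ) : ZMod n)

/-- The offset `o_i(j) = π(j) - (n / B) h(i)`. -/
def offset {n : ℕ} (B : ℕ) (h : Seed n) (i j : ZMod n) : ZMod n :=
  hashPerm h j - bucketCenter n B (bucket B h i)

/-- `(P_{σ,a,q} y)_i = y_{σ (i - a)} ω^{i σ q}`. -/
def permSpectrum {n : ℕ} [NeZero n] (h : Seed n) (y : ZMod n → ℂ) (i : ZMod n) : ℂ :=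
  y ((h.1 : ZMod n) * (i - h.2.2)) * ZMod.stdAddChar (i * (h.1 : ZMod n) * h.2.1)

/-- `HashToBins`: from `x̂` and an approximation `chiHat` of the transform of `χ`, the value
`u_j = √n F⁻¹(Ĝ · P_{σ,a,q}(x̂ - chiHat))_{(n/B) j}`. -/
def hashToBins {n : ℕ} [NeZero n] (B : ℕ) (G : ZMod n → ℝ) (h : Seed n)
    (xHat chiHat : ZMod n → ℂ) (j : ℤ) : ℂ :=
  ((Real.sqrt n : ℝ) : ℂ) *
    invDft (fun f => dft (fun i => (G i : ℂ)) f * permSpectrum h (xHat - chiHat) f)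
      (bucketCenter n B j)

/-! ### Estimating values -/

/-- The median of `r` reals: the entry with index `⌊r / 2⌋`, counted from `0`, in increasing
order. -/
def median {r : ℕ} (u : Fin r → ℝ) : ℝ :=
  if hr : 0 < r then u (Tuple.sort u ⟨r / 2, Nat.div_lt_self hr (by norm_num)⟩) else 0

/-- The estimate `G_{o_i(i)}⁻¹ u_{h(i)} ω^{-a σ i}` of one coordinate from one measurement. -/
def singleEstimate {n : ℕ} [NeZero n] (B : ℕ) (G : ZMod n → ℝ) (h : Seed n)
    (xHat chiHat : ZMod n → ℂ) (i : ZMod n) : ℂ :=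
  ((G (offset B h i i) : ℝ) : ℂ)⁻¹ * hashToBins B G h xHat chiHat (bucket B h i) *
    ZMod.stdAddChar (-(h.2.2 * (h.1 : ZMod n) * i))

/-- `EstimateValues` on the list `L`: coordinatewise (real and imaginary part) medians over the
`r` measurements; `chiHat s` is the approximate transform of `χ` used with measurement `s`. -/
def estimateValues {n : ℕ} [NeZero n] {r : ℕ} (B : ℕ) (G : ZMod n → ℝ) (H : Fin r → Seed n)
    (xHat : ZMod n → ℂ) (chiHat : Fin r → ZMod n → ℂ) (L : Finset (ZMod n)) (i : ZMod n) : ℂ :=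
  if i ∈ L then
    ⟨median fun s => (singleEstimate B G (H s) xHat (chiHat s) i).re,
      median fun s => (singleEstimate B G (H s) xHat (chiHat s) i).im⟩
  else 0

/-! ### Parameters -/

/-- `R_t = C₁ 2^t`. -/
def numReps (C₁ t : ℕ) : ℕ := C₁ * 2 ^ t

/-- `B_t`: the least power of two that is at least `C₂ k / R_t²`. -/
def numBuckets (C₁ : ℕ) (C₂ : ℝ) (k t : ℕ) : ℕ :=
  2 ^ Nat.clog 2 ⌈C₂ * k / (numReps C₁ t : ℝ) ^ 2⌉₊

/-- `T = ⌈(1 - δ)⁻¹ log₂ log₂ (k + 1)⌉ + C_T`. -/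
def numRounds (δ : ℝ) (CT k : ℕ) : ℕ :=
  ⌈1 / (1 - δ) * Real.logb 2 (Real.logb 2 ((k : ℝ) + 1))⌉₊ + CT

/-- All random choices: `R_t` independent seeds for each round `t = 1, …, T`. The index `t : Fin T`
stands for round `t + 1` here and below. -/
abbrev Seeds (n C₁ T : ℕ) : Type := (t : Fin T) → Fin (numReps C₁ ((t : ℕ) + 1)) → Seed n

/-- Probability of an event under the uniform distribution on a finite sample space. -/
def uniformProb {Ω : Type} (E : Set Ω) : ℝ := (E.ncard : ℝ) / (Nat.card Ω : ℝ)

/-! ### Isolating partitions -/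

/-- `a` participates in an `R`-collision with another element `b`. -/
def Collides {n : ℕ} (B R : ℕ) (h : Seed n) (a b : ZMod n) : Prop :=
  a ≠ b ∧ (circAbs (hashPerm h a - hashPerm h b) : ℝ) ≤ (n : ℝ) / B * ((R : ℝ) - 1)

/-- `a` collides with an element of `Q` under more than an `R^{-δ}` fraction of the hashings. -/
def IsBad {n R : ℕ} (δ : ℝ) (B : ℕ) (H : Fin R → Seed n) (Q : Finset (ZMod n)) (a : ZMod n) :
    Prop :=
  (R : ℝ) ^ (-δ) * R < ({s : Fin R | ∃ b ∈ Q, Collides B R (H s) a b}.ncard : ℝ)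

/-- `a` is `lam`-crowded by `Q`: at some scale `p ≥ 0` at least `lam 2^{2p}` elements of
`Q \ {a}` hash to within `(n / B) 2^p` of `a`. -/
def IsCrowded {n : ℕ} (lam : ℝ) (B : ℕ) (h : Seed n) (Q : Finset (ZMod n)) (a : ZMod n) : Prop :=
  ∃ p : ℕ, lam * 2 ^ (2 * p) ≤
    ({b : ZMod n | b ∈ Q ∧ b ≠ a ∧
      (circAbs (hashPerm h b - hashPerm h a) : ℝ) ≤ (n : ℝ) / B * 2 ^ p}.ncard : ℝ)

/-- `S = P_1 ∪ … ∪ P_T` is a `δ`-isolating partition with respect to the hashings `H`. -/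
structure IsIsolating {n C₁ T : ℕ} (δ C₂ : ℝ) (k : ℕ) (S : Finset (ZMod n))
    (H : Seeds n C₁ T) (P : Fin T → Finset (ZMod n)) : Prop where
  disjoint : ∀ t t', t ≠ t' → Disjoint (P t) (P t')
  cover : ∀ i, i ∈ S ↔ ∃ t, i ∈ P t
  size : ∀ t : Fin T, ((P t).card : ℝ) ≤
    k * ((numReps C₁ 0 : ℝ) / numReps C₁ t) * (2 : ℝ) ^ (-(2 : ℝ) ^ ((1 - δ) * ((t : ℕ) : ℝ)) + 1)
  not_crowded : ∀ t : Fin T, ∀ a ∈ P t, ∀ s,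
    ¬ IsCrowded (((numReps C₁ ((t : ℕ) + 1) : ℝ) ^ 3)⁻¹) (numBuckets C₁ C₂ k ((t : ℕ) + 1)) (H t s) (P t) a
  not_collides : ∀ t : Fin T, ∀ a ∈ P t, ∀ b ∈ S,
    IsBad δ (numBuckets C₁ C₂ k ((t : ℕ) + 1)) (H t) (P t) b →
      ∀ s, ¬ Collides (numBuckets C₁ C₂ k ((t : ℕ) + 1)) (numReps C₁ ((t : ℕ) + 1)) (H t s) a b

open Classical in
/-- One pass of the loop of `ConstructPartition`: `Bad ∪ U ∪ V` for the current set `Q`. -/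
def partitionStep {n R : ℕ} (δ : ℝ) (B : ℕ) (S : Finset (ZMod n)) (H : Fin R → Seed n)
    (Q : Finset (ZMod n)) : Finset (ZMod n) :=
  {a ∈ S | IsBad δ B H Q a} ∪
  {a ∈ Q | ∃ b ∈ S, IsBad δ B H Q b ∧ ∃ s, Collides B R (H s) a b} ∪
  {a ∈ Q | ∃ s, IsCrowded (((R : ℝ) ^ 3)⁻¹) B (H s) Q a}

/-- `partitionStage t` is the current set `S_{t+1}^{t+1}` of `ConstructPartition` after `t` passes
of its loop, for `t ≤ T`. Once a stage is empty all later stages are empty, so passing on after the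
loop condition fails changes nothing. -/
def partitionStage {n C₁ T : ℕ} (δ C₂ : ℝ) (k : ℕ) (S : Finset (ZMod n)) (H : Seeds n C₁ T) :
    ℕ → Finset (ZMod n)
  | 0 => S
  | t + 1 =>
    if ht : t < T then
      partitionStep δ (numBuckets C₁ C₂ k ((t : ℕ) + 1)) S (H ⟨t, ht⟩) (partitionStage δ C₂ k S H t)
    else ∅

/-- The output of `ConstructPartition`: each part loses the elements moved to later parts. -/
def constructPartition {n C₁ T : ℕ} (δ C₂ : ℝ) (k : ℕ) (S : Finset (ZMod n)) (H : Seeds n C₁ T)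
    (t : Fin T) : Finset (ZMod n) :=
  partitionStage δ C₂ k S H t \ (Finset.Ioc (t : ℕ) T).biUnion (partitionStage δ C₂ k S H)

/-! ### The `ℓ₁` reduction loop of `Estimate` -/

/-- The approximate transform routine (called in outer iteration `r`, round `t`, measurement `s`)
is accurate to within `‖χ‖₂ n^{-c}` in every coordinate. -/
def IsAccurate {n : ℕ} [NeZero n] (c : ℝ) (fft : ℕ → ℕ → ℕ → (ZMod n → ℂ) → ZMod n → ℂ) : Prop :=
  ∀ r t s χ f, ‖dft χ f - fft r t s χ f‖ ≤ l2On Finset.univ χ * (n : ℝ) ^ (-c)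

/-- The vector after the first `t` rounds of outer iteration `r`, started from `χ`. -/
def innerLoop {n : ℕ} [NeZero n] {C₁ T : ℕ} (C₂ : ℝ) (k : ℕ) (G : Fin T → ZMod n → ℝ)
    (H : Seeds n C₁ T) (fft : ℕ → ℕ → ℕ → (ZMod n → ℂ) → ZMod n → ℂ) (xHat : ZMod n → ℂ)
    (P : Fin T → Finset (ZMod n)) (r : ℕ) (χ : ZMod n → ℂ) : ℕ → ZMod n → ℂ
  | 0 => χ
  | t + 1 =>
    let χ' := innerLoop C₂ k G H fft xHat P r χ t
    if ht : t < T then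
      χ' + estimateValues (numBuckets C₁ C₂ k ((t : ℕ) + 1)) (G ⟨t, ht⟩) (H ⟨t, ht⟩) xHat
        (fun s => fft r t s χ') (P ⟨t, ht⟩)
    else χ'

/-- The vector after `r` outer iterations, started from `0`. -/
def outerLoop {n : ℕ} [NeZero n] {C₁ T : ℕ} (C₂ : ℝ) (k : ℕ) (G : Fin T → ZMod n → ℝ)
    (H : Seeds n C₁ T) (fft : ℕ → ℕ → ℕ → (ZMod n → ℂ) → ZMod n → ℂ) (xHat : ZMod n → ℂ)
    (P : Fin T → Finset (ZMod n)) : ℕ → ZMod n → ℂ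
  | 0 => 0
  | r + 1 => innerLoop C₂ k G H fft xHat P r (outerLoop C₂ k G H fft xHat P r) T

/-- The vector `χ̃` computed by the loop over `r = 0, 1, …, ⌈C log₄ R*⌉`. -/
def reducedVector {n : ℕ} [NeZero n] {C₁ T : ℕ} (C₂ : ℝ) (k : ℕ) (G : Fin T → ZMod n → ℝ)
    (H : Seeds n C₁ T) (fft : ℕ → ℕ → ℕ → (ZMod n → ℂ) → ZMod n → ℂ) (xHat : ZMod n → ℂ)
    (P : Fin T → Finset (ZMod n)) (C Rstar : ℝ) : ZMod n → ℂ :=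
  outerLoop C₂ k G H fft xHat P (⌈C * Real.logb 4 Rstar⌉₊ + 1)

end

end SparseFourier

namespace SparseFourier

open Finset

noncomputable section

/-! ### Hashing in the time domain -/

/-! Write μ for the ℓ₂ norm of x outside S, and y = x − χ; χ stays supported in S throughout. By
`hashToBins_eq`, a measurement of i ∈ S returns y_i disturbed by head noise (the other y_j with j ∈
S), tail noise (coordinates outside S) and the error of the approximate transform; dividing by the
filter value at most doubles these. The median survives if fewer than a quarter of the seeds are
spoilt by each of the first two.

Head noise is what the iteration contracts. Sum it over i ∈ S_t and exchange sums, so that each j ∈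
S is charged the filter mass it sends to S_t. Filter decay and the absence of crowding bound this
charge by a constant under seeds where j collides with S_t, and by O(1/R_t) under the others
(`sum_filter_le`). An element that is not bad collides under at most an R_t^{-δ} fraction of the
seeds, and a bad one never collides with S_t. The total is O(R_t^{-δ}) times the current ℓ₁ residual
(`sum_headNoise_le`), geometrically summable over rounds and small for large C₁. An outer iteration
therefore divides the residual by 4, up to additive noise (`sum_err_le`, `l1On_outer_step`), and
logarithmically many iterations remove the initial mass R*μ√k.

Tail noise depends neither on χ nor on the partition, so one event serves every partition and every
iteration. Its second moment is O(μ²/B_t). The typical level μ/√B_t, multiplied by the bound on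
|S_t|, sums to at most μ√k. The excess over that level is measured by an elementary symmetric
function of degree about R_t/4; its mean is exponentially small in R_t, so it can be summed over all
of S (`avg_sum_tailExcess_le`).

For the partition, the seeds of a round are independent of the current set Q. Badness requires about
R^{1-δ} independent collisions, and crowding has expected cost quadratic in |Q|. A doubly
exponential size bound thus propagates, because 2^{1-δ} < 2 (`exists_partition_threshold`). Markov's
inequality gives failure probabilities summing to 1/25 over the rounds; a second 1/25 pays for the
tail (`exists_good_event`). -/

lemma norm_stdAddChar {n : ℕ} [NeZero n] (z : ZMod n) : ‖(ZMod.stdAddChar z : ℂ)‖ = 1 := by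
  rw [ZMod.stdAddChar_apply]; exact Circle.norm_coe _

lemma sum_stdAddChar_mul {n : ℕ} [NeZero n] (b : ZMod n) :
    ∑ f, (ZMod.stdAddChar (f * b) : ℂ) = if b = 0 then (n : ℂ) else 0 := by
  rw [AddChar.sum_mulShift b (ZMod.isPrimitive_stdAddChar n)]
  simp [ZMod.card]

lemma sqrt_natCast_mul_self (n : ℕ) : ((Real.sqrt n : ℝ) : ℂ) * ((Real.sqrt n : ℝ) : ℂ) = n := by
  rw [← Complex.ofReal_mul, Real.mul_self_sqrt (Nat.cast_nonneg n)]; simp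

lemma sqrt_natCast_ne_zero (n : ℕ) [NeZero n] : ((Real.sqrt n : ℝ) : ℂ) ≠ 0 := by
  rw [Complex.ofReal_ne_zero]
  exact (Real.sqrt_pos.2 (by exact_mod_cast NeZero.pos n)).ne'

/-- Filtering the permuted spectrum of `y` evaluates a weighted sum of the entries of `y`. -/
lemma sqrt_mul_invDft_filter {n : ℕ} [NeZero n] (G : ZMod n → ℝ) (h : Seed n) (y : ZMod n → ℂ)
    (c : ZMod n) :
    ((Real.sqrt n : ℝ) : ℂ) *
        invDft (fun f => dft (fun i => (G i : ℂ)) f * permSpectrum h (dft y) f) c =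
      ∑ j, y j * (G (c - hashPerm h j) : ℂ) *
        ZMod.stdAddChar (h.2.2 * (h.1 : ZMod n) * j) := by
  have hs := sqrt_natCast_ne_zero n
  have hn : (n : ℂ) ≠ 0 := by exact_mod_cast NeZero.ne n
  have key : ∀ f : ZMod n, ZMod.stdAddChar (c * f) *
      (dft (fun i => (G i : ℂ)) f * permSpectrum h (dft y) f) =
      (n : ℂ)⁻¹ * ∑ j, ∑ l, y j * (G l : ℂ) * ZMod.stdAddChar (h.2.2 * (h.1 : ZMod n) * j) *
        ZMod.stdAddChar (f * (c - hashPerm h j - l)) := by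
    intro f
    simp only [dft, permSpectrum]
    rw [← sqrt_natCast_mul_self n, mul_inv]
    calc _ = ((Real.sqrt n : ℝ) : ℂ)⁻¹ * ((Real.sqrt n : ℝ) : ℂ)⁻¹ *
          ((∑ j, ZMod.stdAddChar (-(j * ((h.1 : ZMod n) * (f - h.2.2)))) * y j) *
          (∑ l, ZMod.stdAddChar (-(l * f)) * (G l : ℂ))) *
            (ZMod.stdAddChar (c * f) * ZMod.stdAddChar (f * (h.1 : ZMod n) * h.2.1)) := by ring
      _ = _ := by
        rw [mul_assoc, Finset.sum_mul_sum, Finset.sum_mul]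
        congr 1
        refine Finset.sum_congr rfl fun j _ => ?_
        rw [Finset.sum_mul]
        refine Finset.sum_congr rfl fun l _ => ?_
        -- Collecting phases: the evaluation point a leaves a modulation in j alone, and the shift q
        -- completes σj to the hashed position.
        have : (ZMod.stdAddChar (h.2.2 * (h.1 : ZMod n) * j) : ℂ) *
            ZMod.stdAddChar (f * (c - hashPerm h j - l)) =
            ZMod.stdAddChar (-(j * ((h.1 : ZMod n) * (f - h.2.2)))) *
            ZMod.stdAddChar (-(l * f)) * (ZMod.stdAddChar (c * f) *
              ZMod.stdAddChar (f * (h.1 : ZMod n) * h.2.1)) := by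
          simp only [← AddChar.map_add_eq_mul, hashPerm]
          congr 1; ring
        rw [mul_assoc (y j * (G l : ℂ)), this]; ring
  unfold invDft
  rw [← mul_assoc, mul_inv_cancel₀ hs, one_mul]
  simp_rw [key]
  rw [← Finset.mul_sum, Finset.sum_comm, Finset.mul_sum]
  refine Finset.sum_congr rfl fun j _ => ?_
  rw [Finset.sum_comm]
  -- Orthogonality over f keeps only l = c − π(j), so the convolution with G collapses.
  simp_rw [← Finset.mul_sum, sum_stdAddChar_mul, sub_eq_zero]
  simp only [mul_ite, mul_zero, Finset.sum_ite_eq, Finset.mem_univ, if_true]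
  field_simp

/-- The triangle inequality suffices for the precision error: the lost powers of n are absorbed by
n^{-c} later. -/
lemma norm_sum_le_of_norm_le {n : ℕ} [NeZero n] (f : ZMod n → ℂ) {ε : ℝ} (hf : ∀ j, ‖f j‖ ≤ ε) :
    ‖((Real.sqrt n : ℝ) : ℂ)⁻¹ * ∑ j, f j‖ ≤ Real.sqrt n * ε := by
  have hpos : 0 < Real.sqrt n := Real.sqrt_pos.2 (by exact_mod_cast NeZero.pos n)
  have h1 : ‖∑ j, f j‖ ≤ n * ε := by
    refine (norm_sum_le _ _).trans ((Finset.sum_le_sum fun j _ => hf j).trans ?_)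
    simp [ZMod.card]
  rw [norm_mul, norm_inv, Complex.norm_real, Real.norm_of_nonneg hpos.le]
  calc _ ≤ (Real.sqrt n)⁻¹ * (n * ε) := by gcongr
    _ = Real.sqrt n * ε := by
      nth_rewrite 2 [← Real.mul_self_sqrt (Nat.cast_nonneg n)]
      field_simp

/-- A uniformly small perturbation of the spectrum perturbs the hash values little. -/
lemma norm_sqrt_mul_invDft_filter_le {n : ℕ} [NeZero n] {G : ZMod n → ℝ} (h : Seed n)
    {e : ZMod n → ℂ} {ε : ℝ} (hG : ∀ j, |G j| ≤ 1) (he : ∀ f, ‖e f‖ ≤ ε) (c : ZMod n) :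
    ‖((Real.sqrt n : ℝ) : ℂ) *
        invDft (fun f => dft (fun i => (G i : ℂ)) f * permSpectrum h e f) c‖ ≤
      n * Real.sqrt n * ε := by
  have hpos : 0 < Real.sqrt n := Real.sqrt_pos.2 (by exact_mod_cast NeZero.pos n)
  have hd : ∀ f, ‖dft (fun i => (G i : ℂ)) f‖ ≤ Real.sqrt n * 1 := fun f =>
    norm_sum_le_of_norm_le _ fun j => by
      rw [norm_mul, norm_stdAddChar, one_mul, Complex.norm_real]; exact hG j
  have hi : ‖invDft (fun f => dft (fun i => (G i : ℂ)) f * permSpectrum h e f) c‖ ≤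
      Real.sqrt n * (Real.sqrt n * ε) :=
    norm_sum_le_of_norm_le _ fun f => by
      rw [norm_mul, norm_stdAddChar, one_mul, norm_mul]
      have h2 : ‖permSpectrum h e f‖ ≤ ε := by
        rw [permSpectrum, norm_mul, norm_stdAddChar, mul_one]; exact he _
      have := hd f
      rw [mul_one] at this
      gcongr
  rw [norm_mul, Complex.norm_real, Real.norm_of_nonneg hpos.le]
  calc _ ≤ Real.sqrt n * (Real.sqrt n * (Real.sqrt n * ε)) := by gcongr
    _ = _ := by
      nth_rewrite 4 [← Real.mul_self_sqrt (Nat.cast_nonneg n)]; ring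

lemma dft_sub {n : ℕ} [NeZero n] (x y : ZMod n → ℂ) : dft (x - y) = dft x - dft y := by
  funext f
  simp [dft, mul_sub, Finset.sum_sub_distrib]

/-- By linearity the spectrum splits into the exact transform of x − χ and the approximation error.
Symmetry of the filter turns its argument c − π(j) into the offset π(j) − c. -/
lemma hashToBins_eq {n : ℕ} [NeZero n] {B : ℕ} {G : ZMod n → ℝ} (hG : ∀ j, G (-j) = G j)
    (h : Seed n) (x χ : ZMod n → ℂ) (chiHat : ZMod n → ℂ) (i : ZMod n) :
    hashToBins B G h (dft x) chiHat (bucket B h i) =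
      ∑ j, (x - χ) j * (G (offset B h i j) : ℂ) * ZMod.stdAddChar (h.2.2 * (h.1 : ZMod n) * j) +
      ((Real.sqrt n : ℝ) : ℂ) * invDft (fun f => dft (fun i => (G i : ℂ)) f *
        permSpectrum h (dft χ - chiHat) f) (bucketCenter n B (bucket B h i)) := by
  have h1 := sqrt_mul_invDft_filter G h (x - χ) (bucketCenter n B (bucket B h i))
  have h2 : ∀ j, G (bucketCenter n B (bucket B h i) - hashPerm h j) = G (offset B h i j) := by
    intro j; rw [offset, ← hG]; congr 1; ring
  simp_rw [h2] at h1
  rw [← h1, hashToBins, ← mul_add]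
  congr 1
  simp only [invDft, ← mul_add, ← Finset.sum_add_distrib, permSpectrum, dft_sub, Pi.sub_apply]
  congr 1
  refine Finset.sum_congr rfl fun f _ => ?_
  ring

/-! ### Circular absolute value and offsets -/

lemma circAbs_add_le {n : ℕ} (a b : ZMod n) : circAbs (a + b) ≤ circAbs a + circAbs b :=
  (ZMod.natAbs_valMinAbs_add_le a b).trans (Int.natAbs_add_le _ _)

lemma circAbs_neg {n : ℕ} (a : ZMod n) : circAbs (-a) = circAbs a := ZMod.natAbs_valMinAbs_neg a

lemma circAbs_sub_comm {n : ℕ} (a b : ZMod n) : circAbs (a - b) = circAbs (b - a) := by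
  rw [← circAbs_neg, neg_sub]

lemma circAbs_intCast_le {n : ℕ} [NeZero n] (z : ℤ) : circAbs (z : ZMod n) ≤ z.natAbs := by
  rw [circAbs]
  refine Int.natAbs_le_iff_mul_self_le.2 ?_
  have h1 := ZMod.valMinAbs_mem_Ioc (z : ZMod n)
  have h2 : ((z : ZMod n).valMinAbs : ZMod n) = (z : ZMod n) := ZMod.coe_valMinAbs _
  rw [ZMod.intCast_eq_intCast_iff] at h2
  obtain ⟨k, hk⟩ := h2.dvd
  set v := (z : ZMod n).valMinAbs
  have hn : (0 : ℤ) < n := by exact_mod_cast NeZero.pos n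
  have hz : z = v + n * k := by linarith
  obtain ⟨h3, h4⟩ := h1
  rcases lt_trichotomy k 0 with hk0 | hk0 | hk0
  · have : (n : ℤ) * k ≤ -n := by nlinarith
    nlinarith
  · subst hk0; simp [hz]
  · have : (n : ℤ) ≤ n * k := by nlinarith
    nlinarith

lemma circAbs_le_half {n : ℕ} [NeZero n] (z : ZMod n) : (circAbs z : ℝ) ≤ n / 2 := by
  have := ZMod.natAbs_valMinAbs_le z
  calc (circAbs z : ℝ) ≤ ((n / 2 : ℕ) : ℝ) := by exact_mod_cast this
    _ ≤ _ := Nat.cast_div_le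

lemma hashPerm_sub {n : ℕ} (h : Seed n) (i j : ZMod n) :
    hashPerm h i - hashPerm h j = (h.1 : ZMod n) * (i - j) := by
  simp only [hashPerm]; ring

/-- If B ≤ n then n/B is an integer. Otherwise the inner argument is already an integer, and scaling
back gives v. -/
lemma exists_int_eq_div_mul_round {m β : ℕ} (v : ℕ) :
    ∃ z : ℤ, ((2 ^ m : ℕ) : ℚ) / ((2 ^ β : ℕ) : ℚ) *
      (round (((2 ^ β : ℕ) : ℚ) / ((2 ^ m : ℕ) : ℚ) * (v : ℚ)) : ℤ) = z := by
  rcases le_total β m with hle | hle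
  · obtain ⟨d, rfl⟩ := Nat.exists_eq_add_of_le hle
    refine ⟨2 ^ d * round (((2 ^ β : ℕ) : ℚ) / ((2 ^ (β + d) : ℕ) : ℚ) * (v : ℚ)), ?_⟩
    push_cast
    rw [pow_add]
    field_simp
  · obtain ⟨d, rfl⟩ := Nat.exists_eq_add_of_le hle
    refine ⟨v, ?_⟩
    have : ((2 ^ (m + d) : ℕ) : ℚ) / ((2 ^ m : ℕ) : ℚ) * (v : ℚ) = ((2 ^ d * v : ℤ) : ℚ) := by
      push_cast; rw [pow_add]; field_simp
    rw [this, round_intCast]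
    push_cast; rw [pow_add]; field_simp

lemma circAbs_offset_self_le {n B : ℕ} [NeZero n] (hn : ∃ m : ℕ, n = 2 ^ m)
    (hB : ∃ β : ℕ, B = 2 ^ β) (h : Seed n) (i : ZMod n) :
    (circAbs (offset B h i i) : ℝ) ≤ n / (2 * B) := by
  obtain ⟨m, hm⟩ := hn
  obtain ⟨β, hβ⟩ := hB
  obtain ⟨z, hz⟩ := exists_int_eq_div_mul_round (m := m) (β := β) (hashPerm h i).val
  rw [← hm, ← hβ] at hz
  have hc : bucketCenter n B (bucket B h i) = (z : ZMod n) := by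
    rw [bucketCenter, bucket, hz, round_intCast]
  have hn0 : (0 : ℚ) < n := by exact_mod_cast NeZero.pos n
  have hB0 : (0 : ℚ) < B := by rw [hβ]; positivity
  have ho : offset B h i i = ((((hashPerm h i).val : ℤ) - z : ℤ) : ZMod n) := by
    rw [offset, hc]; push_cast; rw [ZMod.natCast_zmod_val]
  rw [ho]
  have h1 : |((hashPerm h i).val : ℚ) - z| ≤ n / (2 * B) := by
    rw [← hz]
    set v := ((hashPerm h i).val : ℚ)
    have h2 : v - n / B * (round ((B : ℚ) / n * v) : ℤ) =
        n / B * ((B : ℚ) / n * v - (round ((B : ℚ) / n * v) : ℤ)) := by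
      field_simp
    rw [h2, abs_mul, abs_of_pos (div_pos hn0 hB0)]
    calc _ ≤ (n : ℚ) / B * (1 / 2) := by
          gcongr
          exact abs_sub_round _
      _ = _ := by field_simp
  have h3 : (((((hashPerm h i).val : ℤ) - z).natAbs : ℕ) : ℚ) ≤ n / (2 * B) := by
    rw [Nat.cast_natAbs]; push_cast; exact h1
  have h4 : ((circAbs (((((hashPerm h i).val : ℤ) - z : ℤ)) : ZMod n) : ℕ) : ℚ) ≤ n / (2 * B) :=
    le_trans (by exact_mod_cast circAbs_intCast_le _) h3
  have h5 := (Rat.cast_le (K := ℝ)).2 h4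
  push_cast at h5
  exact_mod_cast h5

/-! ### Averages over finite sample spaces -/

/-- The expectation of `f` under the uniform distribution. -/
def avg {Ω : Type} [Fintype Ω] (f : Ω → ℝ) : ℝ := (∑ ω, f ω) / Fintype.card Ω

open Classical in
/-- The indicator of a proposition. -/
def ind (p : Prop) : ℝ := if p then 1 else 0

lemma ind_of {p : Prop} (h : p) : ind p = 1 := if_pos h

lemma ind_of_not {p : Prop} (h : ¬ p) : ind p = 0 := if_neg h

lemma ind_nonneg (p : Prop) : 0 ≤ ind p := by unfold ind; split_ifs <;> norm_num

lemma ind_le {p : Prop} {c : ℝ} (hc : 0 ≤ c) (h : p → 1 ≤ c) : ind p ≤ c := by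
  unfold ind; split_ifs with hp
  · exact h hp
  · exact hc

lemma ind_mono {p q : Prop} (h : p → q) : ind p ≤ ind q :=
  ind_le (ind_nonneg q) fun hp => (ind_of (h hp)).ge

variable {Ω Ω' : Type} [Fintype Ω] [Fintype Ω']

lemma avg_mono {f g : Ω → ℝ} (h : ∀ ω, f ω ≤ g ω) : avg f ≤ avg g :=
  div_le_div_of_nonneg_right (sum_le_sum fun ω _ => h ω) (Nat.cast_nonneg _)

lemma avg_nonneg {f : Ω → ℝ} (h : ∀ ω, 0 ≤ f ω) : 0 ≤ avg f :=
  div_nonneg (sum_nonneg fun ω _ => h ω) (Nat.cast_nonneg _)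

lemma avg_add (f g : Ω → ℝ) : avg (fun ω => f ω + g ω) = avg f + avg g := by
  simp only [avg, sum_add_distrib, add_div]

lemma avg_sum {ι : Type*} (s : Finset ι) (f : ι → Ω → ℝ) :
    avg (fun ω => ∑ i ∈ s, f i ω) = ∑ i ∈ s, avg (f i) := by
  simp only [avg, sum_comm (s := univ), sum_div]

lemma avg_const_mul (c : ℝ) (f : Ω → ℝ) : avg (fun ω => c * f ω) = c * avg f := by
  simp only [avg, ← mul_sum, mul_div_assoc]

lemma avg_const [Nonempty Ω] (c : ℝ) : avg (fun _ : Ω => c) = c := by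
  have : (Fintype.card Ω : ℝ) ≠ 0 := by exact_mod_cast Fintype.card_ne_zero
  simp only [avg, sum_const, card_univ, nsmul_eq_mul]
  field_simp

/-- The inequality, unlike the equality, survives an empty sample space, where `avg` is 0. -/
lemma avg_const_le {c : ℝ} (hc : 0 ≤ c) : avg (fun _ : Ω => c) ≤ c := by
  rcases isEmpty_or_nonempty Ω with h | h
  · simpa [avg] using hc
  · exact (avg_const c).le

lemma avg_prod (f : Ω × Ω' → ℝ) : avg f = avg fun a => avg fun b => f (a, b) := by
  simp only [avg, Fintype.sum_prod_type, Fintype.card_prod, Nat.cast_mul, ← sum_div]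
  rw [div_div, mul_comm]

/-- Independence of the coordinates; those outside J contribute the factor 1. -/
lemma avg_pi_prod {ι : Type} [Fintype ι] [DecidableEq ι] [Nonempty Ω] (J : Finset ι)
    (f : ι → Ω → ℝ) :
    avg (fun H : ι → Ω => ∏ s ∈ J, f s (H s)) = ∏ s ∈ J, avg (f s) := by
  have h1 : ∀ g : ι → Ω → ℝ, avg (fun H : ι → Ω => ∏ s, g s (H s)) = ∏ s, avg (g s) := by
    intro g
    simp only [avg, prod_div_distrib]
    rw [Finset.prod_univ_sum, Fintype.piFinset_univ]
    simp
  have h2 := h1 fun s ω => if s ∈ J then f s ω else 1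
  have h3 : ∀ s, avg (fun ω => if s ∈ J then f s ω else 1) = if s ∈ J then avg (f s) else 1 := by
    intro s
    split_ifs
    · rfl
    · exact avg_const 1
  simp only [h3, prod_ite_mem, univ_inter] at h2
  exact h2

/-- An average over a product is bounded by bounding the averages over one coordinate. -/
lemma avg_pi_le {ι : Type} [Fintype ι] [DecidableEq ι] {α : ι → Type} [∀ i, Fintype (α i)]
    (i : ι) (F : (∀ j, α j) → ℝ) {c : ℝ} (hc : 0 ≤ c)
    (h : ∀ H : ∀ j, α j, avg (fun a : α i => F (Function.update H i a)) ≤ c) : avg F ≤ c := by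
  let e := Equiv.piSplitAt i α
  have h1 : avg F = avg fun z => F (e.symm z) := by
    simp only [avg]
    rw [Equiv.sum_comp e.symm, Fintype.card_congr e]
  have h2 : avg (fun z => F (e.symm z)) =
      avg fun b : (∀ j : {j // j ≠ i}, α j) => avg fun a : α i => F (e.symm (a, b)) := by
    rw [avg_prod]
    simp only [avg, ← sum_div]
    rw [sum_comm, div_div, div_div, mul_comm]
  rw [h1, h2]
  refine (avg_mono fun b => ?_).trans (avg_const_le hc)
  rcases isEmpty_or_nonempty (α i) with h0 | ⟨⟨a0⟩⟩
  · simpa [avg] using hc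
  · refine le_trans (le_of_eq ?_) (h (e.symm (a0, b)))
    congr 1
    funext a
    congr 1
    funext j
    by_cases hj : j = i
    · subst hj; simp [e, Equiv.piSplitAt]
    · simp [e, Equiv.piSplitAt, hj]

lemma uniformProb_eq_avg (E : Set Ω) : uniformProb E = avg fun ω => ind (ω ∈ E) := by
  classical
  simp only [uniformProb, avg, ind, Nat.card_eq_fintype_card]
  rw [Finset.sum_boole, Set.ncard_eq_toFinset_card' E]
  congr 3
  ext; simp

/-! ### Distribution of hash differences -/

/-- Write d = 2^e u with u odd. Every σd is a nonzero multiple of 2^e, there are at most 2ρ/2^e of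
these within distance ρ, and each is hit by at most 2^e units. There are n/2 units altogether. -/
lemma card_units_circAbs_mul_le {n : ℕ} [NeZero n] (hn : ∃ m : ℕ, n = 2 ^ m) {d : ZMod n}
    (hd : d ≠ 0) {ρ : ℝ} (hρ : 0 ≤ ρ) :
    ∑ σ : (ZMod n)ˣ, ind ((circAbs ((σ : ZMod n) * d) : ℝ) ≤ ρ) ≤
      4 * ρ / n * Fintype.card (ZMod n)ˣ := by
  classical
  obtain ⟨m, hm⟩ := hn
  have hdv : d.val ≠ 0 := by rwa [Ne, ZMod.val_eq_zero]
  obtain ⟨e, u, hu, hdu⟩ := Nat.exists_eq_two_pow_mul_odd hdv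
  have hem : e < m := by
    by_contra hle
    have h1 : d.val < 2 ^ m := hm ▸ ZMod.val_lt d
    have h2 : 2 ^ m ≤ 2 ^ e := Nat.pow_le_pow_right (by norm_num) (not_lt.1 hle)
    have h3 : 1 ≤ u := hu.pos
    nlinarith
  obtain ⟨l, rfl⟩ := Nat.exists_eq_add_of_lt hem
  set N := 2 ^ (l + 1) with hN
  have hnN : n = 2 ^ e * N := by rw [hm, hN, ← pow_add]; ring_nf
  have hcard : (Fintype.card (ZMod n)ˣ : ℝ) = n / 2 := by
    rw [ZMod.card_units_eq_totient]
    have : Nat.totient n * 2 = n := by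
      rw [hm, Nat.totient_prime_pow_succ Nat.prime_two]; simp [pow_succ]
    have h2 : (Nat.totient n : ℝ) * 2 = n := by exact_mod_cast this
    linarith
  have hn0 : (0 : ℝ) < n := by exact_mod_cast NeZero.pos n
  set M : ℕ := ⌊ρ / 2 ^ e⌋₊ with hM
  have hdvd : ∀ σ : (ZMod n)ˣ, (2 ^ e : ℤ) ∣ ((σ : ZMod n) * d).valMinAbs := by
    intro σ
    have h1 : ((((σ : ZMod n) * d).valMinAbs : ℤ) : ZMod n) =
        (((σ : ZMod n).val * d.val : ℤ) : ZMod n) := by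
      rw [ZMod.coe_valMinAbs]; push_cast; simp
    rw [ZMod.intCast_eq_intCast_iff_dvd_sub] at h1
    have h2 : (2 ^ e : ℤ) ∣ n := ⟨N, by rw [hnN]; push_cast; ring⟩
    have h3 : (2 ^ e : ℤ) ∣ (σ : ZMod n).val * d.val := by
      rw [hdu]; exact ⟨(σ : ZMod n).val * u, by push_cast; ring⟩
    exact (dvd_sub_right h3).1 (h2.trans h1)
  simp only [ind]
  rw [Finset.sum_boole]
  -- The quotient of σd by 2^e determines σ mod N because u is odd; the quotient of σ by N gives the
  -- rest. Excluding the zero quotient makes the bound proportional to ρ, with no additive term.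
  have hle : #{σ : (ZMod n)ˣ | (circAbs ((σ : ZMod n) * d) : ℝ) ≤ ρ} ≤
      #(((Icc (-(M : ℤ)) M).erase 0) ×ˢ range (2 ^ e)) := by
    refine Finset.card_le_card_of_injOn
      (fun σ => (((σ : ZMod n) * d).valMinAbs / 2 ^ e, (σ : ZMod n).val / N)) ?_ ?_
    · intro σ hσ
      have hσ' : (circAbs ((σ : ZMod n) * d) : ℝ) ≤ ρ := by simpa using hσ
      obtain ⟨w, hw⟩ := hdvd σ
      have hw0 : w ≠ 0 := by
        rintro rfl
        rw [mul_zero, ZMod.valMinAbs_eq_zero, Units.mul_right_eq_zero] at hw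
        exact hd hw
      have hwM : w.natAbs ≤ M := by
        refine Nat.le_floor ?_
        rw [le_div_iff₀ (by positivity)]
        refine le_trans (le_of_eq ?_) hσ'
        rw [circAbs, hw, Int.natAbs_mul]; push_cast
        rw [mul_comm]; congr 1
        simp
      simp only [coe_product, Set.mem_prod, mem_coe, mem_erase, mem_Icc, mem_range]
      rw [hw, Int.mul_ediv_cancel_left _ (by positivity)]
      refine ⟨⟨hw0, by omega, by omega⟩, ?_⟩
      rw [Nat.div_lt_iff_lt_mul (by positivity), ← hnN]
      exact ZMod.val_lt _
    · intro σ _ τ _ hst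
      simp only [Prod.mk.injEq] at hst
      obtain ⟨h1, h2⟩ := hst
      have h3 : ((σ : ZMod n) * d).valMinAbs = ((τ : ZMod n) * d).valMinAbs := by
        rw [← Int.ediv_mul_cancel (hdvd σ), h1, Int.ediv_mul_cancel (hdvd τ)]
      rw [ZMod.valMinAbs_inj] at h3
      have h4 : ((((σ : ZMod n).val * d.val : ℤ)) : ZMod n) =
          (((τ : ZMod n).val * d.val : ℤ) : ZMod n) := by
        push_cast; simpa [ZMod.natCast_zmod_val] using h3
      rw [ZMod.intCast_eq_intCast_iff_dvd_sub] at h4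
      have h5 : (2 ^ e * N : ℤ) ∣ 2 ^ e * (((τ : ZMod n).val - (σ : ZMod n).val) * u) := by
        have : (n : ℤ) = 2 ^ e * N := by rw [hnN]; push_cast; ring
        rw [← this]
        convert h4 using 1
        rw [hdu]; push_cast; ring
      have h6 := Int.dvd_of_mul_dvd_mul_left (by positivity) h5
      have hcop : IsCoprime (N : ℤ) u := by
        rw [Nat.isCoprime_iff_coprime, hN]
        exact Nat.Coprime.pow_left _ (Nat.coprime_two_left.2 hu)
      have h7 : ((σ : ZMod n).val : ℤ) ≡ (τ : ZMod n).val [ZMOD N] :=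
        Int.modEq_iff_dvd.2 (hcop.dvd_of_dvd_mul_right h6)
      have h8 : (σ : ZMod n).val % N = (τ : ZMod n).val % N := Int.natCast_modEq_iff.1 h7
      refine Units.ext (ZMod.val_injective n ?_)
      rw [← Nat.div_add_mod (σ : ZMod n).val N, h2, h8, Nat.div_add_mod]
  have hcount : (#(((Icc (-(M : ℤ)) M).erase 0) ×ˢ range (2 ^ e)) : ℝ) ≤ 2 * ρ := by
    rw [card_product, card_erase_of_mem (by simp), Int.card_Icc, card_range]
    have h1 : ((M : ℤ) + 1 - -(M : ℤ)).toNat - 1 = 2 * M := by omega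
    rw [h1]
    have h2 : (M : ℝ) ≤ ρ / 2 ^ e := Nat.floor_le (by positivity)
    rw [le_div_iff₀ (by positivity)] at h2
    push_cast; linarith
  calc _ ≤ (#(((Icc (-(M : ℤ)) M).erase 0) ×ˢ range (2 ^ e)) : ℝ) := by exact_mod_cast hle
    _ ≤ 2 * ρ := hcount
    _ = _ := by rw [hcard]; field_simp; ring

lemma avg_hash_near_le {n : ℕ} [NeZero n] (hn : ∃ m : ℕ, n = 2 ^ m) {a b : ZMod n}
    (hab : a ≠ b) {ρ : ℝ} (hρ : 0 ≤ ρ) :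
    avg (fun h : Seed n => ind ((circAbs (hashPerm h a - hashPerm h b) : ℝ) ≤ ρ)) ≤ 4 * ρ / n := by
  rw [avg_prod]
  simp only [hashPerm_sub]
  have hc : (0 : ℝ) < Fintype.card (ZMod n)ˣ := by exact_mod_cast Fintype.card_pos
  simp only [avg_const]
  rw [avg, div_le_iff₀ hc]
  exact card_units_circAbs_mul_le hn (sub_ne_zero.2 hab) hρ

/-! ### Filters at hashed positions -/

/-- Take the least dyadic scale p containing the hashed distance of i and j. Sharpness 8 yields
decay 2^{-7p}, and 2^7 covers the scales where only G ≤ 1 is available. -/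
lemma IsFlatFilter.apply_offset_le {n B P : ℕ} [NeZero n] {G : ZMod n → ℝ}
    (hG : IsFlatFilter n B 8 G) (hn : ∃ m : ℕ, n = 2 ^ m) (hB : ∃ β : ℕ, B = 2 ^ β)
    (hP : B ≤ 2 ^ P) (h : Seed n) (i j : ZMod n) :
    ∃ p ∈ range (P + 1), (circAbs (hashPerm h i - hashPerm h j) : ℝ) ≤ (n : ℝ) / B * 2 ^ p ∧
      G (offset B h i j) ≤ 2 ^ 7 * ((1 / 2) ^ 7) ^ p := by
  classical
  set D : ℝ := (circAbs (hashPerm h i - hashPerm h j) : ℝ) with hD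
  have hn0 : (0 : ℝ) < n := by exact_mod_cast NeZero.pos n
  have hB0 : (0 : ℝ) < B := by obtain ⟨β, rfl⟩ := hB; positivity
  have hDP : D ≤ (n : ℝ) / B * 2 ^ P := by
    have h1 : (B : ℝ) ≤ 2 ^ P := by exact_mod_cast hP
    calc D ≤ n / 2 := circAbs_le_half _
      _ ≤ n / B * B := by rw [div_mul_cancel₀ _ hB0.ne']; linarith
      _ ≤ _ := by gcongr
  have hex : ∃ p : ℕ, D ≤ (n : ℝ) / B * 2 ^ p := ⟨P, hDP⟩
  refine ⟨Nat.find hex, mem_range.2 (Nat.lt_succ_of_le (Nat.find_min' hex hDP)),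
    Nat.find_spec hex, ?_⟩
  rcases Nat.lt_or_ge (Nat.find hex) 2 with h2 | h2
  · refine (hG.le_one _).trans ?_
    interval_cases Nat.find hex <;> norm_num
  · obtain ⟨p, hp⟩ := Nat.exists_eq_add_of_le h2
    have hmin : (n : ℝ) / B * 2 ^ (p + 1) < D :=
      not_le.1 (Nat.find_min hex (by omega : p + 1 < Nat.find hex))
    rw [hp]
    -- Passing from π(i) to its bucket centre costs half a bucket. Minimality of the scale leaves an
    -- offset of at least a quarter of that scale, hence the shift by 2.
    have ho : D ≤ circAbs (offset B h i j) + n / (2 * B) := by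
      have h3 : hashPerm h j - hashPerm h i = offset B h i j + -offset B h i i := by
        simp only [offset]; ring
      have h4 := circAbs_add_le (offset B h i j) (-offset B h i i)
      rw [← h3, circAbs_neg, circAbs_sub_comm] at h4
      have h5 : D ≤ circAbs (offset B h i j) + circAbs (offset B h i i) := by
        rw [hD]; exact_mod_cast h4
      linarith [circAbs_offset_self_le hn hB h i]
    have hc : (n : ℝ) / B * 2 ^ p ≤ circAbs (offset B h i j) := by
      have h6 : (n : ℝ) / (2 * B) ≤ n / B * 2 ^ p := by
        rw [show (n : ℝ) / (2 * B) = n / B * (1 / 2) by field_simp]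
        have : (1 : ℝ) ≤ 2 ^ p := one_le_pow₀ (by norm_num)
        gcongr; linarith
      rw [pow_succ, ← mul_assoc] at hmin
      linarith
    have h1p : (1 : ℝ) ≤ 2 ^ p := one_le_pow₀ (by norm_num)
    have hc0 : (0 : ℝ) < circAbs (offset B h i j) := lt_of_lt_of_le (by positivity) hc
    have hdec := hG.decay (offset B h i j) (le_trans (le_mul_of_one_le_right (by positivity) h1p) hc)
    refine hdec.trans ?_
    have h7 : (n : ℝ) / (B * circAbs (offset B h i j)) ≤ (1 / 2) ^ p := by
      rw [div_le_iff₀ (by positivity)]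
      calc (n : ℝ) = (1 / 2) ^ p * (B * (n / B * 2 ^ p)) := by
            have : ((1 : ℝ) / 2) ^ p * 2 ^ p = 1 := by rw [← mul_pow]; norm_num
            calc (n : ℝ) = n * ((1 / 2) ^ p * 2 ^ p) := by rw [this, mul_one]
              _ = _ := by field_simp
        _ ≤ _ := by gcongr
    calc (1 / 4 : ℝ) ^ (8 - 1) * ((n : ℝ) / (B * circAbs (offset B h i j))) ^ (8 - 1)
        ≤ (1 / 4 : ℝ) ^ 7 * ((1 / 2) ^ p) ^ 7 := by norm_num; gcongr
      _ ≤ 2 ^ 7 * ((1 / 2) ^ 7) ^ (2 + p) := by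
        rw [pow_add, pow_right_comm ((1 : ℝ) / 2) p 7, ← mul_assoc]
        gcongr
        norm_num

/-- Scale p occurs with probability at most 4·2^p/B and carries weight 2^7·2^{-7p}, so the sum over
scales is geometric. -/
lemma avg_filter_le {n B : ℕ} [NeZero n] {G : ZMod n → ℝ}
    (hG : IsFlatFilter n B 8 G) (hn : ∃ m : ℕ, n = 2 ^ m) (hB : ∃ β : ℕ, B = 2 ^ β)
    {i j : ZMod n} (hij : i ≠ j) :
    avg (fun h : Seed n => G (offset B h i j)) ≤ 2 ^ 10 / B := by
  obtain ⟨β, hβ⟩ := hB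
  have hn0 : (0 : ℝ) < n := by exact_mod_cast NeZero.pos n
  have hB0 : (0 : ℝ) < B := by rw [hβ]; positivity
  have h1 : ∀ h : Seed n, G (offset B h i j) ≤ ∑ p ∈ range (β + 1),
      2 ^ 7 * ((1 / 2) ^ 7) ^ p *
        ind ((circAbs (hashPerm h i - hashPerm h j) : ℝ) ≤ (n : ℝ) / B * 2 ^ p) := by
    intro h
    obtain ⟨p, hp, hD, hle⟩ := hG.apply_offset_le hn ⟨β, hβ⟩ hβ.le h i j
    refine hle.trans ?_
    have := Finset.single_le_sum (f := fun p : ℕ => (2 : ℝ) ^ 7 * ((1 / 2) ^ 7) ^ p *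
        ind ((circAbs (hashPerm h i - hashPerm h j) : ℝ) ≤ (n : ℝ) / B * 2 ^ p))
        (fun p _ => mul_nonneg (by positivity) (ind_nonneg _)) hp
    refine le_trans (le_of_eq ?_) this
    simp only [ind_of hD, mul_one]
  refine (avg_mono h1).trans ?_
  rw [avg_sum]
  calc _ ≤ ∑ p ∈ range (β + 1), 2 ^ 9 / (B : ℝ) * (1 / 2) ^ p := by
        refine Finset.sum_le_sum fun p _ => ?_
        rw [avg_const_mul]
        have h2 := avg_hash_near_le hn hij (ρ := (n : ℝ) / B * 2 ^ p) (by positivity)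
        calc _ ≤ 2 ^ 7 * ((1 / 2) ^ 7) ^ p * (4 * ((n : ℝ) / B * 2 ^ p) / n) := by gcongr
          _ = 2 ^ 9 / (B : ℝ) * (((1 / 2) ^ 7) ^ p * 2 ^ p) := by field_simp; norm_num
          _ ≤ _ := by
            gcongr
            rw [← mul_pow]
            gcongr
            norm_num
    _ ≤ _ := by
      rw [← Finset.mul_sum]
      have h3 : ∑ p ∈ range (β + 1), ((1 : ℝ) / 2) ^ p ≤ 2 := by
        have := sum_geometric_two_le (β + 1); simpa using this
      calc _ ≤ 2 ^ 9 / (B : ℝ) * 2 := by gcongr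
        _ = _ := by ring

/-! ### The noise from outside the head set -/

/-- The contribution to bucket `h(i)` of the coordinates in `Q`. -/
def bucketNoise {n : ℕ} [NeZero n] (B : ℕ) (G : ZMod n → ℝ) (Q : Finset (ZMod n))
    (x : ZMod n → ℂ) (h : Seed n) (i : ZMod n) : ℝ :=
  ‖∑ j ∈ Q, x j * (G (offset B h i j) : ℂ) * ZMod.stdAddChar (h.2.2 * (h.1 : ZMod n) * j)‖

/-- Parseval in the evaluation point: since σ is a unit, distinct j give distinct characters of a,
so all cross terms average to 0. -/
lemma avg_norm_sq_modulated_sum {n : ℕ} [NeZero n] (σ : (ZMod n)ˣ) (Q : Finset (ZMod n))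
    (c : ZMod n → ℂ) :
    avg (fun a : ZMod n => ‖∑ j ∈ Q, c j * ZMod.stdAddChar (a * (σ : ZMod n) * j)‖ ^ 2) =
      ∑ j ∈ Q, ‖c j‖ ^ 2 := by
  have hn0 : (n : ℝ) ≠ 0 := by exact_mod_cast NeZero.ne n
  rw [avg, ZMod.card, div_eq_iff hn0, ← Complex.ofReal_inj]
  push_cast
  have h1 : ∀ a : ZMod n, ((‖∑ j ∈ Q, c j * ZMod.stdAddChar (a * (σ : ZMod n) * j)‖ : ℝ) : ℂ) ^ 2 =
      ∑ j ∈ Q, ∑ l ∈ Q, c j * (starRingEnd ℂ) (c l) *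
        ZMod.stdAddChar (a * ((σ : ZMod n) * (j - l))) := by
    intro a
    rw [← Complex.mul_conj', map_sum, Finset.sum_mul_sum]
    refine Finset.sum_congr rfl fun j _ => Finset.sum_congr rfl fun l _ => ?_
    rw [map_mul (starRingEnd ℂ), ← AddChar.map_neg_eq_conj]
    rw [show a * ((σ : ZMod n) * (j - l)) = a * (σ : ZMod n) * j + -(a * (σ : ZMod n) * l) by ring,
      AddChar.map_add_eq_mul]
    ring
  simp_rw [h1]
  rw [Finset.sum_comm, Finset.sum_mul]
  refine Finset.sum_congr rfl fun j hj => ?_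
  rw [Finset.sum_comm]
  simp_rw [← Finset.mul_sum, sum_stdAddChar_mul, Units.mul_right_eq_zero, sub_eq_zero]
  simp only [mul_ite, mul_zero, Finset.sum_ite_eq, hj, if_true]
  rw [Complex.mul_conj']

lemma avg_bucketNoise_sq_le {n B : ℕ} [NeZero n] {G : ZMod n → ℝ}
    (hG : IsFlatFilter n B 8 G) (hn : ∃ m : ℕ, n = 2 ^ m) (hB : ∃ β : ℕ, B = 2 ^ β)
    {Q : Finset (ZMod n)} (x : ZMod n → ℂ) {i : ZMod n} (hi : i ∉ Q) :
    avg (fun h : Seed n => bucketNoise B G Q x h i ^ 2) ≤ 2 ^ 10 / B * l2On Q x ^ 2 := by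
  have h1 : avg (fun h : Seed n => bucketNoise B G Q x h i ^ 2) =
      avg (fun h : Seed n => ∑ j ∈ Q, ‖x j‖ ^ 2 * G (offset B h i j) ^ 2) := by
    rw [avg_prod, avg_prod]
    congr 1; funext σ
    rw [avg_prod, avg_prod]
    congr 1; funext q
    have h2 := avg_norm_sq_modulated_sum σ Q fun j => x j * (G (offset B (σ, q, 0) i j) : ℂ)
    -- Offsets ignore a, so for fixed σ and q only the phases are random.
    have h3 : ∀ a j, offset B (σ, q, a) i j = offset B (σ, q, 0) i j := fun a j => rfl
    simp only [bucketNoise, h3, avg_const]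
    rw [h2]
    refine Finset.sum_congr rfl fun j _ => ?_
    rw [norm_mul, mul_pow, Complex.norm_real, Real.norm_eq_abs, sq_abs]
  rw [h1, avg_sum, l2On, Real.sq_sqrt (Finset.sum_nonneg fun _ _ => by positivity), Finset.mul_sum]
  refine Finset.sum_le_sum fun j hj => ?_
  rw [avg_const_mul, mul_comm]
  gcongr
  refine le_trans (avg_mono fun h => ?_) (avg_filter_le hG hn hB (i := i) (j := j) ?_)
  · exact pow_le_of_le_one (hG.nonneg _) (hG.le_one _) (by norm_num)
  · rintro rfl; exact hi hj

/-! ### One pass of the partition loop -/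

/-- The union bound over m-subsets: it replaces "at least m of the events occur" by a sum of
products, whose averages factor by independence. -/
lemma one_le_sum_prod_ind {ι : Type} [DecidableEq ι] {U : Finset ι} {P : ι → Prop} {m : ℕ}
    {A : Finset ι} (hA : A ⊆ U) (hP : ∀ s ∈ A, P s) (hm : m ≤ #A) :
    1 ≤ ∑ J ∈ powersetCard m U, ∏ s ∈ J, ind (P s) := by
  obtain ⟨J, hJ, hJm⟩ := exists_subset_card_eq hm
  have h1 := single_le_sum (f := fun J => ∏ s ∈ J, ind (P s))
    (fun J _ => prod_nonneg fun s _ => ind_nonneg _) (mem_powersetCard.2 ⟨hJ.trans hA, hJm⟩)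
  refine le_trans (le_of_eq ?_) h1
  exact (prod_eq_one fun s hs => ind_of (hP s (hJ hs))).symm

lemma avg_apply {Ω : Type} [Fintype Ω] [Nonempty Ω] {ι : Type} [Fintype ι] [DecidableEq ι]
    (s : ι) (f : Ω → ℝ) : avg (fun H : ι → Ω => f (H s)) = avg f := by
  have := avg_pi_prod (Ω := Ω) {s} fun _ => f
  simpa using this

lemma avg_mul_prod {Ω : Type} [Fintype Ω] [Nonempty Ω] {ι : Type} [Fintype ι] [DecidableEq ι]
    {s : ι} {J : Finset ι} (hs : s ∉ J) (f g : Ω → ℝ) :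
    avg (fun H : ι → Ω => f (H s) * ∏ r ∈ J, g (H r)) = avg f * avg g ^ #J := by
  have := avg_pi_prod (Ω := Ω) (insert s J) fun r => if r = s then f else g
  simp only [prod_insert hs, if_true] at this
  have h1 : ∀ r ∈ J, r ≠ s := fun r hr h => hs (h ▸ hr)
  have h2 : ∀ H : ι → Ω, ∏ r ∈ J, (if r = s then f else g) (H r) = ∏ r ∈ J, g (H r) := fun H =>
    prod_congr rfl fun r hr => by rw [if_neg (h1 r hr)]
  have h3 : ∏ r ∈ J, avg (if r = s then f else g) = avg g ^ #J := by
    rw [← prod_const]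
    exact prod_congr rfl fun r hr => by rw [if_neg (h1 r hr)]
  simp only [h2, h3] at this
  exact this

lemma avg_collides_le {n : ℕ} [NeZero n] (hn : ∃ m : ℕ, n = 2 ^ m) {B R : ℕ} (hR : 1 ≤ R)
    (a b : ZMod n) : avg (fun h : Seed n => ind (Collides B R h a b)) ≤ 4 * R / B := by
  have hR' : (1 : ℝ) ≤ R := by exact_mod_cast hR
  have hn0 : (0 : ℝ) < n := by exact_mod_cast NeZero.pos n
  rcases eq_or_ne a b with rfl | hab
  · have : ∀ h : Seed n, ind (Collides B R h a a) = 0 := fun h => ind_of_not fun hc => hc.1 rfl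
    simp only [this]
    exact avg_const_le (by positivity) |>.trans (by positivity)
  · refine (avg_mono fun h => ind_mono And.right).trans ?_
    have hρ : 0 ≤ (n : ℝ) / B * ((R : ℝ) - 1) := mul_nonneg (by positivity) (by linarith)
    refine (avg_hash_near_le hn hab hρ).trans ?_
    have : 4 * ((n : ℝ) / B * ((R : ℝ) - 1)) / n = 4 * ((R : ℝ) - 1) / B := by field_simp
    rw [this]
    gcongr
    linarith

lemma avg_exists_collides_le {n : ℕ} [NeZero n] (hn : ∃ m : ℕ, n = 2 ^ m) {B R : ℕ} (hR : 1 ≤ R)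
    (Q : Finset (ZMod n)) (a : ZMod n) :
    avg (fun h : Seed n => ind (∃ b ∈ Q, Collides B R h a b)) ≤ #Q * (4 * R / B) := by
  calc _ ≤ avg (fun h : Seed n => ∑ b ∈ Q, ind (Collides B R h a b)) := by
        refine avg_mono fun h => ind_le (sum_nonneg fun _ _ => ind_nonneg _) ?_
        rintro ⟨b, hb, hc⟩
        have := single_le_sum (f := fun b => ind (Collides B R h a b))
          (fun _ _ => ind_nonneg _) hb
        simpa [ind_of hc] using this
    _ ≤ ∑ b ∈ Q, (4 * R / B : ℝ) := by
        rw [avg_sum]; exact sum_le_sum fun b _ => avg_collides_le hn hR a b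
    _ = _ := by simp

lemma IsBad.exists_finset {n R B : ℕ} {δ : ℝ} {H : Fin R → Seed n} {Q : Finset (ZMod n)}
    {a : ZMod n} (h : IsBad δ B H Q a) {m : ℕ} (hm : (m : ℝ) ≤ (R : ℝ) ^ (-δ) * R) :
    ∃ A : Finset (Fin R), m < #A ∧ ∀ s ∈ A, ∃ b ∈ Q, Collides B R (H s) a b := by
  classical
  refine ⟨univ.filter fun s => ∃ b ∈ Q, Collides B R (H s) a b, ?_, by simp⟩
  have h1 := hm.trans_lt h
  rw [Set.ncard_eq_toFinset_card'] at h1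
  simpa using h1

lemma avg_isBad_le {n : ℕ} [NeZero n] (hn : ∃ m : ℕ, n = 2 ^ m) {B R m : ℕ} (hR : 1 ≤ R) {δ : ℝ}
    (hm : (m : ℝ) ≤ (R : ℝ) ^ (-δ) * R) (Q : Finset (ZMod n)) (a : ZMod n) :
    avg (fun H : Fin R → Seed n => ind (IsBad δ B H Q a)) ≤ (R * (#Q * (4 * R / B))) ^ m := by
  calc _ ≤ avg (fun H : Fin R → Seed n => ∑ J ∈ powersetCard m univ,
          ∏ s ∈ J, ind (∃ b ∈ Q, Collides B R (H s) a b)) := by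
        refine avg_mono fun H => ind_le
          (sum_nonneg fun _ _ => prod_nonneg fun _ _ => ind_nonneg _) fun hb => ?_
        obtain ⟨A, hA, hAP⟩ := hb.exists_finset hm
        exact one_le_sum_prod_ind (subset_univ A) hAP hA.le
    _ ≤ ∑ J ∈ powersetCard m (univ : Finset (Fin R)), (#Q * (4 * R / B) : ℝ) ^ m := by
        rw [avg_sum]
        refine sum_le_sum fun J hJ => ?_
        rw [avg_pi_prod J fun _ h => ind (∃ b ∈ Q, Collides B R h a b), prod_const,
          (mem_powersetCard.1 hJ).2]
        exact pow_le_pow_left₀ (avg_nonneg fun _ => ind_nonneg _) (avg_exists_collides_le hn hR Q a) m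
    _ ≤ _ := by
        rw [sum_const, card_powersetCard, card_univ, Fintype.card_fin, nsmul_eq_mul, mul_pow (R : ℝ)]
        gcongr
        exact_mod_cast Nat.choose_le_pow R m

/-- Badness of b and the collision of a with b both involve seed s. Dropping s from the witnesses of
badness leaves two independent events. -/
lemma avg_isBad_and_collides_le {n : ℕ} [NeZero n] (hn : ∃ m : ℕ, n = 2 ^ m) {B R m : ℕ}
    (hR : 1 ≤ R) {δ : ℝ} (hm : (m : ℝ) ≤ (R : ℝ) ^ (-δ) * R) (Q : Finset (ZMod n))
    (a b : ZMod n) (s : Fin R) :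
    avg (fun H : Fin R → Seed n => ind (IsBad δ B H Q b ∧ Collides B R (H s) a b)) ≤
      4 * R / B * (R * (#Q * (4 * R / B))) ^ m := by
  calc _ ≤ avg (fun H : Fin R → Seed n => ∑ J ∈ powersetCard m (univ.erase s),
          ind (Collides B R (H s) a b) * ∏ r ∈ J, ind (∃ c ∈ Q, Collides B R (H r) b c)) := by
        refine avg_mono fun H => ind_le (sum_nonneg fun _ _ => mul_nonneg (ind_nonneg _)
          (prod_nonneg fun _ _ => ind_nonneg _)) fun hb => ?_
        obtain ⟨A, hA, hAP⟩ := hb.1.exists_finset hm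
        rw [← mul_sum, ind_of hb.2, one_mul]
        refine one_le_sum_prod_ind (A := A.erase s) (erase_subset_erase _ (subset_univ A))
          (fun r hr => hAP r (mem_of_mem_erase hr)) ?_
        -- Badness is a strict inequality, so more than m seeds collide and at least m remain after
        -- s is removed.
        have := pred_card_le_card_erase (s := A) (a := s)
        omega
    _ ≤ ∑ J ∈ powersetCard m ((univ : Finset (Fin R)).erase s),
          (4 * R / B : ℝ) * (#Q * (4 * R / B) : ℝ) ^ m := by
        rw [avg_sum]
        refine sum_le_sum fun J hJ => ?_
        have hsJ : s ∉ J := fun h => by simpa using (mem_powersetCard.1 hJ).1 h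
        rw [avg_mul_prod hsJ (fun h => ind (Collides B R h a b))
          fun h => ind (∃ c ∈ Q, Collides B R h b c), (mem_powersetCard.1 hJ).2]
        exact mul_le_mul (avg_collides_le hn hR a b)
          (pow_le_pow_left₀ (avg_nonneg fun _ => ind_nonneg _) (avg_exists_collides_le hn hR Q b) m)
          (pow_nonneg (avg_nonneg fun _ => ind_nonneg _) _) (by positivity)
    _ ≤ _ := by
        have h1 : (((R - 1).choose m : ℕ) : ℝ) ≤ (R : ℝ) ^ m := by
          exact_mod_cast (Nat.choose_le_pow (R - 1) m).trans (Nat.pow_le_pow_left (by omega) m)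
        rw [sum_const, card_powersetCard, card_erase_of_mem (mem_univ _), card_univ,
          Fintype.card_fin, nsmul_eq_mul, mul_pow (R : ℝ), mul_left_comm]
        gcongr

lemma IsCrowded.one_le_sum {n R B : ℕ} [NeZero n] {h : Seed n} {Q : Finset (ZMod n)} {a : ZMod n}
    (hR : 1 ≤ R) (hc : IsCrowded (((R : ℝ) ^ 3)⁻¹) B h Q a) :
    1 ≤ ∑ p ∈ range (#Q * R ^ 3 + 1), ∑ b ∈ Q.erase a, (R : ℝ) ^ 3 * (1 / 4) ^ p *
      ind ((circAbs (hashPerm h b - hashPerm h a) : ℝ) ≤ (n : ℝ) / B * 2 ^ p) := by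
  classical
  obtain ⟨p, hp⟩ := hc
  have hR' : (0 : ℝ) < (R : ℝ) ^ 3 := by
    have : (1 : ℝ) ≤ R := by exact_mod_cast hR
    positivity
  have hset : {b : ZMod n | b ∈ Q ∧ b ≠ a ∧
      (circAbs (hashPerm h b - hashPerm h a) : ℝ) ≤ (n : ℝ) / B * 2 ^ p} =
      ((Q.erase a).filter fun b =>
        (circAbs (hashPerm h b - hashPerm h a) : ℝ) ≤ (n : ℝ) / B * 2 ^ p : Finset (ZMod n)) := by
    ext b; simp [and_assoc, and_left_comm]
  rw [hset, Set.ncard_coe_finset, inv_mul_le_iff₀ hR', pow_mul,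
    show (2 : ℝ) ^ 2 = 4 by norm_num] at hp
  -- A crowded scale satisfies p < 4^p ≤ R³|Q|, so finitely many scales suffice; the crude range is
  -- harmless because the series is geometric.
  have hpm : p ∈ range (#Q * R ^ 3 + 1) := by
    rw [mem_range, Nat.lt_succ_iff]
    have h1 : ((4 ^ p : ℕ) : ℝ) ≤ ((R ^ 3 * #Q : ℕ) : ℝ) := by
      push_cast
      refine hp.trans ?_
      gcongr
      exact (filter_subset _ _).trans (erase_subset _ _)
    have h2 : 4 ^ p ≤ R ^ 3 * #Q := by exact_mod_cast h1
    have h3 : p < 4 ^ p := Nat.lt_pow_self (by norm_num)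
    rw [mul_comm]; omega
  refine le_trans ?_ (single_le_sum (f := fun p => ∑ b ∈ Q.erase a, (R : ℝ) ^ 3 * (1 / 4) ^ p *
      ind ((circAbs (hashPerm h b - hashPerm h a) : ℝ) ≤ (n : ℝ) / B * 2 ^ p))
      (fun p _ => sum_nonneg fun b _ => mul_nonneg (by positivity) (ind_nonneg _)) hpm)
  rw [← mul_sum]
  simp only [ind]
  rw [sum_boole]
  have h4 : (1 : ℝ) = (1 / 4) ^ p * 4 ^ p := by rw [← mul_pow]; norm_num
  rw [mul_right_comm, mul_comm _ ((1 / 4 : ℝ) ^ p)]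
  refine h4.le.trans ?_
  gcongr

lemma avg_isCrowded_le {n : ℕ} [NeZero n] (hn : ∃ m : ℕ, n = 2 ^ m) {B R : ℕ} (hR : 1 ≤ R)
    (Q : Finset (ZMod n)) (a : ZMod n) :
    avg (fun h : Seed n => ind (IsCrowded (((R : ℝ) ^ 3)⁻¹) B h Q a)) ≤ 8 * #Q * R ^ 3 / B := by
  have hn0 : (0 : ℝ) < n := by exact_mod_cast NeZero.pos n
  calc _ ≤ avg (fun h : Seed n => ∑ p ∈ range (#Q * R ^ 3 + 1), ∑ b ∈ Q.erase a,
          (R : ℝ) ^ 3 * (1 / 4) ^ p *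
          ind ((circAbs (hashPerm h b - hashPerm h a) : ℝ) ≤ (n : ℝ) / B * 2 ^ p)) :=
        avg_mono fun h => ind_le (sum_nonneg fun p _ => sum_nonneg fun b _ =>
          mul_nonneg (by positivity) (ind_nonneg _)) fun hc => hc.one_le_sum hR
    _ ≤ ∑ p ∈ range (#Q * R ^ 3 + 1), ∑ b ∈ Q.erase a, (4 * R ^ 3 / B : ℝ) * (1 / 2) ^ p := by
        rw [avg_sum]
        refine sum_le_sum fun p _ => ?_
        rw [avg_sum]
        refine sum_le_sum fun b hb => ?_
        rw [avg_const_mul]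
        calc _ ≤ (R : ℝ) ^ 3 * (1 / 4) ^ p * (4 * ((n : ℝ) / B * 2 ^ p) / n) := by
              gcongr
              exact avg_hash_near_le hn (ne_of_mem_erase hb) (by positivity)
          _ = (4 * R ^ 3 / B : ℝ) * ((1 / 4) ^ p * 2 ^ p) := by field_simp
          _ = _ := by rw [← mul_pow]; norm_num
    _ ≤ ∑ p ∈ range (#Q * R ^ 3 + 1), #Q * ((4 * R ^ 3 / B : ℝ) * (1 / 2) ^ p) := by
        refine sum_le_sum fun p _ => ?_
        rw [sum_const, nsmul_eq_mul]
        gcongr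
        exact erase_subset _ _
    _ ≤ #Q * ((4 * R ^ 3 / B : ℝ) * 2) := by
        rw [← mul_sum, ← mul_sum]
        gcongr
        exact sum_geometric_two_le _
    _ = _ := by ring

lemma sum_ind_eq_card {α : Type*} (S : Finset α) (P : α → Prop) [DecidablePred P] :
    (#(S.filter P) : ℝ) = ∑ a ∈ S, ind (P a) := by
  rw [← Finset.sum_boole]
  refine Finset.sum_congr rfl fun a _ => ?_
  by_cases h : P a <;> simp [ind, h]

lemma avg_card_partitionStep_le {n : ℕ} [NeZero n] (hn : ∃ m : ℕ, n = 2 ^ m) {B R m : ℕ}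
    (hR : 1 ≤ R) {δ : ℝ} (hm : (m : ℝ) ≤ (R : ℝ) ^ (-δ) * R) (S Q : Finset (ZMod n))
    (hsmall : R * (#Q * (4 * R / B : ℝ)) ≤ 1) :
    avg (fun H : Fin R → Seed n => (#(partitionStep δ B S H Q) : ℝ)) ≤
      2 * #S * (R * (#Q * (4 * R / B : ℝ))) ^ m + 8 * (#Q : ℝ) ^ 2 * R ^ 4 / B := by
  classical
  set X : ℝ := (R * (#Q * (4 * R / B : ℝ))) with hX
  have hX0 : 0 ≤ X := by positivity
  have h1 : ∀ H : Fin R → Seed n, (#(partitionStep δ B S H Q) : ℝ) ≤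
      ∑ a ∈ S, ind (IsBad δ B H Q a) +
      ∑ a ∈ Q, ∑ b ∈ S, ∑ s, ind (IsBad δ B H Q b ∧ Collides B R (H s) a b) +
      ∑ a ∈ Q, ∑ s, ind (IsCrowded (((R : ℝ) ^ 3)⁻¹) B (H s) Q a) := by
    intro H
    unfold partitionStep
    refine (Nat.cast_le.2 ((card_union_le _ _).trans
      (Nat.add_le_add_right (card_union_le _ _) _))).trans ?_
    push_cast
    rw [sum_ind_eq_card, sum_ind_eq_card, sum_ind_eq_card]
    refine add_le_add (add_le_add le_rfl (sum_le_sum fun a _ => ?_)) (sum_le_sum fun a _ => ?_)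
    · refine ind_le (sum_nonneg fun _ _ => sum_nonneg fun _ _ => ind_nonneg _) ?_
      rintro ⟨b, hb, hbad, s, hs⟩
      have e1 := single_le_sum (f := fun s => ind (IsBad δ B H Q b ∧ Collides B R (H s) a b))
        (fun _ _ => ind_nonneg _) (mem_univ s)
      have e2 := single_le_sum
        (f := fun b => ∑ s, ind (IsBad δ B H Q b ∧ Collides B R (H s) a b))
        (fun _ _ => sum_nonneg fun _ _ => ind_nonneg _) hb
      rw [ind_of ⟨hbad, hs⟩] at e1
      exact e1.trans e2
    · refine ind_le (sum_nonneg fun _ _ => ind_nonneg _) ?_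
      rintro ⟨s, hs⟩
      have e1 := single_le_sum (f := fun s => ind (IsCrowded (((R : ℝ) ^ 3)⁻¹) B (H s) Q a))
        (fun _ _ => ind_nonneg _) (mem_univ s)
      rwa [ind_of hs] at e1
  refine (avg_mono h1).trans ?_
  rw [avg_add, avg_add, avg_sum, avg_sum, avg_sum]
  have hb1 : ∑ a ∈ S, avg (fun H : Fin R → Seed n => ind (IsBad δ B H Q a)) ≤ #S * X ^ m := by
    refine (sum_le_sum fun a _ => avg_isBad_le hn hR hm Q a).trans ?_
    simp [hX]
  have hb2 : ∑ a ∈ Q, avg (fun H : Fin R → Seed n => ∑ b ∈ S, ∑ s,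
      ind (IsBad δ B H Q b ∧ Collides B R (H s) a b)) ≤ #S * X ^ m := by
    calc _ ≤ ∑ a ∈ Q, ∑ b ∈ S, ∑ s : Fin R, (4 * R / B * X ^ m : ℝ) := by
          refine sum_le_sum fun a _ => ?_
          rw [avg_sum]
          refine sum_le_sum fun b _ => ?_
          rw [avg_sum]
          exact sum_le_sum fun s _ => avg_isBad_and_collides_le hn hR hm Q a b s
      -- Summing the collision probability 4R/B over all a ∈ Q and all seeds produces exactly one
      -- more factor X, which is at most 1.
      _ = #S * (X * X ^ m) := by simp [hX]; ring
      _ ≤ _ := by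
          gcongr
          exact mul_le_of_le_one_left (by positivity) hsmall
  have hb3 : ∑ a ∈ Q, avg (fun H : Fin R → Seed n => ∑ s,
      ind (IsCrowded (((R : ℝ) ^ 3)⁻¹) B (H s) Q a)) ≤ 8 * (#Q : ℝ) ^ 2 * R ^ 4 / B := by
    calc _ ≤ ∑ a ∈ Q, ∑ s : Fin R, (8 * #Q * R ^ 3 / B : ℝ) := by
          refine sum_le_sum fun a _ => ?_
          rw [avg_sum]
          refine sum_le_sum fun s _ => ?_
          rw [avg_apply s fun h => ind (IsCrowded (((R : ℝ) ^ 3)⁻¹) B h Q a)]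
          exact avg_isCrowded_le hn hR Q a
      _ = _ := by simp; ring
  linarith

/-! ### Parameters -/

lemma numReps_cast (C₁ t : ℕ) : (numReps C₁ t : ℝ) = C₁ * 2 ^ t := by simp [numReps]

lemma numReps_pos {C₁ : ℕ} (hC : 1 ≤ C₁) (t : ℕ) : 1 ≤ numReps C₁ t :=
  Nat.mul_pos hC (by positivity)

lemma numBuckets_isPow (C₁ : ℕ) (C₂ : ℝ) (k t : ℕ) : ∃ β : ℕ, numBuckets C₁ C₂ k t = 2 ^ β :=
  ⟨_, rfl⟩

lemma numBuckets_pos (C₁ : ℕ) (C₂ : ℝ) (k t : ℕ) : (0 : ℝ) < numBuckets C₁ C₂ k t := by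
  unfold numBuckets; positivity

lemma inv_numBuckets_le {C₁ : ℕ} (hC : 1 ≤ C₁) {C₂ : ℝ} (hC₂ : 0 < C₂) {k : ℕ} (hk : 1 ≤ k)
    (t : ℕ) : ((numBuckets C₁ C₂ k t : ℝ))⁻¹ ≤ (numReps C₁ t : ℝ) ^ 2 / (C₂ * k) := by
  have hR : (0 : ℝ) < numReps C₁ t := by exact_mod_cast numReps_pos hC t
  have hk' : (0 : ℝ) < k := by exact_mod_cast hk
  rw [← inv_div (C₂ * k)]
  gcongr
  refine (Nat.le_ceil _).trans ?_
  unfold numBuckets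
  exact_mod_cast Nat.le_pow_clog (by norm_num) _

/-- The doubly exponentially decreasing factor `2^{-2^{(1-δ)t}}`. -/
def dblExp (δ : ℝ) (t : ℕ) : ℝ := (2 : ℝ) ^ (-(2 : ℝ) ^ ((1 - δ) * (t : ℝ)))

lemma dblExp_pos (δ : ℝ) (t : ℕ) : 0 < dblExp δ t := by unfold dblExp; positivity

/-- The bound on the size of the part handled in round `t + 1`. -/
def sizeBound (δ : ℝ) (k t : ℕ) : ℝ := k * (1 / 2) ^ t * (2 * dblExp δ t)

lemma sizeBound_eq {C₁ : ℕ} (hC : 1 ≤ C₁) (δ : ℝ) (k t : ℕ) :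
    k * ((numReps C₁ 0 : ℝ) / numReps C₁ t) * (2 : ℝ) ^ (-(2 : ℝ) ^ ((1 - δ) * (t : ℝ)) + 1) =
      sizeBound δ k t := by
  have hC' : (C₁ : ℝ) ≠ 0 := by exact_mod_cast (by omega : C₁ ≠ 0)
  rw [sizeBound, dblExp, Real.rpow_add (by norm_num), Real.rpow_one, numReps_cast, numReps_cast]
  rw [one_div, inv_pow]
  field_simp

lemma sizeBound_pos (δ : ℝ) {k : ℕ} (hk : 1 ≤ k) (t : ℕ) : 0 < sizeBound δ k t := by
  have hk' : (0 : ℝ) < k := by exact_mod_cast hk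
  have := dblExp_pos δ t
  unfold sizeBound; positivity

lemma sizeBound_zero (δ : ℝ) (k : ℕ) : sizeBound δ k 0 = k := by
  simp [sizeBound, dblExp, Real.rpow_neg_one]

/-- A doubly exponential decay absorbs every exponential growth. -/
lemma exists_bound_exp_mul_dblExp (a : ℝ) {γ r : ℝ} (hγ : 0 < γ) (hr : 1 < r) :
    ∃ M : ℝ, 0 < M ∧ ∀ t : ℕ, (2 : ℝ) ^ (a * t - γ * r ^ t) ≤ M := by
  obtain ⟨c, hc⟩ := (tendsto_pow_const_div_const_pow_of_one_lt 2 hr).bddAbove_range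
  have hc' : ∀ t : ℕ, (t : ℝ) ^ 2 ≤ (|c| + 1) * r ^ t := by
    intro t
    have h1 : (t : ℝ) ^ 2 / r ^ t ≤ c := hc ⟨t, rfl⟩
    have h2 : (t : ℝ) ^ 2 / r ^ t ≤ |c| + 1 := h1.trans (by linarith [le_abs_self c])
    rwa [div_le_iff₀ (by positivity)] at h2
  have hd : 0 < |c| + 1 := by positivity
  set d := |c| + 1
  refine ⟨2 ^ (a ^ 2 * d / (4 * γ)), by positivity, fun t => ?_⟩
  refine Real.rpow_le_rpow_of_exponent_le (by norm_num) ?_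
  have h1 : γ * (t : ℝ) ^ 2 / d ≤ γ * r ^ t := by
    rw [div_le_iff₀ hd]
    calc γ * (t : ℝ) ^ 2 ≤ γ * (d * r ^ t) := by gcongr; exact hc' t
      _ = _ := by ring
  -- With r^t replaced by a multiple of t², the exponent is a concave quadratic; the bound comes
  -- from completing the square.
  have h2 : a * t - γ * (t : ℝ) ^ 2 / d ≤ a ^ 2 * d / (4 * γ) := by
    have : a ^ 2 * d / (4 * γ) - (a * t - γ * (t : ℝ) ^ 2 / d) =
        (a * d - 2 * γ * t) ^ 2 / (4 * γ * d) := by field_simp; ring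
    have h3 : 0 ≤ (a * d - 2 * γ * t) ^ 2 / (4 * γ * d) := by positivity
    linarith
  linarith

lemma two_rpow_mul_natCast (ρ : ℝ) (t : ℕ) : (2 : ℝ) ^ (ρ * (t : ℝ)) = ((2 : ℝ) ^ ρ) ^ t := by
  rw [Real.rpow_mul (by norm_num), Real.rpow_natCast]

lemma exists_pow_mul_dblExp_le {δ : ℝ} (hδ₁ : δ < 1 / 2) :
    ∃ M : ℝ, 0 < M ∧ ∀ t : ℕ, (8 : ℝ) ^ t * dblExp δ t ≤ M := by
  have hr : (1 : ℝ) < 2 ^ (1 - δ) := Real.one_lt_rpow (by norm_num) (by linarith)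
  obtain ⟨M, hM0, hM⟩ := exists_bound_exp_mul_dblExp 3 one_pos hr
  refine ⟨M, hM0, fun t => le_trans (le_of_eq ?_) (hM t)⟩
  rw [dblExp, two_rpow_mul_natCast, one_mul]
  set r : ℝ := (2 : ℝ) ^ (1 - δ)
  rw [sub_eq_add_neg, Real.rpow_add (by norm_num), two_rpow_mul_natCast]
  norm_num

/-- With r = 2^{1-δ}, the square divided by the next term is 2^{-(2-r)r^t}, and δ > 0 gives r < 2.
This lets the quadratic cost of crowding fit the next size bound. -/
lemma exists_pow_mul_dblExp_sq_le {δ : ℝ} (hδ₀ : 0 < δ) (hδ₁ : δ < 1 / 2) :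
    ∃ M : ℝ, 0 < M ∧ ∀ t : ℕ, (64 : ℝ) ^ t * dblExp δ t ^ 2 ≤ M * dblExp δ (t + 1) := by
  have hr : (1 : ℝ) < 2 ^ (1 - δ) := Real.one_lt_rpow (by norm_num) (by linarith)
  have hr2 : (2 : ℝ) ^ (1 - δ) < 2 := by
    calc (2 : ℝ) ^ (1 - δ) < 2 ^ (1 : ℝ) := Real.rpow_lt_rpow_of_exponent_lt (by norm_num) (by linarith)
      _ = 2 := Real.rpow_one 2
  obtain ⟨M, hM0, hM⟩ := exists_bound_exp_mul_dblExp 6 (sub_pos.2 hr2) hr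
  refine ⟨M, hM0, fun t => ?_⟩
  rw [← div_le_iff₀ (dblExp_pos _ _)]
  refine le_trans (le_of_eq ?_) (hM t)
  rw [dblExp, dblExp, two_rpow_mul_natCast, two_rpow_mul_natCast]
  set r : ℝ := (2 : ℝ) ^ (1 - δ)
  have h64 : (64 : ℝ) ^ t = 2 ^ ((6 : ℝ) * t) := by rw [two_rpow_mul_natCast]; norm_num
  rw [h64, div_eq_mul_inv, ← Real.rpow_neg (by norm_num), sq, ← Real.rpow_add (by norm_num),
    ← Real.rpow_add (by norm_num), ← Real.rpow_add (by norm_num), pow_succ]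
  congr 1
  ring

/-- Since δ < 1/2, the base 2^{1-δ} is at least √2 ≥ 1.4, and Bernoulli's inequality applies. The
form (t+4)/3 is what the exponent comparison in `pow_floor_le_dblExp` needs. -/
lemma add_four_div_three_le {δ : ℝ} (hδ₁ : δ < 1 / 2) (t : ℕ) :
    ((t : ℝ) + 4) / 3 ≤ (2 : ℝ) ^ ((1 - δ) * ((t + 1 : ℕ) : ℝ)) := by
  rw [two_rpow_mul_natCast]
  have h1 : (1.4 : ℝ) ≤ 2 ^ (1 - δ) := by
    calc (1.4 : ℝ) ≤ Real.sqrt 2 := Real.le_sqrt_of_sq_le (by norm_num)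
      _ = 2 ^ (1 / 2 : ℝ) := Real.sqrt_eq_rpow 2
      _ ≤ _ := Real.rpow_le_rpow_of_exponent_le (by norm_num) (by linarith)
  have h2 := one_add_mul_le_pow (a := (0.4 : ℝ)) (by norm_num) (t + 1)
  have h3 : (1 + 0.4 : ℝ) ^ (t + 1) ≤ ((2 : ℝ) ^ (1 - δ)) ^ (t + 1) := by
    gcongr
    norm_num at h1 ⊢
    exact h1
  push_cast at h2
  have : (0 : ℝ) ≤ t := Nat.cast_nonneg t
  linarith

/-- The exponent is at least half of z = 2^{(1-δ)(t+1)}, so the power is at most 2^{-7z}. One z pays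
for the doubly exponential factor; the other six pay for 4^{-t} and the constants. -/
lemma pow_floor_le_dblExp {δ : ℝ} (hδ₁ : δ < 1 / 2) {C₁ : ℕ} (hC : 1 ≤ C₁) (t : ℕ) {x : ℝ}
    (hx0 : 0 ≤ x) (hx : x ≤ (1 / 2) ^ 14) :
    2 * x ^ ⌊(numReps C₁ (t + 1) : ℝ) ^ (-δ) * numReps C₁ (t + 1)⌋₊ ≤
      (1 / 4) ^ t * dblExp δ (t + 1) / 100 := by
  have hR1 : (1 : ℝ) ≤ numReps C₁ (t + 1) := by exact_mod_cast numReps_pos hC _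
  set R : ℝ := (numReps C₁ (t + 1) : ℝ) with hR
  have hy : R ^ (-δ) * R = R ^ (1 - δ) := by
    rw [← Real.rpow_add_one (by positivity)]; congr 1; ring
  set z : ℝ := (2 : ℝ) ^ ((1 - δ) * ((t + 1 : ℕ) : ℝ)) with hz
  have hz1 : 1 ≤ z := Real.one_le_rpow (by norm_num) (mul_nonneg (by linarith) (by positivity))
  have hzR : z ≤ R ^ (1 - δ) := by
    rw [hz, mul_comm, Real.rpow_mul (by norm_num), Real.rpow_natCast]
    refine Real.rpow_le_rpow (by positivity) ?_ (by linarith)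
    rw [hR, numReps_cast]
    exact le_mul_of_one_le_left (by positivity) (by exact_mod_cast hC)
  rw [hy]
  set m := ⌊R ^ (1 - δ)⌋₊ with hm
  have hm2 : z ≤ 2 * m := by
    have h1 : R ^ (1 - δ) < m + 1 := Nat.lt_floor_add_one _
    have h2 : (1 : ℝ) ≤ m := by
      exact_mod_cast (Nat.one_le_floor_iff _).2 (hz1.trans hzR)
    linarith
  have h14 : x ^ m ≤ (2 : ℝ) ^ (-(7 * z)) := by
    calc x ^ m ≤ ((1 / 2) ^ 14) ^ m := by gcongr
      _ = (2 : ℝ) ^ (-(14 * (m : ℝ))) := by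
        rw [← pow_mul, one_div, inv_pow, Real.rpow_neg (by norm_num)]
        congr 1
        exact_mod_cast (Real.rpow_natCast 2 (14 * m)).symm
      _ ≤ _ := Real.rpow_le_rpow_of_exponent_le (by norm_num) (by linarith)
  have hD : dblExp δ (t + 1) = (2 : ℝ) ^ (-z) := rfl
  rw [hD]
  have h4 : (1 / 4 : ℝ) ^ t = 2 ^ (-(2 * (t : ℝ))) := by
    rw [Real.rpow_neg (by norm_num), two_rpow_mul_natCast, ← inv_pow]; norm_num
  have h100 : (2 : ℝ) ^ (-(7 : ℝ)) ≤ 1 / 100 := by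
    rw [Real.rpow_neg (by norm_num)]; norm_num
  calc 2 * x ^ m ≤ 2 * (2 : ℝ) ^ (-(7 * z)) := by gcongr
    _ = (2 : ℝ) ^ (1 + -(7 * z)) := by rw [Real.rpow_add (by norm_num), Real.rpow_one]
    _ ≤ (2 : ℝ) ^ (-(2 * (t : ℝ)) + -z + -7) := by
        refine Real.rpow_le_rpow_of_exponent_le (by norm_num) ?_
        have := add_four_div_three_le hδ₁ t
        rw [← hz] at this
        linarith
    _ = (2 : ℝ) ^ (-(2 * (t : ℝ))) * (2 : ℝ) ^ (-z) * 2 ^ (-(7 : ℝ)) := by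
        rw [Real.rpow_add (by norm_num), Real.rpow_add (by norm_num)]
    _ ≤ (2 : ℝ) ^ (-(2 * (t : ℝ))) * (2 : ℝ) ^ (-z) * (1 / 100) := by gcongr
    _ = _ := by rw [h4]; ring

lemma exists_partition_threshold {δ : ℝ} (hδ₀ : 0 < δ) (hδ₁ : δ < 1 / 2) {C₁ : ℕ} (hC : 1 ≤ C₁) :
    ∃ C₂₀ : ℝ, 0 < C₂₀ ∧ ∀ C₂ : ℝ, C₂₀ ≤ C₂ → ∀ k : ℕ, 1 ≤ k → ∀ t : ℕ, ∀ q : ℝ, 0 ≤ q →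
      q ≤ sizeBound δ k t → ∀ R B : ℝ, R = numReps C₁ (t + 1) →
      B = numBuckets C₁ C₂ k (t + 1) →
      R * (q * (4 * R / B)) ≤ 1 ∧
      2 * k * (R * (q * (4 * R / B))) ^ ⌊R ^ (-δ) * R⌋₊ + 8 * q ^ 2 * R ^ 4 / B ≤
        (1 / 2) ^ t / 50 * sizeBound δ k (t + 1) := by
  obtain ⟨M, hM0, hM⟩ := exists_pow_mul_dblExp_le hδ₁
  obtain ⟨M', hM'0, hM'⟩ := exists_pow_mul_dblExp_sq_le hδ₀ hδ₁
  have hC0 : (0 : ℝ) < C₁ := by exact_mod_cast hC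
  -- The first summand forces the collision parameter below 2^{-14}; the second keeps the crowding
  -- term within half of the target.
  refine ⟨2 ^ 14 * (128 * C₁ ^ 4 * M) + 204800 * C₁ ^ 6 * M', by positivity, ?_⟩
  intro C₂ hC₂ k hk t q hq0 hq R B hR hB
  have hC₂1 : 2 ^ 14 * (128 * C₁ ^ 4 * M) ≤ C₂ := by
    have : 0 ≤ 204800 * (C₁ : ℝ) ^ 6 * M' := by positivity
    linarith
  have hC₂2 : 204800 * C₁ ^ 6 * M' ≤ C₂ := by
    have : 0 ≤ 2 ^ 14 * (128 * (C₁ : ℝ) ^ 4 * M) := by positivity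
    linarith
  have hC₂0 : 0 < C₂ := lt_of_lt_of_le (by positivity) hC₂1
  have hk0 : (0 : ℝ) < k := by exact_mod_cast hk
  have hinv := inv_numBuckets_le hC hC₂0 hk (t + 1)
  rw [← hR, ← hB] at hinv
  have hRC : R = 2 * C₁ * 2 ^ t := by rw [hR, numReps_cast, pow_succ]; ring
  have hR0 : 0 < R := by rw [hRC]; positivity
  have hD := dblExp_pos δ t
  have hD' := dblExp_pos δ (t + 1)
  have hsb := (sizeBound_pos δ hk t).le
  have hhalf : ((1 : ℝ) / 2) ^ t = (2 ^ t)⁻¹ := by rw [one_div, inv_pow]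
  have h8 : (8 : ℝ) ^ t = (2 ^ t) ^ 3 := by rw [← pow_mul, mul_comm, pow_mul]; norm_num
  have h64 : (64 : ℝ) ^ t = (2 ^ t) ^ 6 := by rw [← pow_mul, mul_comm, pow_mul]; norm_num
  have h4 : ((1 : ℝ) / 4) ^ t = ((2 ^ t) ^ 2)⁻¹ := by
    rw [one_div, inv_pow, ← pow_mul, mul_comm, pow_mul]; norm_num
  have hB0 : 0 < B := by rw [hB]; exact numBuckets_pos _ _ _ _
  have hx0 : 0 ≤ R * (q * (4 * R / B)) := by positivity
  have hx : R * (q * (4 * R / B)) ≤ (1 / 2) ^ 14 := by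
    calc R * (q * (4 * R / B)) = R * (q * (4 * R * B⁻¹)) := by rw [div_eq_mul_inv]
      _ ≤ R * (sizeBound δ k t * (4 * R * (R ^ 2 / (C₂ * k)))) := by gcongr
      _ = 128 * C₁ ^ 4 * ((8 : ℝ) ^ t * dblExp δ t) / C₂ := by
        rw [sizeBound, hhalf, hRC, h8]; field_simp; ring
      _ ≤ 128 * C₁ ^ 4 * M / C₂ := by gcongr; exact hM t
      _ ≤ _ := by rw [div_le_iff₀ hC₂0]; linarith
  refine ⟨hx.trans (by norm_num), ?_⟩
  have h1 : 2 * k * (R * (q * (4 * R / B))) ^ ⌊R ^ (-δ) * R⌋₊ ≤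
      k * ((1 / 4) ^ t * dblExp δ (t + 1) / 100) := by
    have := pow_floor_le_dblExp hδ₁ hC t hx0 hx
    rw [← hR] at this
    calc _ = k * (2 * (R * (q * (4 * R / B))) ^ ⌊R ^ (-δ) * R⌋₊) := by ring
      _ ≤ _ := by gcongr
  have h2 : 8 * q ^ 2 * R ^ 4 / B ≤ k * ((1 / 4) ^ t * dblExp δ (t + 1) / 100) := by
    calc 8 * q ^ 2 * R ^ 4 / B = 8 * q ^ 2 * R ^ 4 * B⁻¹ := by rw [div_eq_mul_inv]
      _ ≤ 8 * sizeBound δ k t ^ 2 * R ^ 4 * (R ^ 2 / (C₂ * k)) := by gcongr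
      _ = 2048 * C₁ ^ 6 * k * (1 / 4) ^ t * ((64 : ℝ) ^ t * dblExp δ t ^ 2) / C₂ := by
        rw [sizeBound, hhalf, hRC, h64, h4]; field_simp; ring
      _ ≤ 2048 * C₁ ^ 6 * k * (1 / 4) ^ t * (M' * dblExp δ (t + 1)) / C₂ := by
        exact div_le_div_of_nonneg_right
          (mul_le_mul_of_nonneg_left (hM' t) (by positivity)) hC₂0.le
      _ = k * ((1 / 4) ^ t * dblExp δ (t + 1) / 100) * ((204800 * C₁ ^ 6 * M') / C₂) := by ring
      _ ≤ k * ((1 / 4) ^ t * dblExp δ (t + 1) / 100) * 1 := by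
        gcongr
        rw [div_le_one hC₂0]; exact hC₂2
      _ = _ := mul_one _
  have h3 : (1 / 2) ^ t / 50 * sizeBound δ k (t + 1) =
      2 * (k * ((1 / 4) ^ t * dblExp δ (t + 1) / 100)) := by
    rw [sizeBound, h4, pow_succ, hhalf]; field_simp; ring
  rw [h3]; linarith

/-! ### The partition succeeds with large probability -/

lemma partitionStage_congr {n C₁ T : ℕ} {δ C₂ : ℝ} {k : ℕ} {S : Finset (ZMod n)}
    {H H' : Seeds n C₁ T} (t : ℕ) (h : ∀ i : Fin T, (i : ℕ) < t → H i = H' i) :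
    partitionStage δ C₂ k S H t = partitionStage δ C₂ k S H' t := by
  induction t with
  | zero => rfl
  | succ t ih =>
    simp only [partitionStage]
    split_ifs with ht
    · rw [ih fun i hi => h i (by omega), h ⟨t, ht⟩ (by simp)]
    · rfl

/-- Fix every seed outside the current round and apply Markov's inequality to the size of the next
set. -/
lemma avg_stage_failure_le {n C₁ T : ℕ} [NeZero n] (hn : ∃ m : ℕ, n = 2 ^ m) {δ C₂ : ℝ} {k : ℕ}
    (hC : 1 ≤ C₁) (hk : 1 ≤ k) {S : Finset (ZMod n)} (hS : #S = k) (t : Fin T)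
    (hstep : ∀ q : ℝ, 0 ≤ q → q ≤ sizeBound δ k t → ∀ R B : ℝ, R = numReps C₁ (t + 1) →
      B = numBuckets C₁ C₂ k (t + 1) →
      R * (q * (4 * R / B)) ≤ 1 ∧
      2 * k * (R * (q * (4 * R / B))) ^ ⌊R ^ (-δ) * R⌋₊ + 8 * q ^ 2 * R ^ 4 / B ≤
        (1 / 2) ^ (t : ℕ) / 50 * sizeBound δ k (t + 1)) :
    avg (fun H : Seeds n C₁ T => ind ((#(partitionStage δ C₂ k S H t) : ℝ) ≤ sizeBound δ k t ∧
      sizeBound δ k (t + 1) < #(partitionStage δ C₂ k S H (t + 1)))) ≤ (1 / 2) ^ (t : ℕ) / 50 := by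
  refine avg_pi_le t _ (by positivity) fun H => ?_
  set Q := partitionStage δ C₂ k S H t with hQ
  have hb := sizeBound_pos δ hk (t + 1)
  -- The current set reads earlier rounds only, so resampling this round does not change it.
  have h1 : ∀ a, partitionStage δ C₂ k S (Function.update H t a) t = Q := fun a =>
    partitionStage_congr _ fun i hi => Function.update_of_ne (by rintro rfl; omega) _ _
  have h2 : ∀ a, partitionStage δ C₂ k S (Function.update H t a) (t + 1) =
      partitionStep δ (numBuckets C₁ C₂ k (t + 1)) S a Q := by
    intro a
    rw [partitionStage, dif_pos t.2, h1, Fin.eta, Function.update_self]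
  simp only [h1, h2]
  by_cases hq : (#Q : ℝ) ≤ sizeBound δ k t
  · obtain ⟨hs, hle⟩ := hstep #Q (Nat.cast_nonneg _) hq _ _ rfl rfl
    have hR := numReps_pos hC (t + 1)
    have h3 := avg_card_partitionStep_le hn hR (B := numBuckets C₁ C₂ k (t + 1)) (δ := δ)
      (Nat.floor_le (by positivity)) S Q hs
    rw [hS] at h3
    have h4 := h3.trans hle
    calc _ ≤ avg (fun a : Fin (numReps C₁ (t + 1)) → Seed n => (sizeBound δ k (t + 1))⁻¹ *
            (#(partitionStep δ (numBuckets C₁ C₂ k (t + 1)) S a Q) : ℝ)) := by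
          refine avg_mono fun a => ind_le (by positivity) fun h => ?_
          rw [inv_mul_eq_div, one_le_div hb]
          exact h.2.le
      _ = (sizeBound δ k (t + 1))⁻¹ * _ := avg_const_mul _ _
      _ ≤ (sizeBound δ k (t + 1))⁻¹ * ((1 / 2) ^ (t : ℕ) / 50 * sizeBound δ k (t + 1)) := by
          gcongr
      _ = _ := by field_simp
  · simp only [hq, false_and]
    refine (avg_mono fun _ => (ind_of_not not_false).le).trans ((avg_const_le le_rfl).trans ?_)
    positivity

/-- The choice of T makes the doubly exponential factor at most 1/(k+1); the additional round
supplies a factor 1/2, and k/(k+1) < 1. -/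
lemma sizeBound_numRounds_lt_one {δ : ℝ} (hδ₁ : δ < 1 / 2) {CT k : ℕ} (hCT : 1 ≤ CT)
    (hk : 1 ≤ k) : sizeBound δ k (numRounds δ CT k) < 1 := by
  have hk0 : (1 : ℝ) ≤ k := by exact_mod_cast hk
  set T := numRounds δ CT k with hT
  have hlog : 1 ≤ Real.logb 2 ((k : ℝ) + 1) := by
    rw [Real.le_logb_iff_rpow_le (by norm_num) (by positivity), Real.rpow_one]; linarith
  have hT1 : 1 / (1 - δ) * Real.logb 2 (Real.logb 2 ((k : ℝ) + 1)) ≤ T := by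
    refine (Nat.le_ceil _).trans ?_
    rw [hT, numRounds]; push_cast; linarith [(Nat.cast_nonneg CT : (0 : ℝ) ≤ CT)]
  have hT2 : 1 ≤ T := hCT.trans (Nat.le_add_left _ _)
  have h1 : Real.logb 2 (Real.logb 2 ((k : ℝ) + 1)) ≤ (1 - δ) * T := by
    rw [one_div, inv_mul_le_iff₀ (by linarith)] at hT1
    exact hT1
  have h2 : Real.logb 2 ((k : ℝ) + 1) ≤ 2 ^ ((1 - δ) * (T : ℝ)) := by
    rwa [Real.logb_le_iff_le_rpow (by norm_num) (by linarith)] at h1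
  have h3 : dblExp δ T ≤ ((k : ℝ) + 1)⁻¹ := by
    calc dblExp δ T ≤ (2 : ℝ) ^ (-Real.logb 2 ((k : ℝ) + 1)) :=
          Real.rpow_le_rpow_of_exponent_le (by norm_num) (by linarith)
      _ = _ := by
          rw [Real.rpow_neg (by norm_num), Real.rpow_logb (by norm_num) (by norm_num) (by positivity)]
  have h4 : ((1 : ℝ) / 2) ^ T ≤ 1 / 2 := pow_le_of_le_one (by norm_num) (by norm_num) (by omega)
  have hD := (dblExp_pos δ T).le
  calc sizeBound δ k T ≤ k * (1 / 2) * (2 * ((k : ℝ) + 1)⁻¹) := by unfold sizeBound; gcongr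
    _ = k / (k + 1) := by field_simp
    _ < 1 := by rw [div_lt_one (by positivity)]; linarith

/-! ### The constructed partition is isolating -/

lemma mem_partitionStep {n R B : ℕ} {δ : ℝ} {S Q : Finset (ZMod n)} {H : Fin R → Seed n}
    {a : ZMod n} : a ∈ partitionStep δ B S H Q ↔
      (a ∈ S ∧ IsBad δ B H Q a) ∨
      (a ∈ Q ∧ ∃ b ∈ S, IsBad δ B H Q b ∧ ∃ s, Collides B R (H s) a b) ∨
      (a ∈ Q ∧ ∃ s, IsCrowded (((R : ℝ) ^ 3)⁻¹) B (H s) Q a) := by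
  classical
  simp [partitionStep]

lemma partitionStage_subset {n C₁ T : ℕ} (δ C₂ : ℝ) (k : ℕ) (S : Finset (ZMod n))
    (H : Seeds n C₁ T) (t : ℕ) : partitionStage δ C₂ k S H t ⊆ S := by
  induction t with
  | zero => exact Subset.rfl
  | succ t ih =>
    simp only [partitionStage]
    split_ifs with ht
    · intro a ha
      rcases mem_partitionStep.1 ha with h | h | h
      · exact h.1
      · exact ih h.1
      · exact ih h.1
    · exact empty_subset _

lemma IsCrowded.mono {n : ℕ} [NeZero n] {lam : ℝ} {B : ℕ} {h : Seed n} {Q Q' : Finset (ZMod n)}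
    (hQ : Q ⊆ Q') {a : ZMod n} (hc : IsCrowded lam B h Q a) : IsCrowded lam B h Q' a := by
  obtain ⟨p, hp⟩ := hc
  refine ⟨p, hp.trans ?_⟩
  exact_mod_cast Set.ncard_le_ncard (fun b (hb : b ∈ Q ∧ _) => (⟨hQ hb.1, hb.2⟩ : b ∈ Q' ∧ _)) (Set.toFinite _)

lemma IsBad.mono {n R B : ℕ} {δ : ℝ} {H : Fin R → Seed n} {Q Q' : Finset (ZMod n)}
    (hQ : Q ⊆ Q') {a : ZMod n} (hb : IsBad δ B H Q a) : IsBad δ B H Q' a := by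
  refine lt_of_lt_of_le hb (Nat.cast_le.2 (Set.ncard_le_ncard ?_ (Set.toFinite _)))
  rintro s ⟨b, hb, hc⟩
  exact ⟨b, hQ hb, hc⟩

/-- An element kept in round t escaped the next stage, so it was neither crowded nor in collision
with a bad element. Both conditions were tested against a superset of its part, and crowding and
badness are monotone in that set. -/
lemma isIsolating_constructPartition {n C₁ T : ℕ} [NeZero n] {δ C₂ : ℝ} {k : ℕ} (hC : 1 ≤ C₁)
    {S : Finset (ZMod n)} {H : Seeds n C₁ T}
    (hsize : ∀ t : Fin T, (#(partitionStage δ C₂ k S H t) : ℝ) ≤ sizeBound δ k t)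
    (hempty : partitionStage δ C₂ k S H T = ∅) :
    IsIsolating δ C₂ k S H (constructPartition δ C₂ k S H) := by
  have hsub : ∀ t, constructPartition δ C₂ k S H t ⊆ partitionStage δ C₂ k S H t := fun t =>
    sdiff_subset
  have hnext : ∀ t : Fin T, ∀ a ∈ constructPartition δ C₂ k S H t,
      a ∉ partitionStage δ C₂ k S H (t + 1) := fun t a ha hmem =>
    (mem_sdiff.1 ha).2 (mem_biUnion.2 ⟨t + 1, mem_Ioc.2 ⟨by omega, t.2⟩, hmem⟩)
  have hstage : ∀ t : Fin T, partitionStage δ C₂ k S H (t + 1) =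
      partitionStep δ (numBuckets C₁ C₂ k (t + 1)) S (H t) (partitionStage δ C₂ k S H t) := by
    intro t; rw [partitionStage, dif_pos t.2]
  have hdisj : ∀ t t' : Fin T, t < t' →
      Disjoint (constructPartition δ C₂ k S H t) (constructPartition δ C₂ k S H t') := by
    intro t t' htt
    refine disjoint_left.2 fun a ha ha' => (mem_sdiff.1 ha).2
      (mem_biUnion.2 ⟨t', mem_Ioc.2 ⟨htt, t'.2.le⟩, hsub t' ha'⟩)
  refine ⟨?_, ?_, ?_, ?_, ?_⟩
  · intro t t' htt
    rcases lt_or_gt_of_ne htt with h | h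
    · exact hdisj t t' h
    · exact (hdisj t' t h).symm
  · intro i
    constructor
    · intro hi
      classical
      have hne : ((range (T + 1)).filter fun t => i ∈ partitionStage δ C₂ k S H t).Nonempty :=
        ⟨0, by simpa [partitionStage] using hi⟩
      -- The part containing i is the last stage containing it; stages need not be nested.
      set t := ((range (T + 1)).filter fun t => i ∈ partitionStage δ C₂ k S H t).max' hne with ht
      have hmem := max'_mem _ hne
      rw [← ht, mem_filter, mem_range] at hmem
      have htT : t < T := by
        rcases Nat.lt_succ_iff_lt_or_eq.1 hmem.1 with h | h
        · exact h
        · rw [h, hempty] at hmem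
          exact absurd hmem.2 (notMem_empty _)
      refine ⟨⟨t, htT⟩, mem_sdiff.2 ⟨hmem.2, fun hb => ?_⟩⟩
      obtain ⟨t', ht', hi'⟩ := mem_biUnion.1 hb
      rw [mem_Ioc] at ht'
      have := le_max' ((range (T + 1)).filter fun t => i ∈ partitionStage δ C₂ k S H t) t'
        (mem_filter.2 ⟨mem_range.2 (by omega), hi'⟩)
      rw [← ht] at this
      exact absurd ht'.1 (not_lt.2 this)
    · rintro ⟨t, ht⟩
      exact partitionStage_subset _ _ _ _ _ _ (hsub t ht)
  · intro t
    rw [sizeBound_eq hC]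
    refine le_trans ?_ (hsize t)
    exact_mod_cast card_le_card (hsub t)
  · intro t a ha s hc
    refine hnext t a ha ?_
    rw [hstage, mem_partitionStep]
    exact Or.inr (Or.inr ⟨hsub t ha, s, hc.mono (hsub t)⟩)
  · intro t a ha b hb hbad s hc
    refine hnext t a ha ?_
    rw [hstage, mem_partitionStep]
    exact Or.inr (Or.inl ⟨hsub t ha, b, hb, hbad.mono (hsub t), s, hc⟩)

/-! ### The tail noise -/

/-- The elementary symmetric function of degree `m` of the squares of `v`. -/
def esymmSq {R : ℕ} (m : ℕ) (v : Fin R → ℝ) : ℝ :=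
  ∑ J ∈ powersetCard m univ, ∏ s ∈ J, v s ^ 2

lemma esymmSq_nonneg {R : ℕ} (m : ℕ) (v : Fin R → ℝ) : 0 ≤ esymmSq m v :=
  sum_nonneg fun _ _ => prod_nonneg fun _ _ => sq_nonneg _

/-- At most `m - 1` of the values exceed a threshold given by the symmetric function. -/
lemma card_lt_of_esymmSq {R m : ℕ} (hm : 1 ≤ m) (v : Fin R → ℝ) {w : ℝ} (hw : 0 < w) :
    #{s | w + esymmSq m v / w ^ (2 * m - 1) < v s} < m := by
  by_contra hcon
  obtain ⟨J, hJ, hJm⟩ := exists_subset_card_eq (not_lt.1 hcon)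
  set E := esymmSq m v with hE
  set θ := w + E / w ^ (2 * m - 1) with hθ
  have hE0 : 0 ≤ E := esymmSq_nonneg m v
  have hwθ : w ≤ θ := by rw [hθ]; exact le_add_of_nonneg_right (by positivity)
  -- If m values exceeded θ, then θ^{2m} ≤ E < w^{2m-1}θ ≤ θ^{2m}.
  have h1 : θ ^ (2 * m) ≤ E := by
    calc θ ^ (2 * m) = ∏ s ∈ J, θ ^ 2 := by rw [prod_const, hJm, pow_mul]
      _ ≤ ∏ s ∈ J, v s ^ 2 := by
        refine prod_le_prod (fun _ _ => sq_nonneg _) fun s hs => ?_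
        have := (mem_filter.1 (hJ hs)).2
        exact pow_le_pow_left₀ (hw.le.trans hwθ) this.le 2
      _ ≤ E := single_le_sum (f := fun J => ∏ s ∈ J, v s ^ 2)
        (fun _ _ => prod_nonneg fun _ _ => sq_nonneg _)
        (mem_powersetCard.2 ⟨subset_univ J, hJm⟩)
  have h2 : E < w ^ (2 * m - 1) * θ := by
    rw [hθ, mul_add, mul_div_cancel₀ _ (by positivity)]
    have : 0 < w ^ (2 * m - 1) * w := by positivity
    linarith
  have h3 : w ^ (2 * m - 1) * θ ≤ θ ^ (2 * m) := by
    calc _ ≤ θ ^ (2 * m - 1) * θ := by gcongr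
      _ = θ ^ (2 * m) := by rw [← pow_succ]; congr 1; omega
  linarith

/-- The typical size of the noise from outside `S` with `B` buckets. -/
def noiseLevel (B : ℕ) (μ : ℝ) : ℝ := 2 ^ 11 * μ / Real.sqrt B

lemma noiseLevel_sq (B : ℕ) (μ : ℝ) : noiseLevel B μ ^ 2 = 2 ^ 12 * (2 ^ 10 / B * μ ^ 2) := by
  rw [noiseLevel, div_pow, Real.sq_sqrt (Nat.cast_nonneg B)]; ring

/-- The degree is m = ⌈R/4⌉. Each squared noise has mean at most w²/2^{12}, there are at most 2^R
subsets, and 12m ≥ 3R, so a factor 4^{-R} survives. -/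
lemma avg_esymmSq_le {n B R : ℕ} [NeZero n] {G : ZMod n → ℝ}
    (hG : IsFlatFilter n B 8 G) (hn : ∃ m : ℕ, n = 2 ^ m) (hB : ∃ β : ℕ, B = 2 ^ β)
    (hR : 1 ≤ R) {Q : Finset (ZMod n)} (x : ZMod n → ℂ) (hx : 0 < l2On Q x) {i : ZMod n}
    (hi : i ∉ Q) :
    avg (fun H : Fin R → Seed n =>
      esymmSq ((R + 3) / 4) (fun s => bucketNoise B G Q x (H s) i) /
        noiseLevel B (l2On Q x) ^ (2 * ((R + 3) / 4) - 1)) ≤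
      noiseLevel B (l2On Q x) * ((1 / 2) ^ R) ^ 2 := by
  set m := (R + 3) / 4 with hm
  set w := noiseLevel B (l2On Q x) with hw
  have hB0 : (0 : ℝ) < B := by obtain ⟨β, rfl⟩ := hB; positivity
  have hw0 : 0 < w := by
    rw [hw, noiseLevel]
    have := Real.sqrt_pos.2 hB0
    positivity
  have h1 : avg (fun H : Fin R → Seed n => esymmSq m fun s => bucketNoise B G Q x (H s) i) ≤
      2 ^ R * (w ^ 2 / 2 ^ 12) ^ m := by
    unfold esymmSq
    rw [avg_sum]
    calc _ ≤ ∑ J ∈ powersetCard m (univ : Finset (Fin R)), (w ^ 2 / 2 ^ 12) ^ m := by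
          refine sum_le_sum fun J hJ => ?_
          rw [avg_pi_prod J fun _ h => bucketNoise B G Q x h i ^ 2, prod_const,
            (mem_powersetCard.1 hJ).2]
          refine pow_le_pow_left₀ (avg_nonneg fun _ => sq_nonneg _) ?_ m
          refine (avg_bucketNoise_sq_le hG hn hB x hi).trans (le_of_eq ?_)
          rw [hw, noiseLevel_sq]; field_simp
      _ ≤ _ := by
          rw [sum_const, card_powersetCard, card_univ, Fintype.card_fin, nsmul_eq_mul]
          gcongr
          exact_mod_cast Nat.choose_le_two_pow R m
  have h2 : w ^ (2 * m) = w ^ (2 * m - 1) * w := by rw [← pow_succ]; congr 1; omega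
  have h3 : (1 / 2 ^ 12 : ℝ) ^ m ≤ ((1 / 2) ^ R) ^ 3 := by
    calc (1 / 2 ^ 12 : ℝ) ^ m = (1 / 2) ^ (12 * m) := by rw [pow_mul]; norm_num
      _ ≤ (1 / 2) ^ (R * 3) := pow_le_pow_of_le_one (by norm_num) (by norm_num) (by omega)
      _ = _ := pow_mul _ _ _
  have h4 : (2 : ℝ) ^ R * (1 / 2) ^ R = 1 := by rw [← mul_pow]; norm_num
  simp only [div_eq_inv_mul _ (w ^ (2 * m - 1))]
  rw [avg_const_mul, inv_mul_le_iff₀ (by positivity)]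
  calc _ ≤ 2 ^ R * (w ^ 2 / 2 ^ 12) ^ m := h1
    _ = 2 ^ R * (w ^ (2 * m) * (1 / 2 ^ 12) ^ m) := by rw [pow_mul w, ← mul_pow]; ring
    _ ≤ 2 ^ R * (w ^ (2 * m) * ((1 / 2) ^ R) ^ 3) := by gcongr
    _ = (2 ^ R * (1 / 2) ^ R) * (w ^ (2 * m) * ((1 / 2) ^ R) ^ 2) := by ring
    _ = _ := by rw [h4, h2]; ring

lemma noiseLevel_le {C₁ : ℕ} (hC : 1 ≤ C₁) {C₂ : ℝ} (hC₂ : 0 < C₂) {k : ℕ} (hk : 1 ≤ k)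
    (t : ℕ) {μ : ℝ} (hμ : 0 ≤ μ) :
    k * noiseLevel (numBuckets C₁ C₂ k t) μ ≤
      2 ^ 11 * (μ * Real.sqrt k) * numReps C₁ t / Real.sqrt C₂ := by
  have hk0 : (0 : ℝ) < k := by exact_mod_cast hk
  have hB := numBuckets_pos C₁ C₂ k t
  have h1 : (Real.sqrt (numBuckets C₁ C₂ k t))⁻¹ ≤
      numReps C₁ t / (Real.sqrt C₂ * Real.sqrt k) := by
    rw [← Real.sqrt_inv, ← Real.sqrt_mul hC₂.le]
    calc _ ≤ Real.sqrt ((numReps C₁ t : ℝ) ^ 2 / (C₂ * k)) :=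
          Real.sqrt_le_sqrt (inv_numBuckets_le hC hC₂ hk t)
      _ = _ := by rw [Real.sqrt_div (sq_nonneg _), Real.sqrt_sq (Nat.cast_nonneg _)]
  have hsk := Real.sqrt_pos.2 hk0
  have hsC := Real.sqrt_pos.2 hC₂
  calc _ = k * (2 ^ 11 * μ) * (Real.sqrt (numBuckets C₁ C₂ k t))⁻¹ := by
        rw [noiseLevel, div_eq_mul_inv]; ring
    _ ≤ k * (2 ^ 11 * μ) * (numReps C₁ t / (Real.sqrt C₂ * Real.sqrt k)) := by gcongr
    _ = (Real.sqrt k * Real.sqrt k) * (2 ^ 11 * μ) *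
        (numReps C₁ t / (Real.sqrt C₂ * Real.sqrt k)) := by rw [Real.mul_self_sqrt hk0.le]
    _ = _ := by field_simp

/-- The excess of the tail noise of coordinate `i` over its typical size in round `t + 1`. -/
def tailExcess {n C₁ T : ℕ} [NeZero n] (C₂ : ℝ) (k : ℕ) (G : Fin T → ZMod n → ℝ)
    (S : Finset (ZMod n)) (x : ZMod n → ℂ) (H : Seeds n C₁ T) (t : Fin T) (i : ZMod n) : ℝ :=
  esymmSq ((numReps C₁ (t + 1) + 3) / 4)
      (fun s => bucketNoise (numBuckets C₁ C₂ k (t + 1)) (G t) Sᶜ x (H t s) i) /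
    noiseLevel (numBuckets C₁ C₂ k (t + 1)) (l2On Sᶜ x) ^
      (2 * ((numReps C₁ (t + 1) + 3) / 4) - 1)

lemma tailExcess_nonneg {n C₁ T : ℕ} [NeZero n] (C₂ : ℝ) (k : ℕ) (G : Fin T → ZMod n → ℝ)
    (S : Finset (ZMod n)) (x : ZMod n → ℂ) (H : Seeds n C₁ T) (t : Fin T) (i : ZMod n) :
    0 ≤ tailExcess C₂ k G S x H t i := by
  refine div_nonneg (esymmSq_nonneg _ _) (pow_nonneg ?_ _)
  unfold noiseLevel l2On; positivity

/-- All of S is charged, not just the part of the round, so the bound holds for every partition at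
once. One factor 2^{-R} absorbs the growth of R; the other makes the rounds summable. -/
lemma avg_sum_tailExcess_le {n C₁ T : ℕ} [NeZero n] (hn : ∃ m : ℕ, n = 2 ^ m) {C₂ : ℝ} {k : ℕ}
    (hC : 1 ≤ C₁) (hC₂ : 1 ≤ C₂) (hk : 1 ≤ k) {S : Finset (ZMod n)} (hS : #S = k)
    {x : ZMod n → ℂ} (hx : 0 < l2On Sᶜ x) {G : Fin T → ZMod n → ℝ}
    (hG : ∀ t : Fin T, IsFlatFilter n (numBuckets C₁ C₂ k (t + 1)) 8 (G t)) :
    avg (fun H : Seeds n C₁ T => ∑ t, ∑ i ∈ S, tailExcess C₂ k G S x H t i) ≤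
      2 ^ 11 * (l2On Sᶜ x * Real.sqrt k) := by
  set μ := l2On Sᶜ x with hμ
  have hC₂0 : 0 < C₂ := by linarith
  have hsC : 1 ≤ Real.sqrt C₂ := by rwa [Real.one_le_sqrt]
  have hround : ∀ t : Fin T, avg (fun H : Seeds n C₁ T => ∑ i ∈ S, tailExcess C₂ k G S x H t i) ≤
      2 ^ 11 * (μ * Real.sqrt k) * (1 / 2 * (1 / 2) ^ (t : ℕ)) := by
    intro t
    have hR := numReps_pos hC (t + 1)
    have hRt : (t : ℕ) + 1 ≤ numReps C₁ (t + 1) := by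
      refine (Nat.lt_two_pow_self (n := (t : ℕ) + 1)).le.trans ?_
      unfold numReps
      exact Nat.le_mul_of_pos_left _ hC
    set R := numReps C₁ (t + 1) with hRdef
    set B := numBuckets C₁ C₂ k (t + 1) with hB
    have h1 : avg (fun H : Seeds n C₁ T => ∑ i ∈ S, tailExcess C₂ k G S x H t i) ≤
        ∑ i ∈ S, noiseLevel B μ * ((1 / 2) ^ R) ^ 2 := by
      rw [avg_sum]
      refine sum_le_sum fun i hi => ?_
      refine avg_pi_le t _ ?_ fun H => ?_
      · rw [noiseLevel]; positivity
      · simp only [tailExcess, Function.update_self]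
        exact avg_esymmSq_le (hG t) hn (numBuckets_isPow _ _ _ _) hR x hx (by simpa using hi)
    refine h1.trans ?_
    rw [sum_const, hS, nsmul_eq_mul, ← mul_assoc]
    have h2 := noiseLevel_le hC hC₂0 hk (t + 1) hx.le
    rw [← hB, ← hRdef] at h2
    have hR2 : (R : ℝ) * (1 / 2) ^ R ≤ 1 := by
      have : (R : ℝ) ≤ 2 ^ R := by exact_mod_cast (Nat.lt_two_pow_self (n := R)).le
      calc _ ≤ (2 : ℝ) ^ R * (1 / 2) ^ R := by gcongr
        _ = 1 := by rw [← mul_pow]; norm_num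
    have hRt2 : (1 / 2 : ℝ) ^ R ≤ 1 / 2 * (1 / 2) ^ (t : ℕ) := by
      rw [← pow_succ']
      exact pow_le_pow_of_le_one (by norm_num) (by norm_num) hRt
    calc _ ≤ 2 ^ 11 * (μ * Real.sqrt k) * R / Real.sqrt C₂ * ((1 / 2) ^ R) ^ 2 := by gcongr
      _ ≤ 2 ^ 11 * (μ * Real.sqrt k) * R / 1 * ((1 / 2) ^ R) ^ 2 := by gcongr
      _ = 2 ^ 11 * (μ * Real.sqrt k) * ((R * (1 / 2) ^ R) * (1 / 2) ^ R) := by ring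
      _ ≤ 2 ^ 11 * (μ * Real.sqrt k) * (1 * (1 / 2 * (1 / 2) ^ (t : ℕ))) := by gcongr
      _ = _ := by ring
  rw [avg_sum]
  refine (sum_le_sum fun t _ => hround t).trans ?_
  rw [← mul_sum, ← mul_sum, Fin.sum_univ_eq_sum_range fun t => (1 / 2 : ℝ) ^ t]
  have := sum_geometric_two_le T
  calc _ ≤ 2 ^ 11 * (μ * Real.sqrt k) * (1 / 2 * 2) := by gcongr
    _ = _ := by ring

/-! ### The good event -/

lemma exists_good_event {n C₁ T : ℕ} [NeZero n] (hn : ∃ m : ℕ, n = 2 ^ m) {δ C₂ : ℝ} {k : ℕ}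
    (hC : 1 ≤ C₁) (hk : 1 ≤ k) {S : Finset (ZMod n)} (hS : #S = k)
    (hstep : ∀ t : ℕ, ∀ q : ℝ, 0 ≤ q → q ≤ sizeBound δ k t → ∀ R B : ℝ,
      R = numReps C₁ (t + 1) → B = numBuckets C₁ C₂ k (t + 1) →
      R * (q * (4 * R / B)) ≤ 1 ∧
      2 * k * (R * (q * (4 * R / B))) ^ ⌊R ^ (-δ) * R⌋₊ + 8 * q ^ 2 * R ^ 4 / B ≤
        (1 / 2) ^ t / 50 * sizeBound δ k (t + 1))
    (Z : Seeds n C₁ T → ℝ) (hZ : ∀ H, 0 ≤ Z H) {M : ℝ} (hM : 0 < M) (hZM : avg Z ≤ M) :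
    ∃ E : Set (Seeds n C₁ T), 1 - 2 / 25 ≤ uniformProb E ∧ ∀ H ∈ E,
      (∀ t ≤ T, (#(partitionStage δ C₂ k S H t) : ℝ) ≤ sizeBound δ k t) ∧ Z H ≤ 25 * M := by
  refine ⟨{H | (∀ t ≤ T, (#(partitionStage δ C₂ k S H t) : ℝ) ≤ sizeBound δ k t) ∧
    Z H ≤ 25 * M}, ?_, fun H h => h⟩
  set E : Set (Seeds n C₁ T) := {H | (∀ t ≤ T,
    (#(partitionStage δ C₂ k S H t) : ℝ) ≤ sizeBound δ k t) ∧ Z H ≤ 25 * M} with hE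
  set F : Fin T → Seeds n C₁ T → ℝ := fun t H =>
    ind ((#(partitionStage δ C₂ k S H t) : ℝ) ≤ sizeBound δ k t ∧
      sizeBound δ k (t + 1) < #(partitionStage δ C₂ k S H (t + 1))) with hF
  have hF0 : ∀ t H, 0 ≤ F t H := fun t H => ind_nonneg _
  have hpt : ∀ H, 1 ≤ ind (H ∈ E) + ∑ t, F t H + (25 * M)⁻¹ * Z H := by
    intro H
    have hs0 : 0 ≤ ∑ t, F t H := sum_nonneg fun t _ => hF0 t H
    have hz0 : 0 ≤ (25 * M)⁻¹ * Z H := mul_nonneg (by positivity) (hZ H)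
    by_cases hzH : Z H ≤ 25 * M
    · by_cases hst : ∀ t ≤ T, (#(partitionStage δ C₂ k S H t) : ℝ) ≤ sizeBound δ k t
      · rw [ind_of (show H ∈ E from ⟨hst, hzH⟩)]; linarith
      -- If some size bound fails, it fails first right after a stage that obeys it, because stage 0
      -- always does.
      · have hex : ∃ t : Fin T, (#(partitionStage δ C₂ k S H t) : ℝ) ≤ sizeBound δ k t ∧
            sizeBound δ k (t + 1) < #(partitionStage δ C₂ k S H (t + 1)) := by
          by_contra hno
          push Not at hno
          refine hst fun t => ?_
          induction t with
          | zero => intro _; simp [partitionStage, sizeBound_zero, hS]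
          | succ t ih => intro ht; exact hno ⟨t, ht⟩ (ih (by omega))
        obtain ⟨t, ht⟩ := hex
        have h1 := single_le_sum (f := fun t => F t H) (fun t _ => hF0 t H) (mem_univ t)
        have h2 : F t H = 1 := ind_of ht
        have := ind_nonneg (H ∈ E)
        simp only [h2] at h1
        linarith
    · have : 1 ≤ (25 * M)⁻¹ * Z H := by
        rw [inv_mul_eq_div, one_le_div (by positivity)]; exact (not_le.1 hzH).le
      linarith [ind_nonneg (H ∈ E)]
  have h1 := avg_mono hpt
  rw [avg_const, avg_add, avg_add, avg_sum, avg_const_mul, ← uniformProb_eq_avg] at h1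
  have h2 : ∑ t, avg (F t) ≤ 1 / 25 := by
    calc _ ≤ ∑ t : Fin T, (1 / 2 : ℝ) ^ (t : ℕ) / 50 :=
          sum_le_sum fun t _ => avg_stage_failure_le hn hC hk hS t (hstep t)
      _ ≤ 2 / 50 := by
          rw [← sum_div, Fin.sum_univ_eq_sum_range fun t => (1 / 2 : ℝ) ^ t]
          have := sum_geometric_two_le T
          gcongr
      _ = _ := by norm_num
  have h3 : (25 * M)⁻¹ * avg Z ≤ 1 / 25 := by
    calc _ ≤ (25 * M)⁻¹ * M := by gcongr
      _ = _ := by field_simp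
  have h4 : ∑ t, avg (F t) = ∑ i, avg fun ω => F i ω := rfl
  linarith

/-! ### Medians -/

/-- A median too large drags all later sorted entries with it, one too small all earlier ones;
either way at least half of the entries are off. -/
lemma abs_median_sub_le {r : ℕ} {u : Fin r → ℝ} {v θ : ℝ}
    (h : 2 * #{s | θ < |u s - v|} < r) : |median u - v| ≤ θ := by
  have hr : 0 < r := by omega
  rw [median, dif_pos hr]
  set idx : Fin r := ⟨r / 2, Nat.div_lt_self hr (by norm_num)⟩ with hidx
  have hmono : Monotone (u ∘ Tuple.sort u) := Tuple.monotone_sort u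
  by_contra hcon
  rw [not_le, lt_abs] at hcon
  have hcard : ∀ A : Finset (Fin r), (∀ j ∈ A, θ < |u (Tuple.sort u j) - v|) →
      #A ≤ #{s | θ < |u s - v|} := fun A hA =>
    card_le_card_of_injOn (Tuple.sort u) (fun j hj => by simpa using hA j hj)
      (Tuple.sort u).injective.injOn
  rcases hcon with hc | hc
  · have h1 := hcard (Ici idx) fun j hj => by
      have h2 : u (Tuple.sort u idx) ≤ u (Tuple.sort u j) := hmono (mem_Ici.1 hj)
      exact lt_of_lt_of_le (by linarith) (le_abs_self _)
    rw [Fin.card_Ici] at h1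
    simp only [hidx] at h1
    omega
  · have h1 := hcard (Iic idx) fun j hj => by
      have h2 : u (Tuple.sort u j) ≤ u (Tuple.sort u idx) := hmono (mem_Iic.1 hj)
      exact lt_of_lt_of_le (by linarith) (neg_le_abs _)
    rw [Fin.card_Iic] at h1
    simp only [hidx] at h1
    omega

lemma median_zero {r : ℕ} : median (fun _ : Fin r => (0 : ℝ)) = 0 := by
  unfold median; split_ifs <;> rfl

/-! ### The error of a single estimate -/

/-- The contribution to bucket `h(i)` of the other elements of the head. -/
def headNoise {n : ℕ} (B : ℕ) (G : ZMod n → ℝ) (S : Finset (ZMod n)) (y : ZMod n → ℂ)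
    (h : Seed n) (i : ZMod n) : ℝ :=
  ∑ j ∈ S.erase i, ‖y j‖ * G (offset B h i j)

lemma norm_singleEstimate_sub_le {n B : ℕ} [NeZero n] {G : ZMod n → ℝ}
    (hG : IsFlatFilter n B 8 G) (hn : ∃ m : ℕ, n = 2 ^ m) (hB : ∃ β : ℕ, B = 2 ^ β)
    (h : Seed n) {S : Finset (ZMod n)} {i : ZMod n} (hi : i ∈ S) {x χ chiHat : ZMod n → ℂ}
    (hχ : ∀ j ∉ S, χ j = 0) {ε : ℝ} (hε : ∀ f, ‖dft χ f - chiHat f‖ ≤ ε) :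
    ‖singleEstimate B G h (dft x) chiHat i - (x - χ) i‖ ≤
      2 * (headNoise B G S (x - χ) h i + bucketNoise B G Sᶜ x h i + n * Real.sqrt n * ε) := by
  set y := x - χ with hy
  set g := G (offset B h i i) with hg
  set ψ : ZMod n → ℂ := fun j => ZMod.stdAddChar (h.2.2 * (h.1 : ZMod n) * j) with hψ
  set err := ((Real.sqrt n : ℝ) : ℂ) * invDft (fun f => dft (fun i => (G i : ℂ)) f *
        permSpectrum h (dft χ - chiHat) f) (bucketCenter n B (bucket B h i)) with herr
  have herr_le : ‖err‖ ≤ n * Real.sqrt n * ε :=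
    norm_sqrt_mul_invDft_filter_le h (fun j => abs_le.2
      ⟨by linarith [hG.nonneg j], hG.le_one j⟩) hε _
  have hg2 : 1 / 2 ≤ g := by
    have := hG.pass _ (circAbs_offset_self_le hn hB h i)
    norm_num at this ⊢
    linarith
  have hg0 : (0 : ℝ) < g := by linarith
  have hgC : (g : ℂ) ≠ 0 := by exact_mod_cast hg0.ne'
  have hψi : ψ i * ZMod.stdAddChar (-(h.2.2 * (h.1 : ZMod n) * i)) = 1 := by
    rw [hψ]
    simp only [← AddChar.map_add_eq_mul]
    simp
  have hψ1 : ∀ j, ‖ψ j‖ = 1 := fun j => norm_stdAddChar _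
  have hsplit : ∑ j, y j * (G (offset B h i j) : ℂ) * ψ j =
      y i * g * ψ i + ∑ j ∈ S.erase i, y j * (G (offset B h i j) : ℂ) * ψ j +
        ∑ j ∈ Sᶜ, x j * (G (offset B h i j) : ℂ) * ψ j := by
    rw [← Finset.sum_add_sum_compl S, ← Finset.add_sum_erase S _ hi]
    congr 1
    refine sum_congr rfl fun j hj => ?_
    rw [hy, Pi.sub_apply, hχ j (mem_compl.1 hj), sub_zero]
  have hmain : singleEstimate B G h (dft x) chiHat i - y i =
      (g : ℂ)⁻¹ * (∑ j ∈ S.erase i, y j * (G (offset B h i j) : ℂ) * ψ j +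
        ∑ j ∈ Sᶜ, x j * (G (offset B h i j) : ℂ) * ψ j + err) *
        ZMod.stdAddChar (-(h.2.2 * (h.1 : ZMod n) * i)) := by
    rw [singleEstimate, hashToBins_eq hG.symm h x χ chiHat i, ← hy, ← hg, ← herr]
    change (g : ℂ)⁻¹ * (∑ j, y j * (G (offset B h i j) : ℂ) * ψ j + err) * _ - y i = _
    rw [hsplit]
    have : (g : ℂ)⁻¹ * (y i * g * ψ i) * ZMod.stdAddChar (-(h.2.2 * (h.1 : ZMod n) * i)) = y i := by
      calc _ = ((g : ℂ)⁻¹ * g) * y i *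
            (ψ i * ZMod.stdAddChar (-(h.2.2 * (h.1 : ZMod n) * i))) := by ring
        _ = _ := by rw [hψi, inv_mul_cancel₀ hgC]; ring
    linear_combination this
  rw [hmain, norm_mul, norm_stdAddChar, mul_one, norm_mul, norm_inv, Complex.norm_real,
    Real.norm_of_nonneg hg0.le]
  have hginv : g⁻¹ ≤ 2 := by rw [inv_le_comm₀ hg0 (by norm_num)]; linarith
  have hhead : ‖∑ j ∈ S.erase i, y j * (G (offset B h i j) : ℂ) * ψ j‖ ≤ headNoise B G S y h i := by
    refine (norm_sum_le _ _).trans (sum_le_sum fun j _ => ?_)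
    rw [norm_mul, norm_mul, hψ1, mul_one, Complex.norm_real, Real.norm_of_nonneg (hG.nonneg _)]
  refine mul_le_mul hginv ?_ (norm_nonneg _) (by norm_num)
  refine (norm_add_le _ _).trans (add_le_add ((norm_add_le _ _).trans (add_le_add hhead ?_)) herr_le)
  exact le_rfl

/-- Markov's inequality over the seeds, kept strict so that it can be added to the tail count. -/
lemma four_mul_card_lt {R : ℕ} (hR : 1 ≤ R) {v : Fin R → ℝ} (hv : ∀ s, 0 ≤ v s) :
    4 * #{s | 4 / R * ∑ r, v r < v s} < R := by
  have hR0 : (0 : ℝ) < R := by exact_mod_cast hR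
  set A := univ.filter fun s => 4 / R * ∑ r, v r < v s with hA
  have hsum : 0 ≤ ∑ r, v r := sum_nonneg fun s _ => hv s
  rcases A.eq_empty_or_nonempty with h | h
  · rw [h]; simp only [card_empty, mul_zero]; omega
  · have h1 : ∑ s ∈ A, 4 / R * ∑ r, v r < ∑ s ∈ A, v s :=
      sum_lt_sum_of_nonempty h fun s hs => (mem_filter.1 hs).2
    have h2 : ∑ s ∈ A, v s ≤ ∑ r, v r :=
      sum_le_sum_of_subset_of_nonneg (subset_univ _) fun s _ _ => hv s
    rw [sum_const, nsmul_eq_mul] at h1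
    have h3 : (#A : ℝ) * (4 / R * ∑ r, v r) < ∑ r, v r := h1.trans_le h2
    have hpos : 0 < ∑ r, v r := by
      rcases hsum.eq_or_lt with h0 | h0
      · rw [← h0] at h3; simp at h3
      · exact h0
    have h4 : (#A : ℝ) * (4 / R) < 1 := by
      by_contra hc
      have : 1 * ∑ r, v r ≤ #A * (4 / R) * ∑ r, v r :=
        mul_le_mul_of_nonneg_right (not_lt.1 hc) hsum
      linarith
    have h5 : (4 * #A : ℝ) < R := by
      rw [mul_div_assoc', div_lt_one hR0] at h4
      linarith
    exact_mod_cast h5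

lemma norm_estimateValues_sub_le {n B R : ℕ} [NeZero n] {G : ZMod n → ℝ}
    (hG : IsFlatFilter n B 8 G) (hn : ∃ m : ℕ, n = 2 ^ m) (hB : ∃ β : ℕ, B = 2 ^ β)
    (hR : 1 ≤ R) (H : Fin R → Seed n) {S P : Finset (ZMod n)} (hPS : P ⊆ S) {i : ZMod n}
    (hi : i ∈ P) {x χ : ZMod n → ℂ} {chiHat : Fin R → ZMod n → ℂ}
    (hχ : ∀ j ∉ S, χ j = 0) {ε : ℝ} (hε : ∀ s f, ‖dft χ f - chiHat s f‖ ≤ ε) {θ : ℝ}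
    (hθ : #{s | θ < bucketNoise B G Sᶜ x (H s) i} < (R + 3) / 4) :
    ‖estimateValues B G H (dft x) chiHat P i - (x - χ) i‖ ≤
      4 * (4 / R * ∑ s, headNoise B G S (x - χ) (H s) i + θ + n * Real.sqrt n * ε) := by
  set θh := 4 / R * ∑ s, headNoise B G S (x - χ) (H s) i with hθh
  have h1 := four_mul_card_lt hR (v := fun s => headNoise B G S (x - χ) (H s) i) fun s =>
    sum_nonneg fun j _ => mul_nonneg (norm_nonneg _) (hG.nonneg _)
  set b := 2 * (θh + θ + n * Real.sqrt n * ε) with hb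
  have hbad : ∀ u : Fin R → ℝ, (∀ s, u s ≤
      ‖singleEstimate B G (H s) (dft x) (chiHat s) i - (x - χ) i‖) → 2 * #{s | b < u s} < R := by
    intro u hu
    have hsub : (univ.filter fun s => b < u s) ⊆
        (univ.filter fun s => θh < headNoise B G S (x - χ) (H s) i) ∪
        (univ.filter fun s => θ < bucketNoise B G Sᶜ x (H s) i) := by
      intro s hs
      have hs' := (mem_filter.1 hs).2
      by_contra hcon
      simp only [mem_union, mem_filter, mem_univ, true_and, not_or, not_lt] at hcon
      have := norm_singleEstimate_sub_le hG hn hB (H s) (hPS hi) (x := x) hχ (hε s)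
      linarith [hu s, hcon.1, hcon.2]
    have h2 := (card_le_card hsub).trans (card_union_le _ _)
    -- The tail count is below ⌈R/4⌉ and the head count below R/4, so together they spoil fewer than
    -- half of the seeds.
    simp only [← hθh] at h1
    omega
  have hre := abs_median_sub_le (v := ((x - χ) i).re) (hbad
    (fun s => |(singleEstimate B G (H s) (dft x) (chiHat s) i).re - ((x - χ) i).re|) fun s => by
      rw [← Complex.sub_re]; exact Complex.abs_re_le_norm _)
  have him := abs_median_sub_le (v := ((x - χ) i).im) (hbad
    (fun s => |(singleEstimate B G (H s) (dft x) (chiHat s) i).im - ((x - χ) i).im|) fun s => by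
      rw [← Complex.sub_im]; exact Complex.abs_im_le_norm _)
  rw [estimateValues, if_pos hi]
  refine (Complex.norm_le_abs_re_add_abs_im _).trans ?_
  rw [Complex.sub_re, Complex.sub_im]
  calc _ ≤ b + b := add_le_add hre him
    _ = _ := by rw [hb]; ring

/-! ### Total head noise in one round -/

/-- The centre j need not lie in P. Points within scale p of j are within scale p+1 of any one of
them, and that one is not crowded; 5 = 1 + 4. -/
lemma card_near_le {n B : ℕ} [NeZero n] {h : Seed n} {lam : ℝ} (hlam : lam ≤ 1)
    {P : Finset (ZMod n)} (hP : ∀ a ∈ P, ¬ IsCrowded lam B h P a) (j : ZMod n) (p : ℕ) :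
    ∑ i ∈ P.erase j, ind ((circAbs (hashPerm h i - hashPerm h j) : ℝ) ≤ (n : ℝ) / B * 2 ^ p) ≤
      5 * 4 ^ p := by
  classical
  rw [← sum_ind_eq_card]
  set A := (P.erase j).filter fun i =>
    (circAbs (hashPerm h i - hashPerm h j) : ℝ) ≤ (n : ℝ) / B * 2 ^ p with hA
  rcases A.eq_empty_or_nonempty with h0 | ⟨a, ha⟩
  · rw [h0]; simp
  · have haP : a ∈ P := mem_of_mem_erase (mem_filter.1 ha).1
    have h1 := hP a haP
    unfold IsCrowded at h1
    push Not at h1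
    have h2 := h1 (p + 1)
    have hsub : (A.erase a : Set (ZMod n)) ⊆ {b : ZMod n | b ∈ P ∧ b ≠ a ∧
        (circAbs (hashPerm h b - hashPerm h a) : ℝ) ≤ (n : ℝ) / B * 2 ^ (p + 1)} := by
      intro b hb
      have hb' := mem_erase.1 (mem_coe.1 hb)
      have hbA := mem_filter.1 hb'.2
      refine ⟨mem_of_mem_erase hbA.1, hb'.1, ?_⟩
      have h3 := circAbs_add_le (hashPerm h b - hashPerm h j) (hashPerm h j - hashPerm h a)
      rw [sub_add_sub_cancel, circAbs_sub_comm (hashPerm h j)] at h3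
      have h4 : (circAbs (hashPerm h b - hashPerm h a) : ℝ) ≤
          circAbs (hashPerm h b - hashPerm h j) + circAbs (hashPerm h a - hashPerm h j) := by
        exact_mod_cast h3
      have h5 := hbA.2
      have h6 := (mem_filter.1 ha).2
      rw [pow_succ, ← mul_assoc]
      linarith
    have h3 := Set.ncard_le_ncard hsub (Set.toFinite _)
    rw [Set.ncard_coe_finset] at h3
    have h3' : (#(A.erase a) : ℝ) ≤ _ := Nat.cast_le.2 h3
    have h4 : #A = #(A.erase a) + 1 := (card_erase_add_one ha).symm
    have h5 : lam * 2 ^ (2 * (p + 1)) ≤ 4 * 4 ^ p := by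
      have h6 : (2 : ℝ) ^ (2 * (p + 1)) = 4 * 4 ^ p := by
        rw [pow_mul, pow_succ]; norm_num; ring
      rw [h6]
      exact mul_le_of_le_one_left (by positivity) hlam
    have h7 : (1 : ℝ) ≤ 4 ^ p := one_le_pow₀ (by norm_num)
    rw [h4]
    push_cast
    linarith

/-- At scale p there are O(4^p) elements, each of weight O(2^{-7p}). The remaining decay allows
inserting a factor 2^pρ ≥ 1, which carries the gain 1/R when there is no collision. -/
lemma sum_filter_le {n B R : ℕ} [NeZero n] {G : ZMod n → ℝ}
    (hG : IsFlatFilter n B 8 G) (hn : ∃ m : ℕ, n = 2 ^ m) (hB : ∃ β : ℕ, B = 2 ^ β)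
    (hR : 1 ≤ R) {h : Seed n} {P : Finset (ZMod n)}
    (hP : ∀ a ∈ P, ¬ IsCrowded (((R : ℝ) ^ 3)⁻¹) B h P a) (j : ZMod n) :
    ∑ i ∈ P.erase j, G (offset B h i j) ≤
      1280 * (ind (∃ i ∈ P, Collides B R h j i) + (R : ℝ)⁻¹) := by
  classical
  have hR1 : (1 : ℝ) ≤ R := by exact_mod_cast hR
  have hn0 : (0 : ℝ) < n := by exact_mod_cast NeZero.pos n
  have hB0 : (0 : ℝ) < B := by obtain ⟨β, rfl⟩ := hB; positivity
  obtain ⟨β, hβ⟩ := hB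
  set ρ : ℝ := ind (∃ i ∈ P, Collides B R h j i) + (R : ℝ)⁻¹ with hρ
  have hρ0 : 0 ≤ ρ := add_nonneg (ind_nonneg _) (by positivity)
  have hpt : ∀ i ∈ P.erase j, G (offset B h i j) ≤ ∑ p ∈ range (β + 1),
      2 ^ 7 * ((1 / 2) ^ 7) ^ p * (2 ^ p * ρ) *
        ind ((circAbs (hashPerm h i - hashPerm h j) : ℝ) ≤ (n : ℝ) / B * 2 ^ p) := by
    intro i hi
    obtain ⟨p, hp, hD, hle⟩ := hG.apply_offset_le hn ⟨β, hβ⟩ hβ.le h i j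
    have h2p : (1 : ℝ) ≤ 2 ^ p := one_le_pow₀ (by norm_num)
    have hone : 1 ≤ 2 ^ p * ρ := by
      by_cases hc : ∃ i ∈ P, Collides B R h j i
      · rw [hρ, ind_of hc]
        have : 0 ≤ (R : ℝ)⁻¹ := by positivity
        nlinarith
      · rw [hρ, ind_of_not hc, zero_add, ← div_eq_mul_inv, one_le_div (by linarith)]
        have hnc : ¬ Collides B R h j i := fun h' => hc ⟨i, mem_of_mem_erase hi, h'⟩
        unfold Collides at hnc
        rw [not_and, not_le, circAbs_sub_comm] at hnc
        have h3 := (hnc (ne_of_mem_erase hi).symm).trans_le hD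
        -- Without a collision the distance exceeds R − 1 buckets; integrality then gives R ≤ 2^p.
        have h4 : (R : ℝ) - 1 < 2 ^ p := lt_of_mul_lt_mul_left h3 (by positivity)
        have h5 : (R : ℝ) < (2 ^ p + 1 : ℕ) := by push_cast; linarith
        have h6 : R ≤ 2 ^ p := Nat.lt_succ_iff.1 (by exact_mod_cast h5)
        exact_mod_cast h6
    have h1 := single_le_sum (f := fun p : ℕ => (2 : ℝ) ^ 7 * ((1 / 2) ^ 7) ^ p * (2 ^ p * ρ) *
        ind ((circAbs (hashPerm h i - hashPerm h j) : ℝ) ≤ (n : ℝ) / B * 2 ^ p))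
        (fun p _ => mul_nonneg (by positivity) (ind_nonneg _)) hp
    refine le_trans ?_ h1
    simp only [ind_of hD, mul_one]
    exact hle.trans (le_mul_of_one_le_right (by positivity) hone)
  refine (sum_le_sum hpt).trans ?_
  rw [sum_comm]
  have hlam : ((R : ℝ) ^ 3)⁻¹ ≤ 1 := inv_le_one_of_one_le₀ (one_le_pow₀ hR1)
  calc _ ≤ ∑ p ∈ range (β + 1), 640 * ρ * (1 / 2 : ℝ) ^ p := by
        refine sum_le_sum fun p _ => ?_
        rw [← mul_sum]
        calc _ ≤ 2 ^ 7 * ((1 / 2) ^ 7) ^ p * (2 ^ p * ρ) * (5 * 4 ^ p) := by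
              gcongr
              exact card_near_le hlam hP j p
          _ = 640 * ρ * (((1 / 2) ^ 7) ^ p * 2 ^ p * 4 ^ p) := by ring
          _ ≤ _ := by
              rw [← mul_pow, ← mul_pow]
              gcongr
              norm_num
    _ ≤ 640 * ρ * 2 := by
        rw [← mul_sum]
        gcongr
        exact sum_geometric_two_le _
    _ = _ := by ring

lemma sum_headNoise_le {n B R : ℕ} [NeZero n] {G : ZMod n → ℝ}
    (hG : IsFlatFilter n B 8 G) (hn : ∃ m : ℕ, n = 2 ^ m) (hB : ∃ β : ℕ, B = 2 ^ β)
    (hR : 1 ≤ R) {δ : ℝ} (hδ : δ ≤ 1) {H : Fin R → Seed n} {S P : Finset (ZMod n)}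
    (hcr : ∀ a ∈ P, ∀ s, ¬ IsCrowded (((R : ℝ) ^ 3)⁻¹) B (H s) P a)
    (hcol : ∀ a ∈ P, ∀ b ∈ S, IsBad δ B H P b → ∀ s, ¬ Collides B R (H s) a b)
    (y : ZMod n → ℂ) :
    ∑ i ∈ P, 4 / R * ∑ s, headNoise B G S y (H s) i ≤ 10240 * (R : ℝ) ^ (-δ) * l1On S y := by
  classical
  have hR1 : (1 : ℝ) ≤ R := by exact_mod_cast hR
  have hpow : 1 ≤ (R : ℝ) ^ (-δ) * R := by
    rw [← Real.rpow_add_one (by positivity)]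
    exact Real.one_le_rpow hR1 (by linarith)
  -- Bad j contribute nothing, because they never collide with P; for the others this is the
  -- definition of not being bad.
  have hcount : ∀ j ∈ S, ∑ s, ind (∃ i ∈ P, Collides B R (H s) j i) ≤ (R : ℝ) ^ (-δ) * R := by
    intro j hj
    by_cases hb : IsBad δ B H P j
    · rw [sum_eq_zero fun s _ => ind_of_not ?_]
      · positivity
      · rintro ⟨i, hi, hc⟩
        refine hcol i hi j hj hb s ⟨hc.1.symm, ?_⟩
        rw [circAbs_sub_comm]; exact hc.2
    · unfold IsBad at hb
      rw [not_lt, Set.ncard_eq_toFinset_card'] at hb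
      rw [← sum_ind_eq_card]
      simpa using hb
  have hj : ∀ j ∈ S, ∑ s, ∑ i ∈ P.erase j, G (offset B (H s) i j) ≤
      2560 * ((R : ℝ) ^ (-δ) * R) := by
    intro j hj
    calc _ ≤ ∑ s, 1280 * (ind (∃ i ∈ P, Collides B R (H s) j i) + (R : ℝ)⁻¹) :=
          sum_le_sum fun s _ => sum_filter_le hG hn hB hR (fun a ha => hcr a ha s) j
      _ = 1280 * (∑ s, ind (∃ i ∈ P, Collides B R (H s) j i) + 1) := by
          rw [← mul_sum, sum_add_distrib]
          simp [mul_inv_cancel₀ (by positivity : (R : ℝ) ≠ 0)]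
      _ ≤ 1280 * ((R : ℝ) ^ (-δ) * R + (R : ℝ) ^ (-δ) * R) := by
          gcongr
          exact hcount j hj
      _ = _ := by ring
  have hswap : ∀ s, ∑ i ∈ P, headNoise B G S y (H s) i =
      ∑ j ∈ S, ‖y j‖ * ∑ i ∈ P.erase j, G (offset B (H s) i j) := by
    intro s
    unfold headNoise
    simp only [mul_sum]
    refine sum_comm' fun i j => ?_
    simp only [mem_erase]
    constructor
    · rintro ⟨h1, h2, h3⟩; exact ⟨⟨h2.symm, h1⟩, h3⟩
    · rintro ⟨⟨h1, h2⟩, h3⟩; exact ⟨h2, h1.symm, h3⟩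
  calc _ = 4 / R * ∑ s, ∑ i ∈ P, headNoise B G S y (H s) i := by
        rw [← mul_sum, sum_comm]
    _ = 4 / R * ∑ j ∈ S, ‖y j‖ * ∑ s, ∑ i ∈ P.erase j, G (offset B (H s) i j) := by
        simp_rw [hswap]
        rw [sum_comm]
        simp_rw [← mul_sum]
    _ ≤ 4 / R * ∑ j ∈ S, ‖y j‖ * (2560 * ((R : ℝ) ^ (-δ) * R)) := by
        gcongr with j hjS
        exact hj j hjS
    _ = _ := by
        rw [← sum_mul, l1On]; field_simp; ring

/-! ### Abstract recurrence -/

/-- A discrete Grönwall argument: errors made in earlier rounds of one pass feed into later rounds,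
but the total gain 1/8 keeps the base of the recurrence below 2Y + 2∑b. -/
lemma sum_err_le {T : ℕ} {err a b : ℕ → ℝ} {Y : ℝ} (hY : 0 ≤ Y) (ha : ∀ t < T, 0 ≤ a t)
    (hb : ∀ t < T, 0 ≤ b t)
    (herr : ∀ t < T, err t ≤ a t * (Y + ∑ s ∈ range t, err s) + b t)
    (hA : ∑ t ∈ range T, a t ≤ 1 / 8) :
    ∑ t ∈ range T, err t ≤ Y / 4 + 2 * ∑ t ∈ range T, b t := by
  set Bt := ∑ t ∈ range T, b t with hBt
  have hpart : ∀ t ≤ T, ∀ f : ℕ → ℝ, (∀ s < T, 0 ≤ f s) →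
      ∑ s ∈ range t, f s ≤ ∑ s ∈ range T, f s := fun t ht f hf =>
    sum_le_sum_of_subset_of_nonneg (range_subset_range.2 ht) fun s hs _ => hf s (mem_range.1 hs)
  have hB0 : 0 ≤ Bt := sum_nonneg fun t ht => hb t (mem_range.1 ht)
  have key : ∀ t ≤ T, ∑ s ∈ range t, err s ≤
      2 * (∑ s ∈ range t, a s) * Y + ∑ s ∈ range t, b s + 2 * (∑ s ∈ range t, a s) * Bt := by
    intro t
    induction t with
    | zero => intro _; simp
    | succ t ih =>
      intro ht
      have ih' := ih (by omega)
      have h1 := herr t (by omega)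
      have ha0 := ha t (by omega)
      have hAt := (hpart t (by omega) a ha).trans hA
      have hAt0 : 0 ≤ ∑ s ∈ range t, a s := sum_nonneg fun s hs => ha s (by
        have := mem_range.1 hs; omega)
      have hBt' := hpart t (by omega) b hb
      rw [← hBt] at hBt'
      rw [sum_range_succ, sum_range_succ, sum_range_succ]
      set A := ∑ s ∈ range t, a s
      have h2 : Y + ∑ s ∈ range t, err s ≤ 2 * Y + 2 * Bt := by
        have e1 : A * Y ≤ 1 / 8 * Y := mul_le_mul_of_nonneg_right hAt hY
        have e2 : A * Bt ≤ 1 / 8 * Bt := mul_le_mul_of_nonneg_right hAt hB0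
        linarith
      have h3 : a t * (Y + ∑ s ∈ range t, err s) ≤ a t * (2 * Y + 2 * Bt) :=
        mul_le_mul_of_nonneg_left h2 ha0
      linarith
  have h1 := key T le_rfl
  have e1 := mul_le_mul_of_nonneg_right hA hY
  have e2 := mul_le_mul_of_nonneg_right hA hB0
  linarith

lemma le_of_contraction {Y : ℕ → ℝ} {D : ℝ} (hD : 0 ≤ D) (h : ∀ r, Y (r + 1) ≤ Y r / 4 + D)
    (r : ℕ) : Y r ≤ (1 / 4) ^ r * Y 0 + 2 * D := by
  induction r with
  | zero => simp; linarith
  | succ r ih => have := h r; rw [pow_succ]; linarith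

/-! ### The reduction loop -/

lemma l1On_nonneg {n : ℕ} (Q : Finset (ZMod n)) (x : ZMod n → ℂ) : 0 ≤ l1On Q x :=
  sum_nonneg fun _ _ => norm_nonneg _

lemma l2On_le_l1On {n : ℕ} (Q : Finset (ZMod n)) (x : ZMod n → ℂ) : l2On Q x ≤ l1On Q x := by
  refine Real.sqrt_le_iff.2 ⟨l1On_nonneg _ _, ?_⟩
  exact sum_sq_le_sq_sum_of_nonneg fun _ _ => norm_nonneg _

/-- Converts precision relative to χ into quantities that the recurrence tracks. -/
lemma l2On_univ_le {n : ℕ} [NeZero n] {S : Finset (ZMod n)} {x χ : ZMod n → ℂ}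
    (hχ : ∀ j ∉ S, χ j = 0) : l2On univ χ ≤ l1On S x + l1On S (x - χ) := by
  have h1 : l2On univ χ = l2On S χ := by
    unfold l2On
    congr 1
    exact (sum_subset (subset_univ S) fun j _ hj => by simp [hχ j hj]).symm
  rw [h1]
  refine (l2On_le_l1On S χ).trans ?_
  unfold l1On
  rw [← sum_add_distrib]
  refine sum_le_sum fun i _ => ?_
  have : χ i = x i - (x - χ) i := by simp
  rw [this]
  exact norm_sub_le _ _

/-- Per-coordinate amplification of the relative error `n^{-c}` of the approximate transform. -/
def precisionFactor (n : ℕ) (c : ℝ) : ℝ := 4 * (n * Real.sqrt n * (n : ℝ) ^ (-c))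

lemma precisionFactor_nonneg (n : ℕ) (c : ℝ) : 0 ≤ precisionFactor n c := by
  unfold precisionFactor; positivity

/-- The error of one application of `EstimateValues`, in terms of the current residual. -/
lemma sum_norm_estimateValues_sub_le {n C₁ T : ℕ} [NeZero n] (hn : ∃ m : ℕ, n = 2 ^ m)
    {δ C₂ : ℝ} (hδ : δ ≤ 1) {k : ℕ} (hC : 1 ≤ C₁) {S : Finset (ZMod n)}
    {G : Fin T → ZMod n → ℝ}
    (hG : ∀ t : Fin T, IsFlatFilter n (numBuckets C₁ C₂ k (t + 1)) 8 (G t))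
    {H : Seeds n C₁ T} {P : Fin T → Finset (ZMod n)} (hP : IsIsolating δ C₂ k S H P)
    {fft : ℕ → ℕ → ℕ → (ZMod n → ℂ) → ZMod n → ℂ} {c : ℝ} (hfft : IsAccurate c fft)
    {x χ : ZMod n → ℂ} (hμ : 0 < l2On Sᶜ x) (hχ : ∀ j ∉ S, χ j = 0) (r : ℕ) (t : Fin T) :
    ∑ i ∈ P t, ‖estimateValues (numBuckets C₁ C₂ k (t + 1)) (G t) (H t) (dft x)
        (fun s => fft r t s χ) (P t) i - (x - χ) i‖ ≤
      (40960 * (numReps C₁ (t + 1) : ℝ) ^ (-δ) + #(P t) * precisionFactor n c) *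
          l1On S (x - χ) +
        (4 * ∑ i ∈ P t, (noiseLevel (numBuckets C₁ C₂ k (t + 1)) (l2On Sᶜ x) +
          tailExcess C₂ k G S x H t i) + #(P t) * precisionFactor n c * l1On S x) := by
  have hR := numReps_pos hC (t + 1)
  have hPS : P t ⊆ S := fun i hi => (hP.cover i).2 ⟨t, hi⟩
  set R := numReps C₁ (t + 1) with hRdef
  set B := numBuckets C₁ C₂ k (t + 1) with hBdef
  have hB := numBuckets_isPow C₁ C₂ k (t + 1)
  have hB0 := numBuckets_pos C₁ C₂ k (t + 1)
  rw [← hBdef] at hB hB0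
  have hw0 : 0 < noiseLevel B (l2On Sᶜ x) := by
    have := Real.sqrt_pos.2 hB0
    unfold noiseLevel; positivity
  set ε := (l1On S x + l1On S (x - χ)) * (n : ℝ) ^ (-c) with hε
  have hacc : ∀ s f, ‖dft χ f - fft r t s χ f‖ ≤ ε := fun s f =>
    (hfft r t s χ f).trans (mul_le_mul_of_nonneg_right (l2On_univ_le hχ) (by positivity))
  have hpt : ∀ i ∈ P t, ‖estimateValues B (G t) (H t) (dft x) (fun s => fft r t s χ) (P t) i -
      (x - χ) i‖ ≤ 4 * (4 / R * ∑ s, headNoise B (G t) S (x - χ) (H t s) i +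
        (noiseLevel B (l2On Sᶜ x) + tailExcess C₂ k G S x H t i) + n * Real.sqrt n * ε) := by
    intro i hi
    refine norm_estimateValues_sub_le (hG t) hn hB hR (H t) hPS hi hχ (fun s f => hacc s f) ?_
    exact card_lt_of_esymmSq (by omega) _ hw0
  refine (sum_le_sum hpt).trans ?_
  have hhead := sum_headNoise_le (hG t) hn hB hR hδ (fun a ha s => hP.not_crowded t a ha s)
    (hP.not_collides t) (x - χ)
  rw [← mul_sum, sum_add_distrib, sum_add_distrib, sum_const, nsmul_eq_mul]
  have hprec : 4 * (#(P t) * (n * Real.sqrt n * ε)) =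
      #(P t) * precisionFactor n c * l1On S (x - χ) + #(P t) * precisionFactor n c * l1On S x := by
    rw [hε, precisionFactor]; ring
  linarith

lemma innerLoop_succ {n C₁ T : ℕ} [NeZero n] (C₂ : ℝ) (k : ℕ) (G : Fin T → ZMod n → ℝ)
    (H : Seeds n C₁ T) (fft : ℕ → ℕ → ℕ → (ZMod n → ℂ) → ZMod n → ℂ) (xHat : ZMod n → ℂ)
    (P : Fin T → Finset (ZMod n)) (r : ℕ) (χ : ZMod n → ℂ) {t : ℕ} (ht : t < T) :
    innerLoop C₂ k G H fft xHat P r χ (t + 1) = innerLoop C₂ k G H fft xHat P r χ t +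
      estimateValues (numBuckets C₁ C₂ k (t + 1)) (G ⟨t, ht⟩) (H ⟨t, ht⟩) xHat
        (fun s => fft r t s (innerLoop C₂ k G H fft xHat P r χ t)) (P ⟨t, ht⟩) := by
  rw [innerLoop]; exact dif_pos ht

lemma innerLoop_support {n C₁ T : ℕ} [NeZero n] {C₂ : ℝ} {k : ℕ} {G : Fin T → ZMod n → ℝ}
    {H : Seeds n C₁ T} {fft : ℕ → ℕ → ℕ → (ZMod n → ℂ) → ZMod n → ℂ} {xHat : ZMod n → ℂ}
    {P : Fin T → Finset (ZMod n)} {S : Finset (ZMod n)} (hPS : ∀ t, P t ⊆ S) {r : ℕ}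
    {χ : ZMod n → ℂ} (hχ : ∀ j ∉ S, χ j = 0) {t : ℕ} (ht : t ≤ T) :
    ∀ j ∉ S, innerLoop C₂ k G H fft xHat P r χ t j = 0 := by
  induction t with
  | zero => exact hχ
  | succ t ih =>
    intro j hj
    have htT : t < T := ht
    rw [innerLoop_succ _ _ _ _ _ _ _ _ _ htT, Pi.add_apply, ih htT.le j hj, estimateValues,
      if_neg fun h => hj (hPS _ h), add_zero]

/-- The residual on `S` after `t` rounds: processed parts carry only estimation errors. -/
lemma l1On_innerLoop {n C₁ T : ℕ} [NeZero n] {C₂ : ℝ} {k : ℕ} {G : Fin T → ZMod n → ℝ}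
    {H : Seeds n C₁ T} {fft : ℕ → ℕ → ℕ → (ZMod n → ℂ) → ZMod n → ℂ} {x : ZMod n → ℂ}
    {P : Fin T → Finset (ZMod n)} {S : Finset (ZMod n)} (hPS : ∀ t, P t ⊆ S)
    (hdisj : ∀ t t', t ≠ t' → Disjoint (P t) (P t')) (r : ℕ) (χ : ZMod n → ℂ)
    {p err : ℕ → ℝ} (hp : ∀ t : Fin T, p t = l1On (P t) (x - χ))
    (herr : ∀ t : Fin T, err t = ∑ i ∈ P t,
      ‖estimateValues (numBuckets C₁ C₂ k (t + 1)) (G t) (H t) (dft x)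
        (fun s => fft r t s (innerLoop C₂ k G H fft (dft x) P r χ t)) (P t) i -
        (x - innerLoop C₂ k G H fft (dft x) P r χ t) i‖) {t : ℕ} (ht : t ≤ T) :
    l1On S (x - innerLoop C₂ k G H fft (dft x) P r χ t) + ∑ s ∈ range t, p s =
        l1On S (x - χ) + ∑ s ∈ range t, err s ∧
      ∀ t' : Fin T, t ≤ t' → ∀ i ∈ P t', innerLoop C₂ k G H fft (dft x) P r χ t i = χ i := by
  induction t with
  | zero => exact ⟨by simp [innerLoop], fun _ _ _ _ => rfl⟩
  | succ t ih =>
    have htT : t < T := ht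
    obtain ⟨ih1, ih2⟩ := ih htT.le
    have hstep := innerLoop_succ C₂ k G H fft (dft x) P r χ htT
    set I := innerLoop C₂ k G H fft (dft x) P r χ t with hI
    set I' := innerLoop C₂ k G H fft (dft x) P r χ (t + 1) with hI'
    have hout : ∀ i ∉ P ⟨t, htT⟩, I' i = I i := by
      intro i hi
      rw [hstep, Pi.add_apply, estimateValues, if_neg hi, add_zero]
    constructor
    · rw [sum_range_succ, sum_range_succ]
      have e1 := hp ⟨t, htT⟩
      have e2 := herr ⟨t, htT⟩
      simp only at e1 e2
      rw [← hI] at e2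
      have e3 : l1On S (x - I') = ∑ i ∈ S \ P ⟨t, htT⟩, ‖(x - I) i‖ + err t := by
        rw [l1On, ← sum_sdiff (hPS ⟨t, htT⟩), e2]
        congr 1
        · refine sum_congr rfl fun i hi => ?_
          rw [Pi.sub_apply, Pi.sub_apply, hout i (mem_sdiff.1 hi).2]
        · refine sum_congr rfl fun i _ => ?_
          rw [hstep, ← norm_neg]
          congr 1
          simp only [Pi.sub_apply, Pi.add_apply]
          ring
      have e4 : l1On S (x - I) = ∑ i ∈ S \ P ⟨t, htT⟩, ‖(x - I) i‖ + p t := by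
        rw [l1On, ← sum_sdiff (hPS ⟨t, htT⟩), e1, l1On]
        congr 1
        refine sum_congr rfl fun i hi => ?_
        rw [Pi.sub_apply, Pi.sub_apply, ih2 ⟨t, htT⟩ le_rfl i hi]
      linarith
    · intro t' ht' i hi
      have hne : t' ≠ ⟨t, htT⟩ := by
        rintro rfl
        simp at ht'
      rw [hout i fun h => disjoint_left.1 (hdisj _ _ hne) hi h]
      exact ih2 t' (by omega) i hi

/-- One outer iteration contracts the residual on `S`, up to noise. -/
lemma l1On_outer_step {n C₁ T : ℕ} [NeZero n] (hn : ∃ m : ℕ, n = 2 ^ m)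
    {δ C₂ : ℝ} (hδ : δ ≤ 1) {k : ℕ} (hC : 1 ≤ C₁) {S : Finset (ZMod n)} (hS : #S = k)
    {G : Fin T → ZMod n → ℝ}
    (hG : ∀ t : Fin T, IsFlatFilter n (numBuckets C₁ C₂ k (t + 1)) 8 (G t))
    {H : Seeds n C₁ T} {P : Fin T → Finset (ZMod n)} (hP : IsIsolating δ C₂ k S H P)
    {fft : ℕ → ℕ → ℕ → (ZMod n → ℂ) → ZMod n → ℂ} {c : ℝ} (hfft : IsAccurate c fft)
    {x χ : ZMod n → ℂ} (hμ : 0 < l2On Sᶜ x) (hχ : ∀ j ∉ S, χ j = 0) (r : ℕ)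
    (hrate : ∑ t : Fin T, 40960 * (numReps C₁ (t + 1) : ℝ) ^ (-δ) ≤ 1 / 16)
    (hprec : k * precisionFactor n c ≤ 1 / 16) :
    l1On S (x - innerLoop C₂ k G H fft (dft x) P r χ T) ≤ l1On S (x - χ) / 4 +
      2 * (4 * ∑ t : Fin T, ∑ i ∈ P t, (noiseLevel (numBuckets C₁ C₂ k (t + 1)) (l2On Sᶜ x) +
          tailExcess C₂ k G S x H t i) + k * precisionFactor n c * l1On S x) := by
  have hPS : ∀ t, P t ⊆ S := fun t i hi => (hP.cover i).2 ⟨t, hi⟩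
  set Y := l1On S (x - χ) with hY
  set κ := precisionFactor n c with hκ
  have hκ0 : 0 ≤ κ := precisionFactor_nonneg n c
  have hSunion : S = univ.biUnion P := by
    ext i; rw [hP.cover]; simp
  have hpd : Set.PairwiseDisjoint (univ : Finset (Fin T)) P := fun t _ t' _ h => hP.disjoint t t' h
  have hcard : ∑ t, (#(P t) : ℝ) = k := by
    rw [← hS, hSunion, card_biUnion fun t _ t' _ h => hP.disjoint t t' h]; push_cast; rfl
  let ext : (Fin T → ℝ) → ℕ → ℝ := fun f t => if h : t < T then f ⟨t, h⟩ else 0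
  have hext : ∀ f (t : Fin T), ext f t = f t := fun f t => by simp [ext]
  have hsum : ∀ f, ∑ t ∈ range T, ext f t = ∑ t, f t := fun f => by
    rw [← Fin.sum_univ_eq_sum_range]; simp only [hext]
  set I := innerLoop C₂ k G H fft (dft x) P r χ with hI
  let p : Fin T → ℝ := fun t => l1On (P t) (x - χ)
  let err : Fin T → ℝ := fun t => ∑ i ∈ P t,
      ‖estimateValues (numBuckets C₁ C₂ k (t + 1)) (G t) (H t) (dft x)
        (fun s => fft r t s (I t)) (P t) i - (x - I t) i‖
  let a : Fin T → ℝ := fun t => 40960 * (numReps C₁ (t + 1) : ℝ) ^ (-δ) + #(P t) * κ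
  let b : Fin T → ℝ := fun t => 4 * ∑ i ∈ P t,
    (noiseLevel (numBuckets C₁ C₂ k (t + 1)) (l2On Sᶜ x) +
          tailExcess C₂ k G S x H t i) + #(P t) * κ * l1On S x
  have hres : ∀ t ≤ T, _ := fun t ht => (l1On_innerLoop hPS hP.disjoint r χ (p := ext p)
    (err := ext err) (hext p) (hext err) ht).1
  have hp0 : ∀ t, 0 ≤ ext p t := by
    intro t
    simp only [ext, p]
    split_ifs
    · exact l1On_nonneg _ _
    · exact le_rfl
  have hlast := hres T le_rfl
  -- After all rounds the parts have used up the whole initial residual, so only estimation errors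
  -- remain.
  have hpY : ∑ t ∈ range T, ext p t = Y := by
    rw [hsum, hY, l1On, hSunion, sum_biUnion hpd]; rfl
  rw [hpY, ← hY] at hlast
  have hwn : ∀ t : Fin T, 0 ≤ noiseLevel (numBuckets C₁ C₂ k (t + 1)) (l2On Sᶜ x) := fun t => by
    unfold noiseLevel; positivity
  have hrec := sum_err_le (T := T) (err := ext err) (a := ext a) (b := ext b) (Y := Y)
    (l1On_nonneg _ _)
    (fun t ht => by rw [hext a ⟨t, ht⟩]; simp only [a]; positivity)
    (fun t ht => by
      rw [hext b ⟨t, ht⟩]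
      have h1 : 0 ≤ ∑ i ∈ P ⟨t, ht⟩, (noiseLevel (numBuckets C₁ C₂ k (t + 1)) (l2On Sᶜ x) +
          tailExcess C₂ k G S x H ⟨t, ht⟩ i) := sum_nonneg fun i _ =>
        add_nonneg (hwn ⟨t, ht⟩) (tailExcess_nonneg _ _ _ _ _ _ _ _)
      have h2 := l1On_nonneg S x
      simp only [b]
      positivity)
    (fun t ht => by
      rw [hext a ⟨t, ht⟩, hext b ⟨t, ht⟩, hext err ⟨t, ht⟩]
      have h1 := sum_norm_estimateValues_sub_le hn hδ hC hG hP hfft (χ := I t) hμ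
        (innerLoop_support hPS hχ ht.le) r ⟨t, ht⟩
      refine h1.trans (add_le_add_left (mul_le_mul_of_nonneg_left ?_ ?_) _)
      · have h2 := hres t ht.le
        have h3 : 0 ≤ ∑ s ∈ range t, ext p s := sum_nonneg fun s _ => hp0 s
        linarith
      · positivity)
    (by
      rw [hsum]
      simp only [a]
      rw [sum_add_distrib, ← sum_mul, hcard]
      linarith)
  have hbt : ∑ t ∈ range T, ext b t = 4 * ∑ t : Fin T, ∑ i ∈ P t,
      (noiseLevel (numBuckets C₁ C₂ k (t + 1)) (l2On Sᶜ x) + tailExcess C₂ k G S x H t i) +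
        k * κ * l1On S x := by
    rw [hsum]
    simp only [b]
    rw [sum_add_distrib, ← mul_sum, ← sum_mul, ← sum_mul, hcard]
  rw [hbt] at hrec
  linarith

lemma outerLoop_support {n C₁ T : ℕ} [NeZero n] {C₂ : ℝ} {k : ℕ} {G : Fin T → ZMod n → ℝ}
    {H : Seeds n C₁ T} {fft : ℕ → ℕ → ℕ → (ZMod n → ℂ) → ZMod n → ℂ} {xHat : ZMod n → ℂ}
    {P : Fin T → Finset (ZMod n)} {S : Finset (ZMod n)} (hPS : ∀ t, P t ⊆ S) (r : ℕ) :
    ∀ j ∉ S, outerLoop C₂ k G H fft xHat P r j = 0 := by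
  induction r with
  | zero => exact fun _ _ => rfl
  | succ r ih => exact innerLoop_support hPS ih le_rfl

/-! ### The zero signal -/

lemma dft_zero {n : ℕ} [NeZero n] : dft (0 : ZMod n → ℂ) = 0 := by
  funext f; simp [dft]

lemma estimateValues_zero {n B r : ℕ} [NeZero n] (G : ZMod n → ℝ) (H : Fin r → Seed n)
    (L : Finset (ZMod n)) : estimateValues B G H 0 (fun _ => 0) L = 0 := by
  have h1 : ∀ s i, singleEstimate B G (H s) 0 0 i = 0 := fun s i => by
    simp [singleEstimate, hashToBins, invDft, permSpectrum]
  funext i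
  simp only [estimateValues, h1, Complex.zero_re, Complex.zero_im, median_zero]
  split_ifs <;> rfl

/-- Relative accuracy forces the approximate transform of 0 to be exactly 0, so the loop never
leaves 0. -/
lemma outerLoop_zero {n C₁ T : ℕ} [NeZero n] {C₂ : ℝ} {k : ℕ} {G : Fin T → ZMod n → ℝ}
    {H : Seeds n C₁ T} {fft : ℕ → ℕ → ℕ → (ZMod n → ℂ) → ZMod n → ℂ} {c : ℝ}
    (hfft : IsAccurate c fft) {P : Fin T → Finset (ZMod n)} (r : ℕ) :
    outerLoop C₂ k G H fft 0 P r = 0 := by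
  have hf : ∀ r t s, fft r t s 0 = 0 := by
    intro r t s
    funext f
    have := hfft r t s 0 f
    simpa [dft_zero, l2On] using this
  have hin : ∀ r t, innerLoop C₂ k G H fft 0 P r 0 t = 0 := by
    intro r t
    induction t with
    | zero => rfl
    | succ t ih =>
      simp only [innerLoop, ih, hf]
      split_ifs
      · rw [estimateValues_zero, add_zero]
      · rfl
  induction r with
  | zero => rfl
  | succ r ih => rw [outerLoop, ih, hin]

/-! ### Thresholds -/

lemma exists_rate_threshold {δ : ℝ} (hδ : 0 < δ) :
    ∃ C₁₀ : ℕ, 1 ≤ C₁₀ ∧ ∀ C₁ : ℕ, C₁₀ ≤ C₁ → ∀ T : ℕ,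
      ∑ t : Fin T, 40960 * (numReps C₁ (t + 1) : ℝ) ^ (-δ) ≤ 1 / 16 := by
  have hr0 : (0 : ℝ) < 2 ^ (-δ) := by positivity
  have hr1 : (2 : ℝ) ^ (-δ) < 1 := Real.rpow_lt_one_of_one_lt_of_neg (by norm_num) (by linarith)
  set ρ : ℝ := 2 ^ (-δ) with hρ
  -- Here 655360 = 16·40960, and C₁^δ must dominate the geometric sum.
  have hD : 0 < 655360 / (1 - ρ) := div_pos (by norm_num) (by linarith)
  set D := 655360 / (1 - ρ) with hDdef
  refine ⟨max 1 ⌈D ^ (1 / δ)⌉₊, le_max_left _ _, fun C₁ hC T => ?_⟩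
  have hC1 : 1 ≤ C₁ := (le_max_left _ _).trans hC
  have hC1' : (1 : ℝ) ≤ C₁ := by exact_mod_cast hC1
  have hC2 : D ^ (1 / δ) ≤ C₁ := Nat.ceil_le.1 ((le_max_right _ _).trans hC)
  have hCD : D ≤ (C₁ : ℝ) ^ δ := by
    have := Real.rpow_le_rpow (by positivity) hC2 hδ.le
    rwa [← Real.rpow_mul hD.le, one_div_mul_cancel hδ.ne', Real.rpow_one] at this
  have hterm : ∀ t : Fin T, 40960 * (numReps C₁ (t + 1) : ℝ) ^ (-δ) ≤ 40960 * D⁻¹ * ρ ^ (t : ℕ) := by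
    intro t
    rw [numReps_cast, Real.mul_rpow (by positivity) (by positivity), mul_assoc]
    gcongr
    · rw [Real.rpow_neg (by positivity)]
      gcongr
    · rw [← Real.rpow_natCast, ← Real.rpow_mul (by norm_num), mul_comm, two_rpow_mul_natCast]
      exact pow_le_pow_of_le_one hr0.le hr1.le (Nat.le_succ _)
  refine (sum_le_sum fun t _ => hterm t).trans ?_
  rw [← mul_sum, Fin.sum_univ_eq_sum_range fun t => ρ ^ t]
  have hgeo : ∑ t ∈ range T, ρ ^ t ≤ (1 - ρ)⁻¹ := by
    rw [← tsum_geometric_of_lt_one hr0.le hr1]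
    exact (summable_geometric_of_lt_one hr0.le hr1).sum_le_tsum _ fun _ _ => by positivity
  have h1 : 0 < 1 - ρ := by linarith
  calc _ ≤ 40960 * D⁻¹ * (1 - ρ)⁻¹ := by gcongr
    _ = 1 / 16 := by rw [hDdef]; field_simp; norm_num

/-- The growth of R_t in the noise level cancels the factor 2^{-t} of the size bound; doubly
exponential decay makes the rounds summable, and √C₂ absorbs the constant. -/
lemma exists_noise_threshold {δ : ℝ} (hδ : δ < 1 / 2) {C₁ : ℕ} (hC : 1 ≤ C₁) :
    ∃ C₂₀ : ℝ, 0 < C₂₀ ∧ ∀ C₂ : ℝ, C₂₀ ≤ C₂ → ∀ k : ℕ, 1 ≤ k → ∀ μ : ℝ, 0 ≤ μ → ∀ T : ℕ,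
      ∑ t : Fin T, sizeBound δ k t * noiseLevel (numBuckets C₁ C₂ k (t + 1)) μ ≤
        μ * Real.sqrt k := by
  obtain ⟨M, hM0, hM⟩ := exists_pow_mul_dblExp_le hδ
  have hC0 : (0 : ℝ) < C₁ := by exact_mod_cast hC
  refine ⟨(2 ^ 14 * C₁ * M) ^ 2, by positivity, fun C₂ hC₂ k hk μ hμ T => ?_⟩
  have hC₂0 : 0 < C₂ := lt_of_lt_of_le (by positivity) hC₂
  have hs : 2 ^ 14 * C₁ * M ≤ Real.sqrt C₂ := Real.le_sqrt_of_sq_le hC₂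
  have hs0 := Real.sqrt_pos.2 hC₂0
  have hterm : ∀ t : Fin T, sizeBound δ k t * noiseLevel (numBuckets C₁ C₂ k (t + 1)) μ ≤
      2 ^ 13 * C₁ * M / Real.sqrt C₂ * (μ * Real.sqrt k) * (1 / 2) ^ (t : ℕ) := by
    intro t
    have hD0 := dblExp_pos δ t
    have hE : dblExp δ t ≤ M * (1 / 2) ^ (t : ℕ) := by
      have h8 : (8 : ℝ) ^ (t : ℕ) * (1 / 8) ^ (t : ℕ) = 1 := by rw [← mul_pow]; norm_num
      calc dblExp δ t = (8 : ℝ) ^ (t : ℕ) * dblExp δ t * (1 / 8) ^ (t : ℕ) := by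
            rw [mul_right_comm, h8, one_mul]
        _ ≤ M * (1 / 2) ^ (t : ℕ) := by gcongr; exact hM t; norm_num
    have h2 : ((1 : ℝ) / 2) ^ (t : ℕ) * 2 ^ (t : ℕ) = 1 := by rw [← mul_pow]; norm_num
    calc _ = (1 / 2) ^ (t : ℕ) * (2 * dblExp δ t) *
          (k * noiseLevel (numBuckets C₁ C₂ k (t + 1)) μ) := by rw [sizeBound]; ring
      _ ≤ (1 / 2) ^ (t : ℕ) * (2 * dblExp δ t) *
          (2 ^ 11 * (μ * Real.sqrt k) * numReps C₁ (t + 1) / Real.sqrt C₂) := by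
          gcongr
          exact noiseLevel_le hC hC₂0 hk _ hμ
      _ = ((1 / 2) ^ (t : ℕ) * 2 ^ (t : ℕ)) * (2 ^ 13 * C₁ / Real.sqrt C₂ *
          (μ * Real.sqrt k) * dblExp δ t) := by rw [numReps_cast, pow_succ]; ring
      _ ≤ 1 * (2 ^ 13 * C₁ / Real.sqrt C₂ * (μ * Real.sqrt k) * (M * (1 / 2) ^ (t : ℕ))) := by
          rw [h2]; gcongr
      _ = _ := by ring
  refine (sum_le_sum fun t _ => hterm t).trans ?_
  rw [← mul_sum, Fin.sum_univ_eq_sum_range fun t => (1 / 2 : ℝ) ^ t]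
  calc _ ≤ 2 ^ 13 * C₁ * M / Real.sqrt C₂ * (μ * Real.sqrt k) * 2 := by
        gcongr
        exact sum_geometric_two_le T
    _ = 2 ^ 14 * C₁ * M / Real.sqrt C₂ * (μ * Real.sqrt k) := by ring
    _ ≤ 1 * (μ * Real.sqrt k) := by
        gcongr
        rwa [div_le_one hs0]
    _ = _ := one_mul _

lemma card_mul_precisionFactor_le {n k : ℕ} (hn : 2 ≤ n) (hk : k ≤ n) {A c Rstar : ℝ}
    (hR : Rstar ≤ (n : ℝ) ^ A) (hR0 : 0 ≤ Rstar) (hc : max 9 (A + 5) ≤ c) :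
    k * precisionFactor n c ≤ 1 / 16 ∧ k * precisionFactor n c * Rstar ≤ 1 := by
  have hn2 : (2 : ℝ) ≤ n := by exact_mod_cast hn
  have hn0 : (0 : ℝ) < n := by linarith
  have hkn : (k : ℝ) ≤ n := by exact_mod_cast hk
  have hsq : Real.sqrt n ≤ n := by
    rw [Real.sqrt_le_left hn0.le]; nlinarith
  -- The factors k, n and √n are each at most n. Then c ≥ 9 gives the absolute bound, and c ≥ A + 5
  -- also pays for R* ≤ n^A.
  have hmain : k * precisionFactor n c ≤ 4 * (n : ℝ) ^ (3 - c) := by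
    unfold precisionFactor
    calc _ ≤ n * (4 * (n * n * (n : ℝ) ^ (-c))) := by gcongr
      _ = 4 * (n : ℝ) ^ (3 - c) := by
        have h3 : (n : ℝ) ^ (3 : ℝ) = (n : ℝ) ^ 3 := by exact_mod_cast Real.rpow_natCast (n : ℝ) 3
        rw [sub_eq_add_neg, Real.rpow_add hn0, h3]; ring
  have hsmall : ∀ e : ℝ, e ≤ -2 → (n : ℝ) ^ e ≤ 1 / 4 := by
    intro e he
    calc (n : ℝ) ^ e ≤ n ^ (-2 : ℝ) := Real.rpow_le_rpow_of_exponent_le (by linarith) he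
      _ ≤ 2 ^ (-2 : ℝ) := Real.rpow_le_rpow_of_nonpos (by norm_num) hn2 (by norm_num)
      _ = 1 / 4 := by rw [Real.rpow_neg (by norm_num)]; norm_num
  have hc9 := (le_max_left _ _).trans hc
  have hcA := (le_max_right _ _).trans hc
  constructor
  · refine hmain.trans ?_
    have h1 : (n : ℝ) ^ (3 - c) ≤ n ^ (-2 : ℝ) * (n ^ (-2 : ℝ) * n ^ (-2 : ℝ)) := by
      rw [← Real.rpow_add hn0, ← Real.rpow_add hn0]
      exact Real.rpow_le_rpow_of_exponent_le (by linarith) (by linarith)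
    have h2 := hsmall (-2) le_rfl
    have h3 : (n : ℝ) ^ (-2 : ℝ) * (n ^ (-2 : ℝ) * n ^ (-2 : ℝ)) ≤ 1 / 4 * (1 / 4 * (1 / 4)) := by
      gcongr
    linarith
  · calc _ ≤ 4 * (n : ℝ) ^ (3 - c) * n ^ A := by gcongr
      _ = 4 * (n : ℝ) ^ (3 - c + A) := by rw [Real.rpow_add hn0]; ring
      _ ≤ 4 * (1 / 4) := by gcongr; exact hsmall _ (by linarith)
      _ = 1 := by norm_num

lemma le_four_pow_ceil {C Rstar : ℝ} (hC : 1 ≤ C) (hR : 0 < Rstar) :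
    Rstar ≤ 4 ^ (⌈C * Real.logb 4 Rstar⌉₊ + 1) := by
  rcases le_total Rstar 1 with h | h
  · exact h.trans (one_le_pow₀ (by norm_num))
  · have h0 : 0 ≤ Real.logb 4 Rstar := Real.logb_nonneg (by norm_num) h
    have h1 : Real.logb 4 Rstar ≤ (⌈C * Real.logb 4 Rstar⌉₊ + 1 : ℕ) := by
      push_cast
      have := Nat.le_ceil (C * Real.logb 4 Rstar)
      nlinarith
    rwa [Real.logb_le_iff_le_rpow (by norm_num) hR, Real.rpow_natCast] at h1

lemma l1On_reducedVector_le {n C₁ T : ℕ} [NeZero n] (hn : ∃ m : ℕ, n = 2 ^ m)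
    {δ C₂ : ℝ} (hδ : δ ≤ 1) {k : ℕ} (hk : 1 ≤ k) (hC : 1 ≤ C₁) {S : Finset (ZMod n)} (hS : #S = k)
    {G : Fin T → ZMod n → ℝ}
    (hG : ∀ t : Fin T, IsFlatFilter n (numBuckets C₁ C₂ k (t + 1)) 8 (G t))
    {H : Seeds n C₁ T} {P : Fin T → Finset (ZMod n)} (hP : IsIsolating δ C₂ k S H P)
    {fft : ℕ → ℕ → ℕ → (ZMod n → ℂ) → ZMod n → ℂ} {c : ℝ} (hfft : IsAccurate c fft)
    {x : ZMod n → ℂ} (hμ : 0 < l2On Sᶜ x) {C Rstar : ℝ} (hC1 : 1 ≤ C) (hR0 : 0 < Rstar)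
    (hx : ∀ i, ‖x i‖ ≤ Rstar * l2On Sᶜ x / Real.sqrt k)
    (hrate : ∑ t : Fin T, 40960 * (numReps C₁ (t + 1) : ℝ) ^ (-δ) ≤ 1 / 16)
    (hprec : k * precisionFactor n c ≤ 1 / 16 ∧ k * precisionFactor n c * Rstar ≤ 1)
    (hlevel : ∑ t : Fin T, sizeBound δ k t *
      noiseLevel (numBuckets C₁ C₂ k (t + 1)) (l2On Sᶜ x) ≤ l2On Sᶜ x * Real.sqrt k)
    (hZ : ∑ t, ∑ i ∈ S, tailExcess C₂ k G S x H t i ≤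
      25 * (2 ^ 11 * (l2On Sᶜ x * Real.sqrt k))) :
    l1On S (x - reducedVector C₂ k G H fft (dft x) P C Rstar) ≤
      2 ^ 20 * (l2On Sᶜ x * Real.sqrt k) := by
  have hPS : ∀ t, P t ⊆ S := fun t i hi => (hP.cover i).2 ⟨t, hi⟩
  have hk0 : (0 : ℝ) < k := by exact_mod_cast hk
  have hsk := Real.sqrt_pos.2 hk0
  set W := l2On Sᶜ x * Real.sqrt k with hW
  have hW0 : 0 < W := by positivity
  have hX : l1On S x ≤ Rstar * W := by
    calc l1On S x ≤ ∑ i ∈ S, Rstar * l2On Sᶜ x / Real.sqrt k := sum_le_sum fun i _ => hx i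
      _ = (Real.sqrt k * Real.sqrt k) * (Rstar * l2On Sᶜ x / Real.sqrt k) := by
        rw [sum_const, hS, nsmul_eq_mul, Real.mul_self_sqrt hk0.le]
      _ = _ := by rw [hW]; field_simp
  have htail : ∑ t : Fin T, ∑ i ∈ P t, (noiseLevel (numBuckets C₁ C₂ k (t + 1)) (l2On Sᶜ x) +
      tailExcess C₂ k G S x H t i) ≤ W + 25 * (2 ^ 11 * W) := by
    simp only [sum_add_distrib]
    refine add_le_add (le_trans (sum_le_sum fun t _ => ?_) hlevel)
      (le_trans (sum_le_sum fun t _ => ?_) hZ)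
    · rw [sum_const, nsmul_eq_mul]
      have := hP.size t
      rw [sizeBound_eq hC] at this
      refine mul_le_mul_of_nonneg_right this ?_
      unfold noiseLevel; positivity
    · exact sum_le_sum_of_subset_of_nonneg (hPS t) fun i _ _ => tailExcess_nonneg _ _ _ _ _ _ _ _
  have hpX : k * precisionFactor n c * l1On S x ≤ W := by
    have h0 : 0 ≤ k * precisionFactor n c := mul_nonneg hk0.le (precisionFactor_nonneg n c)
    calc _ ≤ k * precisionFactor n c * (Rstar * W) := by gcongr
      _ = k * precisionFactor n c * Rstar * W := by ring
      _ ≤ 1 * W := by gcongr; exact hprec.2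
      _ = W := one_mul _
  -- The exact additive constant is 2(4(1 + 25·2^{11}) + 1) = 409610, rounded up so that twice it
  -- plus 1 stays below 2^{20}.
  have hstep : ∀ r, l1On S (x - outerLoop C₂ k G H fft (dft x) P (r + 1)) ≤
      l1On S (x - outerLoop C₂ k G H fft (dft x) P r) / 4 + 2 ^ 18 * (7 / 4 * W) := by
    intro r
    have := l1On_outer_step hn hδ hC hS hG hP hfft (χ := outerLoop C₂ k G H fft (dft x) P r) hμ
      (outerLoop_support hPS r) r hrate hprec.1
    refine this.trans (add_le_add_right ?_ _)
    linarith
  have hfin := le_of_contraction (Y := fun r => l1On S (x - outerLoop C₂ k G H fft (dft x) P r))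
    (by positivity) hstep (⌈C * Real.logb 4 Rstar⌉₊ + 1)
  have hzero : l1On S (x - outerLoop C₂ k G H fft (dft x) P 0) = l1On S x := by
    simp [outerLoop]
  simp only [hzero] at hfin
  have h4 : (1 / 4 : ℝ) ^ (⌈C * Real.logb 4 Rstar⌉₊ + 1) * l1On S x ≤ W := by
    have h5 := le_four_pow_ceil hC1 hR0
    set N := ⌈C * Real.logb 4 Rstar⌉₊ + 1
    have h6 : (1 / 4 : ℝ) ^ N * 4 ^ N = 1 := by rw [← mul_pow]; norm_num
    calc _ ≤ (1 / 4 : ℝ) ^ N * (4 ^ N * W) := by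
          gcongr
          exact hX.trans (by gcongr)
      _ = W := by rw [← mul_assoc, h6, one_mul]
  unfold reducedVector
  linarith

end

end SparseFourier

theorem mainTheorem6 (δ : ℝ) (hδ₀ : 0 < δ) (hδ₁ : δ < 1 / 2) :
    ∃ (K : ℝ) (CT₀ C₁₀ : ℕ) (c₀ : ℝ → ℝ), 0 < K ∧
    ∀ C₁ : ℕ, C₁₀ ≤ C₁ → ∃ C₂₀ : ℝ, ∀ C₂ : ℝ, C₂₀ ≤ C₂ → ∀ CT : ℕ, CT₀ ≤ CT →
    ∀ (n : ℕ) [NeZero n], (∃ m : ℕ, n = 2 ^ m) →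
    ∀ (k : ℕ), 1 ≤ k → ∀ S : Finset (ZMod n), S.card = k →
    ∀ (x : ZMod n → ℂ) (Rstar A c C : ℝ), 0 < Rstar → Rstar ≤ (n : ℝ) ^ A → c₀ A ≤ c → 1 ≤ C →
    (∀ i, ‖x i‖ ≤ Rstar * SparseFourier.l2On Sᶜ x / Real.sqrt k) →
    ∀ G : Fin (SparseFourier.numRounds δ CT k) → ZMod n → ℝ,
    (∀ t : Fin (SparseFourier.numRounds δ CT k),
      SparseFourier.IsFlatFilter n (SparseFourier.numBuckets C₁ C₂ k ((t : ℕ) + 1)) 8 (G t)) →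
    ∃ E : Set (SparseFourier.Seeds n C₁ (SparseFourier.numRounds δ CT k)),
      1 - 2 / 25 ≤ SparseFourier.uniformProb E ∧
      ∀ H ∈ E,
        SparseFourier.partitionStage δ C₂ k S H (SparseFourier.numRounds δ CT k) = ∅ ∧
        SparseFourier.IsIsolating δ C₂ k S H (SparseFourier.constructPartition δ C₂ k S H) ∧
        ∀ P : Fin (SparseFourier.numRounds δ CT k) → Finset (ZMod n),
          SparseFourier.IsIsolating δ C₂ k S H P →
          ∀ fft : ℕ → ℕ → ℕ → (ZMod n → ℂ) → ZMod n → ℂ, SparseFourier.IsAccurate c fft →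
            SparseFourier.l1On S (x - SparseFourier.reducedVector C₂ k G H fft
                (SparseFourier.dft x) P C Rstar) ≤
              K * (SparseFourier.l2On Sᶜ x * Real.sqrt k) := by 
  classical
  obtain ⟨C₁₀, hC₁₀, hrate⟩ := SparseFourier.exists_rate_threshold hδ₀
  refine ⟨2 ^ 20, 1, C₁₀, fun A => max 9 (A + 5), by norm_num, fun C₁ hC₁ => ?_⟩
  have hC : 1 ≤ C₁ := hC₁₀.trans hC₁
  obtain ⟨D₁, _, hstep⟩ := SparseFourier.exists_partition_threshold hδ₀ hδ₁ hC
  obtain ⟨D₂, _, hlevel⟩ := SparseFourier.exists_noise_threshold hδ₁ hC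
  refine ⟨max 1 (max D₁ D₂), fun C₂ hC₂ CT hCT n _ hn k hk S hS x Rstar A c C hR0 hRA hc hC1
    hx => ?_⟩
  have hC₂1 : 1 ≤ C₂ := (le_max_left _ _).trans hC₂
  have hD₁ : D₁ ≤ C₂ := ((le_max_left _ _).trans (le_max_right _ _)).trans hC₂
  have hD₂ : D₂ ≤ C₂ := ((le_max_right _ _).trans (le_max_right _ _)).trans hC₂
  have hk0 : (0 : ℝ) < k := by exact_mod_cast hk
  have hTlt := SparseFourier.sizeBound_numRounds_lt_one hδ₁ hCT hk
  -- From here on T matters only through the final size bound being below 1.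
  generalize SparseFourier.numRounds δ CT k = T at hTlt ⊢
  intro G hG
  have hpart : ∀ H : SparseFourier.Seeds n C₁ T,
      (∀ t ≤ T, ((SparseFourier.partitionStage δ C₂ k S H t).card : ℝ) ≤
        SparseFourier.sizeBound δ k t) →
      SparseFourier.partitionStage δ C₂ k S H T = ∅ ∧
        SparseFourier.IsIsolating δ C₂ k S H (SparseFourier.constructPartition δ C₂ k S H) := by
    intro H hH
    have hempty : SparseFourier.partitionStage δ C₂ k S H T = ∅ := by
      have h1 := (hH T le_rfl).trans_lt hTlt
      exact Finset.card_eq_zero.1 (Nat.lt_one_iff.1 (by exact_mod_cast h1))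
    exact ⟨hempty, SparseFourier.isIsolating_constructPartition hC (fun t => hH t t.2.le) hempty⟩
  have hμ0 : 0 ≤ SparseFourier.l2On Sᶜ x := Real.sqrt_nonneg _
  rcases hμ0.eq_or_lt with hμ | hμ
  -- With no tail the sup-norm hypothesis kills x. This case is separate because `tailExcess`
  -- divides by the noise level.
  · have hx0 : x = 0 := by
      funext i
      have := hx i
      rw [← hμ] at this
      simpa using this
    obtain ⟨E, hE, hEH⟩ := SparseFourier.exists_good_event hn hC hk hS (hstep C₂ hD₁ k hk)
      (fun _ : SparseFourier.Seeds n C₁ T => 0) (fun _ => le_rfl) one_pos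
      ((SparseFourier.avg_const_le le_rfl).trans zero_le_one)
    refine ⟨E, hE, fun H hH => ?_⟩
    obtain ⟨h1, h2⟩ := hpart H (hEH H hH).1
    refine ⟨h1, h2, fun P _ fft hfft => ?_⟩
    rw [← hμ, hx0, SparseFourier.dft_zero, SparseFourier.reducedVector,
      SparseFourier.outerLoop_zero hfft]
    simp [SparseFourier.l1On]
  -- For n = 1 the set S would be everything and the tail would vanish; n ≥ 2 is what makes n^{-c}
  -- small.
  · have hn2 : 2 ≤ n := by
      by_contra hlt
      have hpos := NeZero.pos n
      have hn1 : n = 1 := by omega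
      subst hn1
      have hSu : S = Finset.univ := by
        refine (Finset.card_eq_iff_eq_univ S).1 ?_
        have h1 : S.card ≤ Fintype.card (ZMod 1) := Finset.card_le_univ S
        have h2 : Fintype.card (ZMod 1) = 1 := ZMod.card 1
        omega
      rw [hSu, Finset.compl_univ] at hμ
      simp [SparseFourier.l2On] at hμ
    have hkn : k ≤ n := by
      rw [← hS]
      exact (Finset.card_le_univ S).trans (ZMod.card n).le
    have hprec := SparseFourier.card_mul_precisionFactor_le hn2 hkn hRA hR0.le hc
    obtain ⟨E, hE, hEH⟩ := SparseFourier.exists_good_event hn hC hk hS (hstep C₂ hD₁ k hk)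
      (fun H : SparseFourier.Seeds n C₁ T => ∑ t, ∑ i ∈ S,
        SparseFourier.tailExcess C₂ k G S x H t i)
      (fun H => Finset.sum_nonneg fun t _ => Finset.sum_nonneg fun i _ =>
        SparseFourier.tailExcess_nonneg _ _ _ _ _ _ _ _)
      (mul_pos (by norm_num) (mul_pos hμ (Real.sqrt_pos.2 hk0)))
      (SparseFourier.avg_sum_tailExcess_le hn hC hC₂1 hk hS hμ hG)
    refine ⟨E, hE, fun H hH => ?_⟩
    obtain ⟨hsize, hZ⟩ := hEH H hH
    obtain ⟨h1, h2⟩ := hpart H hsize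
    exact ⟨h1, h2, fun P hP fft hfft => SparseFourier.l1On_reducedVector_le hn (by linarith) hk hC
      hS hG hP hfft hμ hC1 hR0 hx (hrate C₁ hC₁ T) hprec
      (hlevel C₂ hD₂ k hk _ hμ0 T) hZ⟩
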